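/- **Logic.** Fix a first-order vocabulary $L$ and variables $v_0,v_1,\dots$. Formulas of independence logic $\mathcal I$ over $L$ (with equality) are: all first-order formulas; the independence atoms $t_1\bot_{t_3}t_2$ for finite, possibly empty, tuples of terms $t_1,t_2,t_3$ (written $t_1\bot t_2$ if $t_3$ is empty); and everything obtained from these by $\wedge,\vee,\exists x,\forall x$ (so negation is applied to first-order formulas only). $\mathrm{Fr}(\phi)$ is the set of free variables, where all the variables of an atom are free in it; a sentence is a formula without free variables. Let $M$ be a (nonempty) $L$-structure and let a team $X$ be a set of assignments. Then $M\models_X\phi$ for first-order $\phi$ iff $M\models_s\phi$ for all $s\in X$; $M\models_X t_1\bot_{t_3}t_2$ iff for all $s,s'\in X$ that agree on $t_3$ there is $s''\in X$ that agrees with $s$ on $t_1t_3$ and with $s'$ on $t_2$; $M\models_X\psi\vee\theta$ iff $X=Y\cup Z$ with $M\models_Y\psi$ and $M\models_Z\theta$; $M\models_X\psi\wedge\theta$ iff $M\models_X\psi$ and $M\models_X\theta$; $M\models_X\exists x\psi$ iff there is $F:X\to\mathcal P(M)\setminus\{\emptyset\}$ with $M\models_{\{s(a/x)\,:\,s\in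 X,\ a\in F(s)\}}\psi$; $M\models_X\forall x\psi$ iff $M\models_{\{s(a/x)\,:\,s\in X,\ a\in M\}}\psi$. Formulas are logically equivalent if the same teams of the same structures satisfy them. **Deduction system.** $\Gamma\vdash_{\mathcal I}\psi$ means that $\psi$ has a natural deduction, consisting of formulas of $\mathcal I$, with non-discharged assumptions in $\Gamma$, by the rules below. $A(t/x)$ is $A$ with $t$ in place of the free occurrences of $x$; it is presumed that no variable of $t$ becomes bound. $[A]$ is a discharged assumption, and "open assumptions" are the non-discharged ones. * The usual introduction and elimination rules of $\wedge$; $\vee$-introduction; from $A\vee B$ and derivations of $C$ from $[A]$ and from $[B]$ infer $C$, if $C$ is first-order; from a derivation of $B\wedge\neg B$ from $[A]$ infer $\neg A$, and from $\neg\neg A$ infer $A$, for first-order $A,B$; from $A$ infer $\forall xA$, if $x$ is not free in the open assumptions used in deriving $A$; from $\forall xA$ infer $A(t/x)$, for first-order $A$; from $A(t/x)$ infer $\exists xA$; from $\exists xA$ and a derivation of $B$ from $[A]$ infer $B$, if $x$ is free neither in $B$ nor in the open assumptions other than $A$ used in deriving $B$. * (1) From $A\vee B$ and a derivation of $C$ from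 $[B]$ infer $A\vee C$. (2) From $B\vee A$ infer $A\vee B$; from $(A\vee B)\vee C$ infer $A\vee(B\vee C)$. * (3) From $\forall xA\vee B$ infer $\forall x((A\wedge x\bot y)\vee B)$, where $y$ lists $\mathrm{Fr}(A\vee B)\setminus\{x\}$ and $x\notin\mathrm{Fr}(B)$. (4) From $\exists xA\vee B$ infer $\exists x(A\vee B)$, if $x\notin\mathrm{Fr}(B)$. * (5) From $\forall xA$ and a derivation of $B$ from $[A(y/x)]$ infer $\forall yB$, if $y$ is free neither in $\forall xA$ nor in the open assumptions other than $A(y/x)$ used in deriving $B$. * (6) From $A\vee B$, where $A=\exists x_0(\bigwedge_{i\le m}u_i\bot_{w_i}v_i\wedge C)$ and $B=\exists x_1(\bigwedge_{m<i\le m+n}u_i\bot_{w_i}v_i\wedge D)$, infer $\forall\alpha\forall\beta\exists x_0\exists x_1\exists z_0\exists z_1\exists r[\bigwedge_{i\le m+n}u_i\bot_{w_ir}v_i\wedge z_0\bot z_0\wedge z_1\bot z_1\wedge(\neg z_0=z_1\vee\alpha=\beta)\wedge((C\wedge r=z_0)\vee(D\wedge r=z_1))]$. Here $C,D$ are first-order;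 $x_0,x_1$ are tuples of variables such that those of $x_0$ do not appear in $B$ and those of $x_1$ do not appear in $A$; $u_i,v_i,w_i$ are tuples of variables from $x_0$ for $i\le m$ and from $x_1$ for $i>m$; $\alpha,\beta,z_0,z_1,r$ are distinct variables that do not appear in $A\vee B$. * (7) From $\exists x\forall yA$ infer $\forall y\exists x(A\wedge x\bot_zy)$, where $x\ne y$ and $z$ lists $\mathrm{Fr}(A)\setminus\{x,y\}$. * (8) From $$\forall x_{0,0}\exists y_{0,0}\exists x_{0,1}\exists y_{0,1}\dots\exists x_{0,p}\exists y_{0,p}\Big(\bigwedge_{1\le i\le m}u^i_{0,0}\bot_{w^i_{0,0}}v^i_{0,0}\wedge\bigwedge_{1\le i\le p}x_{0,i}y_{0,i}\subseteq x_{0,0}y_{0,0}\wedge\bigwedge_{0\le i\le p}C_{0,i}\wedge D\Big)$$ infer $$\forall x_{0,0}\exists y_{0,0}\exists x_{0,1}\exists y_{0,1}\dots\exists x_{0,p}\exists y_{0,p}\Big(\bigwedge_{0\le i\le p}C_{0,i}\wedge D\wedge\forall x_{1,-1}\exists y_{1,-1}\exists x_{1,0}\exists y_{1,0}\dots\exists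 x_{1,p'}\exists y_{1,p'}\,\Xi\Big),$$ where $\Xi$ is $$\bigwedge_{1\le i\le m}u^i_{1,-1}\bot_{w^i_{1,-1}}v^i_{1,-1}\wedge\bigwedge_{0\le i\le p'}x_{1,i}y_{1,i}\subseteq x_{1,-1}y_{1,-1}\wedge\bigwedge_{-1\le i\le p'}C_{1,i}\wedge\bigwedge_{0\le i\le p}x_{1,i}y_{1,i}=x_{0,i}y_{0,i}\wedge\bigwedge_{\substack{1\le i\le m\\-1\le j,k\le p}}\Big(E^i_{j,k}\vee\bigvee_{p<l\le p'}u^i_{1,j}v^i_{1,k}w^i_{1,j}=u^i_{1,l}v^i_{1,l}w^i_{1,l}\Big).$$ Here $p,m\ge0$ and $p'=p+m(p+2)^2$; the $x_{j,k}$ are variable tuples of one length and the $y_{j,k}$ are variable tuples of one length; all their variables are distinct, are quantified only once, and do not occur in $D$; $u^i,v^i,w^i$ are tuples of variables from $y_{0,0}$; $C$ is quantifier-free first-order with variables from $x_{0,0}y_{0,0}$; the subscripts $j,k$ on $u^i,v^i,w^i,C$ mean substitution of $x_{j,k}y_{j,k}$ for $x_{0,0}y_{0,0}$; $E^i_{j,k}$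 is $\bot$ if $w^i$ is empty and $\neg w^i_{1,j}=w^i_{1,k}$ otherwise; and $t_1\subseteq t_2$ stands for $\forall a\forall b\forall c((\neg c=t_1\wedge\neg c=t_2)\vee(\neg a=b\wedge\neg c=t_2)\vee((a=b\vee c=t_2)\wedge c\bot ab))$ with fresh distinct variables. * Identity: the axiom $x=x$; from $x=y$ infer $y=x$; from $x=y$ infer $t(x/y)=t$; from $A\wedge x=y$ infer $A(x/y)$ (for variables $x,y$, terms $t$ and formulas $A$). **Proposition.** Let $\phi$ be a sentence of independence logic. Then there is a sentence $\phi'$ of independence logic, logically equivalent to $\phi$, with $\phi\vdash_{\mathcal I}\phi'$, of the form $$\phi'=\forall x\,\exists y\Big(\bigwedge_{1\le i\le m}u_i\bot_{w_i}v_i\wedge\theta\Big),$$ where $x$ and $y$ are (possibly empty) tuples of variables in which each variable is quantified only once, $m\ge0$, the $u_i,v_i,w_i$ are (possibly empty) tuples of variables from $y$, i.e. of existentially quantified variables, and $\theta$ is a quantifier-free first-order formula. -/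

import Mathlib

universe u v w

namespace IndepLogic

/-- Raw formulas over a first-order vocabulary `L` (with equality), with variables `0, 1, 2, …`.
`indep t₁ t₃ t₂` is the independence atom `t₁ ⊥_{t₃} t₂`; each of the three term tuples may be
empty.  The formulas of independence logic are the raw formulas satisfying `Formula.WF`. -/
inductive Formula (L : FirstOrder.Language.{u, v}) : Type (max u v)
  | eq (t₁ t₂ : L.Term ℕ) : Formula L
  | rel {n : ℕ} (R : L.Relations n) (ts : Fin n → L.Term ℕ) : Formula L
  | indep (t₁ t₃ t₂ : List (L.Term ℕ)) : Formula L
  | neg (A : Formula L) : Formula L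
  | and (A B : Formula L) : Formula L
  | or (A B : Formula L) : Formula L
  | ex (x : ℕ) (A : Formula L) : Formula L
  | all (x : ℕ) (A : Formula L) : Formula L

namespace Formula

variable {L : FirstOrder.Language.{u, v}}

/-- First-order formulas: no independence atom occurs. -/
def IsFO : Formula L → Prop
  | eq _ _ => True
  | rel _ _ => True
  | indep _ _ _ => False
  | neg A => A.IsFO
  | and A B => A.IsFO ∧ B.IsFO
  | or A B => A.IsFO ∧ B.IsFO
  | ex _ A => A.IsFO
  | all _ A => A.IsFO

/-- Formulas of independence logic: negation is applied to first-order formulas only. -/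
def WF : Formula L → Prop
  | eq _ _ => True
  | rel _ _ => True
  | indep _ _ _ => True
  | neg A => A.IsFO
  | and A B => A.WF ∧ B.WF
  | or A B => A.WF ∧ B.WF
  | ex _ A => A.WF
  | all _ A => A.WF

/-- Quantifier-free formulas. -/
def IsQF : Formula L → Prop
  | eq _ _ => True
  | rel _ _ => True
  | indep _ _ _ => True
  | neg A => A.IsQF
  | and A B => A.IsQF ∧ B.IsQF
  | or A B => A.IsQF ∧ B.IsQF
  | ex _ _ => False
  | all _ _ => False

end Formula

/-- The variables of a tuple of terms. -/
def tupleVars {L : FirstOrder.Language.{u, v}} (ts : List (L.Term ℕ)) : Finset ℕ :=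
  ts.foldr (fun t s => t.varFinset ∪ s) ∅

namespace Formula

variable {L : FirstOrder.Language.{u, v}}

/-- Free variables. -/
def fv : Formula L → Finset ℕ
  | eq t₁ t₂ => t₁.varFinset ∪ t₂.varFinset
  | rel _ ts => Finset.univ.biUnion fun i => (ts i).varFinset
  | indep t₁ t₃ t₂ => tupleVars t₁ ∪ tupleVars t₂ ∪ tupleVars t₃
  | neg A => A.fv
  | and A B => A.fv ∪ B.fv
  | or A B => A.fv ∪ B.fv
  | ex x A => A.fv.erase x
  | all x A => A.fv.erase x

/-- All variables that appear in a formula, free, bound or in a quantifier. -/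
def vars : Formula L → Finset ℕ
  | eq t₁ t₂ => t₁.varFinset ∪ t₂.varFinset
  | rel _ ts => Finset.univ.biUnion fun i => (ts i).varFinset
  | indep t₁ t₃ t₂ => tupleVars t₁ ∪ tupleVars t₂ ∪ tupleVars t₃
  | neg A => A.vars
  | and A B => A.vars ∪ B.vars
  | or A B => A.vars ∪ B.vars
  | ex x A => insert x A.vars
  | all x A => insert x A.vars

def IsSentence (A : Formula L) : Prop := A.fv = ∅

/-- Simultaneous replacement of the free occurrences of every variable `x` by the term `σ x`
(bound variables are not renamed). -/
def subst : Formula L → (ℕ → L.Term ℕ) → Formula L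
  | eq t₁ t₂, σ => eq (t₁.subst σ) (t₂.subst σ)
  | rel R ts, σ => rel R fun i => (ts i).subst σ
  | indep t₁ t₃ t₂, σ =>
      indep (t₁.map fun t => t.subst σ) (t₃.map fun t => t.subst σ) (t₂.map fun t => t.subst σ)
  | neg A, σ => neg (A.subst σ)
  | and A B, σ => and (A.subst σ) (B.subst σ)
  | or A B, σ => or (A.subst σ) (B.subst σ)
  | ex x A, σ => ex x (A.subst (Function.update σ x (FirstOrder.Language.Term.var x)))
  | all x A, σ => all x (A.subst (Function.update σ x (FirstOrder.Language.Term.var x)))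

/-- `A(t/x)`: the free occurrences of `x` in `A` are replaced by `t`. -/
def subst1 (A : Formula L) (t : L.Term ℕ) (x : ℕ) : Formula L :=
  A.subst (Function.update FirstOrder.Language.Term.var x t)

/-- No variable of `t` becomes bound in the substitution `A(t/x)`. -/
def FreeFor (t : L.Term ℕ) (x : ℕ) : Formula L → Prop
  | eq _ _ => True
  | rel _ _ => True
  | indep _ _ _ => True
  | neg A => A.FreeFor t x
  | and A B => A.FreeFor t x ∧ B.FreeFor t x
  | or A B => A.FreeFor t x ∧ B.FreeFor t x
  | ex y A => x ∉ (ex y A).fv ∨ (y ∉ t.varFinset ∧ A.FreeFor t x)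
  | all y A => x ∉ (all y A).fv ∨ (y ∉ t.varFinset ∧ A.FreeFor t x)

/-! ### Semantics -/

/-- Tarskian satisfaction, used for first-order formulas (the value at an independence atom,
where this is not used, is the one that the atom has in a one-element team). -/
def Tarski {M : Type w} [L.Structure M] : Formula L → (ℕ → M) → Prop
  | eq t₁ t₂, s => t₁.realize s = t₂.realize s
  | rel R ts, s => FirstOrder.Language.Structure.RelMap R fun i => (ts i).realize s
  | indep _ _ _, _ => True
  | neg A, s => ¬ A.Tarski s
  | and A B, s => A.Tarski s ∧ B.Tarski s
  | or A B, s => A.Tarski s ∨ B.Tarski s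
  | ex x A, s => ∃ a, A.Tarski (Function.update s x a)
  | all x A, s => ∀ a, A.Tarski (Function.update s x a)

end Formula

/-- The value of a tuple of terms in an assignment. -/
def tupleVal {L : FirstOrder.Language.{u, v}} {M : Type w} [L.Structure M] (ts : List (L.Term ℕ))
    (s : ℕ → M) : List M :=
  ts.map fun t => t.realize s

/-- The supplemented team `X(F/x)`. -/
def supplement {M : Type w} (X : Set (ℕ → M)) (F : (ℕ → M) → Set M) (x : ℕ) : Set (ℕ → M) :=
  {s' | ∃ s ∈ X, ∃ a ∈ F s, s' = Function.update s x a}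

/-- The duplicated team `X(M/x)`. -/
def duplicate {M : Type w} (X : Set (ℕ → M)) (x : ℕ) : Set (ℕ → M) :=
  {s' | ∃ s ∈ X, ∃ a, s' = Function.update s x a}

namespace Formula

variable {L : FirstOrder.Language.{u, v}}

/-- Satisfaction `M ⊨_X A` in a team `X` (lax semantics: the supplementing functions take
nonempty sets of values).  Assignments are total functions on the variables; only the values on
the free variables of the formula matter, see `sat_congr`.  On first-order formulas this is
Tarskian satisfaction by every member of the team, see `sat_iff_tarski`. -/
def Sat {M : Type w} [L.Structure M] : Formula L → Set (ℕ → M) → Prop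
  | eq t₁ t₂, X => ∀ s ∈ X, t₁.realize s = t₂.realize s
  | rel R ts, X => ∀ s ∈ X, FirstOrder.Language.Structure.RelMap R fun i => (ts i).realize s
  | indep t₁ t₃ t₂, X =>
      ∀ s ∈ X, ∀ s' ∈ X, tupleVal t₃ s = tupleVal t₃ s' →
        ∃ s'' ∈ X, tupleVal t₁ s'' = tupleVal t₁ s ∧ tupleVal t₃ s'' = tupleVal t₃ s ∧
          tupleVal t₂ s'' = tupleVal t₂ s'
  | neg A, X => ∀ s ∈ X, ¬ A.Tarski s
  | and A B, X => A.Sat X ∧ B.Sat X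
  | or A B, X => ∃ Y Z : Set (ℕ → M), Y ∪ Z = X ∧ A.Sat Y ∧ B.Sat Z
  | ex x A, X => ∃ F : (ℕ → M) → Set M, (∀ s ∈ X, (F s).Nonempty) ∧ A.Sat (supplement X F x)
  | all x A, X => A.Sat (duplicate X x)

/-- On first-order formulas, team satisfaction is Tarskian satisfaction by every assignment. -/
theorem sat_iff_tarski {M : Type w} [L.Structure M] (A : Formula L) (hA : A.IsFO)
    (X : Set (ℕ → M)) : A.Sat X ↔ ∀ s ∈ X, A.Tarski s := by
  induction A generalizing X with
  | eq t₁ t₂ => exact Iff.rfl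
  | rel R ts => exact Iff.rfl
  | indep t₁ t₃ t₂ => exact hA.elim
  | neg A ih => exact Iff.rfl
  | and A B ihA ihB =>
    simp only [Sat, Tarski, ihA hA.1, ihB hA.2]
    exact ⟨fun h s hs => ⟨h.1 s hs, h.2 s hs⟩, fun h => ⟨fun s hs => (h s hs).1, fun s hs => (h s hs).2⟩⟩
  | or A B ihA ihB =>
    simp only [Sat, Tarski, ihA hA.1, ihB hA.2]
    constructor
    · rintro ⟨Y, Z, rfl, hY, hZ⟩ s (hs | hs)
      · exact Or.inl (hY s hs)
      · exact Or.inr (hZ s hs)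
    · intro h
      refine ⟨{s ∈ X | A.Tarski s}, {s ∈ X | B.Tarski s}, ?_, fun s hs => hs.2, fun s hs => hs.2⟩
      ext s
      constructor
      · rintro (hs | hs) <;> exact hs.1
      · intro hs
        exact (h s hs).imp (fun h => ⟨hs, h⟩) (fun h => ⟨hs, h⟩)
  | ex x A ih =>
    have ih' := ih hA
    simp only [Sat, Tarski, ih', supplement]
    constructor
    · rintro ⟨F, hF, h⟩ s hs
      obtain ⟨a, ha⟩ := hF s hs
      exact ⟨a, h _ ⟨s, hs, a, ha, rfl⟩⟩
    · intro h
      refine ⟨fun s => {a | A.Tarski (Function.update s x a)}, fun s hs => h s hs, ?_⟩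
      rintro _ ⟨s, hs, a, ha, rfl⟩
      exact ha
  | all x A ih =>
    have ih' := ih hA
    simp only [Sat, Tarski, ih', duplicate]
    constructor
    · intro h s hs a
      exact h _ ⟨s, hs, a, rfl⟩
    · rintro h _ ⟨s, hs, a, rfl⟩
      exact h s hs a

theorem realize_congr {M : Type w} [L.Structure M] (t : L.Term ℕ) {s s' : ℕ → M}
    (h : ∀ x ∈ t.varFinset, s x = s' x) : t.realize s = t.realize s' := by
  induction t with
  | var x => exact h x (by simp [FirstOrder.Language.Term.varFinset])
  | func f ts ih =>
    simp only [FirstOrder.Language.Term.realize]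
    congr 1
    funext i
    refine ih i fun x hx => h x ?_
    simp only [FirstOrder.Language.Term.varFinset, Finset.mem_biUnion, Finset.mem_univ, true_and]
    exact ⟨i, hx⟩

theorem tupleVal_congr {M : Type w} [L.Structure M] (ts : List (L.Term ℕ)) {s s' : ℕ → M}
    (h : ∀ x ∈ tupleVars ts, s x = s' x) : tupleVal ts s = tupleVal ts s' := by
  induction ts with
  | nil => rfl
  | cons t ts ih =>
    simp only [tupleVars, List.foldr_cons, Finset.mem_union] at h
    simp only [tupleVal, List.map_cons]
    exact congrArg₂ _ (realize_congr t fun x hx => h x (Or.inl hx)) (ih fun x hx => h x (Or.inr hx))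

theorem tarski_congr {M : Type w} [L.Structure M] (A : Formula L) {s s' : ℕ → M}
    (h : ∀ x ∈ A.fv, s x = s' x) : A.Tarski s ↔ A.Tarski s' := by
  have upd : ∀ (B : Formula L) (x : ℕ) (a : M) (s s' : ℕ → M), (∀ y ∈ B.fv.erase x, s y = s' y) →
      ∀ y ∈ B.fv, Function.update s x a y = Function.update s' x a y := by
    intro B x a s s' h y hy
    by_cases e : y = x
    · subst e; simp
    · simp [e, h y (Finset.mem_erase.2 ⟨e, hy⟩)]
  induction A generalizing s s' with
  | eq t₁ t₂ =>
    simp only [fv, Finset.mem_union] at h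
    simp only [Tarski]
    rw [realize_congr t₁ fun x hx => h x (Or.inl hx), realize_congr t₂ fun x hx => h x (Or.inr hx)]
  | rel R ts =>
    simp only [fv, Finset.mem_biUnion, Finset.mem_univ, true_and] at h
    simp only [Tarski]
    rw [show (fun i => (ts i).realize s) = fun i => (ts i).realize s' from
      funext fun i => realize_congr _ fun x hx => h x ⟨i, hx⟩]
  | indep t₁ t₃ t₂ => exact Iff.rfl
  | neg A ih => exact not_congr (ih h)
  | and A B ihA ihB =>
    simp only [fv, Finset.mem_union] at h
    exact and_congr (ihA fun x hx => h x (Or.inl hx)) (ihB fun x hx => h x (Or.inr hx))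
  | or A B ihA ihB =>
    simp only [fv, Finset.mem_union] at h
    exact or_congr (ihA fun x hx => h x (Or.inl hx)) (ihB fun x hx => h x (Or.inr hx))
  | ex x A ih => exact exists_congr fun a => ih (upd A x a s s' h)
  | all x A ih => exact forall_congr' fun a => ih (upd A x a s s' h)

/-- Locality: satisfaction depends only on the restriction of the team to the free variables. -/
theorem sat_congr {M : Type w} [L.Structure M] (A : Formula L) (X Y : Set (ℕ → M))
    (h₁ : ∀ s ∈ X, ∃ s' ∈ Y, ∀ x ∈ A.fv, s x = s' x)
    (h₂ : ∀ s' ∈ Y, ∃ s ∈ X, ∀ x ∈ A.fv, s x = s' x) (hX : A.Sat X) : A.Sat Y := by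
  have upd : ∀ (B : Formula L) (x : ℕ) (a : M) (s s' : ℕ → M), (∀ y ∈ B.fv.erase x, s y = s' y) →
      ∀ y ∈ B.fv, Function.update s x a y = Function.update s' x a y := by
    intro B x a s s' h y hy
    by_cases e : y = x
    · subst e; simp
    · simp [e, h y (Finset.mem_erase.2 ⟨e, hy⟩)]
  have flat : ∀ B : Formula L, (∀ s' ∈ Y, ∃ s ∈ X, ∀ x ∈ B.fv, s x = s' x) →
      (∀ s ∈ X, B.Tarski s) → ∀ s ∈ Y, B.Tarski s := by
    intro B h hB s' hs'
    obtain ⟨s, hs, e⟩ := h s' hs'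
    exact (tarski_congr B e).1 (hB s hs)
  induction A generalizing X Y with
  | eq t₁ t₂ => exact flat (eq t₁ t₂) h₂ hX
  | rel R ts => exact flat (rel R ts) h₂ hX
  | neg A ih => exact flat (neg A) h₂ hX
  | indep t₁ t₃ t₂ =>
    simp only [fv, Finset.mem_union] at h₁ h₂
    have c : ∀ s s' : ℕ → M, (∀ x, (x ∈ tupleVars t₁ ∨ x ∈ tupleVars t₂) ∨ x ∈ tupleVars t₃ →
        s x = s' x) → tupleVal t₁ s = tupleVal t₁ s' ∧ tupleVal t₃ s = tupleVal t₃ s' ∧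
        tupleVal t₂ s = tupleVal t₂ s' := fun s s' h =>
      ⟨tupleVal_congr _ fun x hx => h x (Or.inl (Or.inl hx)),
        tupleVal_congr _ fun x hx => h x (Or.inr hx),
        tupleVal_congr _ fun x hx => h x (Or.inl (Or.inr hx))⟩
    intro s hs s' hs' e
    obtain ⟨r, hr, er⟩ := h₂ s hs
    obtain ⟨r', hr', er'⟩ := h₂ s' hs'
    obtain ⟨a1, a2, a3⟩ := c _ _ er
    obtain ⟨b1, b2, b3⟩ := c _ _ er'
    obtain ⟨r'', hr'', e1, e2, e3⟩ := hX r hr r' hr' (by rw [a2, b2, e])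
    obtain ⟨s'', hs'', es⟩ := h₁ r'' hr''
    obtain ⟨c1, c2, c3⟩ := c _ _ es
    exact ⟨s'', hs'', by rw [← c1, e1, a1], by rw [← c2, e2, a2], by rw [← c3, e3, b3]⟩
  | and A B ihA ihB =>
    simp only [fv, Finset.mem_union] at h₁ h₂
    refine ⟨ihA X Y ?_ ?_ hX.1 flat, ihB X Y ?_ ?_ hX.2 flat⟩
    · exact fun s hs => let ⟨r, hr, e⟩ := h₁ s hs; ⟨r, hr, fun x hx => e x (Or.inl hx)⟩
    · exact fun s hs => let ⟨r, hr, e⟩ := h₂ s hs; ⟨r, hr, fun x hx => e x (Or.inl hx)⟩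
    · exact fun s hs => let ⟨r, hr, e⟩ := h₁ s hs; ⟨r, hr, fun x hx => e x (Or.inr hx)⟩
    · exact fun s hs => let ⟨r, hr, e⟩ := h₂ s hs; ⟨r, hr, fun x hx => e x (Or.inr hx)⟩
  | or A B ihA ihB =>
    simp only [fv, Finset.mem_union] at h₁ h₂
    obtain ⟨X₁, X₂, rfl, hA, hB⟩ := hX
    let P (X' : Set (ℕ → M)) : Set (ℕ → M) :=
      {s' ∈ Y | ∃ s ∈ X', ∀ x, x ∈ A.fv ∨ x ∈ B.fv → s x = s' x}
    have P₁ : ∀ X' ⊆ X₁ ∪ X₂, ∀ s ∈ X', ∃ s' ∈ P X', ∀ x, x ∈ A.fv ∨ x ∈ B.fv → s x = s' x := by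
      intro X' hX' s hs
      obtain ⟨s', hs', e⟩ := h₁ s (hX' hs)
      exact ⟨s', ⟨hs', s, hs, e⟩, e⟩
    have P₃ : ∀ X' : Set (ℕ → M), ∀ C : Formula L, (∀ s ∈ X', C.Tarski s) →
        (∀ s' ∈ P X', ∃ s ∈ X', ∀ x ∈ C.fv, s x = s' x) → ∀ s ∈ P X', C.Tarski s := by
      intro X' C hC h s' hs'
      obtain ⟨s, hs, e⟩ := h s' hs'
      exact (tarski_congr C e).1 (hC s hs)
    refine ⟨P X₁, P X₂, ?_, ihA X₁ (P X₁) ?_ ?_ hA fun C h h' => P₃ X₁ C h' h,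
      ihB X₂ (P X₂) ?_ ?_ hB fun C h h' => P₃ X₂ C h' h⟩
    · ext s'
      constructor
      · rintro (h | h) <;> exact h.1
      · intro hs'
        obtain ⟨s, hs | hs, e⟩ := h₂ s' hs'
        · exact Or.inl ⟨hs', s, hs, e⟩
        · exact Or.inr ⟨hs', s, hs, e⟩
    · intro s hs
      obtain ⟨s', hs', e⟩ := P₁ X₁ Set.subset_union_left s hs
      exact ⟨s', hs', fun x hx => e x (Or.inl hx)⟩
    · rintro s' ⟨-, s, hs, e⟩
      exact ⟨s, hs, fun x hx => e x (Or.inl hx)⟩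
    · intro s hs
      obtain ⟨s', hs', e⟩ := P₁ X₂ Set.subset_union_right s hs
      exact ⟨s', hs', fun x hx => e x (Or.inr hx)⟩
    · rintro s' ⟨-, s, hs, e⟩
      exact ⟨s, hs, fun x hx => e x (Or.inr hx)⟩
  | ex x A ih =>
    obtain ⟨F, hF, h⟩ := hX
    refine ⟨fun s' => {a | ∃ s ∈ X, (∀ y ∈ A.fv.erase x, s y = s' y) ∧ a ∈ F s}, ?_,
      ih _ _ ?_ ?_ h ?_⟩
    · intro s' hs'
      obtain ⟨s, hs, e⟩ := h₂ s' hs'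
      obtain ⟨a, ha⟩ := hF s hs
      exact ⟨a, s, hs, e, ha⟩
    · rintro _ ⟨s, hs, a, ha, rfl⟩
      obtain ⟨s', hs', e⟩ := h₁ s hs
      exact ⟨_, ⟨s', hs', a, ⟨s, hs, e, ha⟩, rfl⟩, upd A x a s s' e⟩
    · rintro _ ⟨s', hs', a, ⟨s, hs, e, ha⟩, rfl⟩
      exact ⟨_, ⟨s, hs, a, ha, rfl⟩, upd A x a s s' e⟩
    · intro C hC h' s' hs'
      obtain ⟨s, hs, e⟩ := hC s' hs'
      exact (tarski_congr C e).1 (h' s hs)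
  | all x A ih =>
    refine ih _ _ ?_ ?_ hX ?_
    · rintro _ ⟨s, hs, a, rfl⟩
      obtain ⟨s', hs', e⟩ := h₁ s hs
      exact ⟨_, ⟨s', hs', a, rfl⟩, upd A x a s s' e⟩
    · rintro _ ⟨s', hs', a, rfl⟩
      obtain ⟨s, hs, e⟩ := h₂ s' hs'
      exact ⟨_, ⟨s, hs, a, rfl⟩, upd A x a s s' e⟩
    · intro C hC h' s' hs'
      obtain ⟨s, hs, e⟩ := hC s' hs'
      exact (tarski_congr C e).1 (h' s hs)

/-- Logical consequence `A ⊨ B` (over models with universe in `Type w`). -/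
def Entails (A B : Formula L) : Prop :=
  ∀ (M : Type w) [L.Structure M] [Nonempty M] (X : Set (ℕ → M)), A.Sat X → B.Sat X

/-- Logical equivalence. -/
def LogEquiv (A B : Formula L) : Prop :=
  Entails.{u, v, w} A B ∧ Entails.{u, v, w} B A

/-! ### Abbreviations -/

/-- `∀ x₁ … ∀ xₖ A`. -/
def allL (xs : List ℕ) (A : Formula L) : Formula L := xs.foldr all A

/-- `∃ x₁ … ∃ xₖ A`. -/
def exL (xs : List ℕ) (A : Formula L) : Formula L := xs.foldr ex A

/-- `B₁ ∧ (B₂ ∧ … (Bₖ ∧ A))`, which is `A` for `k = 0`. -/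
def conj (Bs : List (Formula L)) (A : Formula L) : Formula L := Bs.foldr and A

/-- `((A ∨ B₁) ∨ B₂) ∨ …`, which is `A` for `k = 0`. -/
def disj (A : Formula L) (Bs : List (Formula L)) : Formula L := Bs.foldl or A

/-- A true sentence. -/
def top : Formula L := all 0 (eq (FirstOrder.Language.Term.var 0) (FirstOrder.Language.Term.var 0))

/-- The first-order sentence `⊥`. -/
def bot : Formula L := neg top

/-- The conjunction of a list of formulas. -/
def bigAnd : List (Formula L) → Formula L
  | [] => top
  | [A] => A
  | A :: B :: l => and A (bigAnd (B :: l))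

/-- Variables as terms. -/
def varTuple (xs : List ℕ) : List (L.Term ℕ) := xs.map FirstOrder.Language.Term.var

/-- `x = y` for tuples of variables of the same length. -/
def tupleEq (xs ys : List ℕ) : Formula L :=
  bigAnd (List.zipWith (fun x y => eq (FirstOrder.Language.Term.var x) (FirstOrder.Language.Term.var y)) xs ys)

/-- The independence atom `u ⊥_w v` for tuples of variables. -/
def indepVar (u w v : List ℕ) : Formula L := indep (varTuple u) (varTuple w) (varTuple v)

/-- The dependence atom `=(z)` of a single variable, that is `z ⊥ z`. -/
def constAtom (z : ℕ) : Formula L := indepVar [z] [] [z]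

/-- The translation of the inclusion atom `t₁ ⊆ t₂` (tuples of variables) with auxiliary variables
`v₁ v₂ z`:
`∀ v₁ ∀ v₂ ∀ z ((¬z = t₁ ∧ ¬z = t₂) ∨ (¬v₁ = v₂ ∧ ¬z = t₂) ∨ ((v₁ = v₂ ∨ z = t₂) ∧ z ⊥ v₁v₂))`. -/
def incl (v₁ v₂ : ℕ) (z t₁ t₂ : List ℕ) : Formula L :=
  all v₁ (all v₂ (allL z
    (or (and (neg (tupleEq z t₁)) (neg (tupleEq z t₂)))
      (or (and (neg (eq (FirstOrder.Language.Term.var v₁) (FirstOrder.Language.Term.var v₂))) (neg (tupleEq z t₂)))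
        (and (or (eq (FirstOrder.Language.Term.var v₁) (FirstOrder.Language.Term.var v₂)) (tupleEq z t₂))
          (indepVar z [] [v₁, v₂]))))))

/-- `A` is a translation of `t₁ ⊆ t₂` whose auxiliary variables are pairwise distinct, not in
`t₁ t₂`, and not in the list `V`. -/
def IsIncl (V t₁ t₂ : List ℕ) (A : Formula L) : Prop :=
  ∃ (v₁ v₂ : ℕ) (z : List ℕ), z.length = t₁.length ∧ (v₁ :: v₂ :: z).Nodup ∧
    (∀ a ∈ v₁ :: v₂ :: z, a ∉ t₁ ∧ a ∉ t₂ ∧ a ∉ V) ∧ A = incl v₁ v₂ z t₁ t₂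

end Formula

/-- The data `(u, w, v)` of an independence atom `u ⊥_w v` of tuples of variables. -/
structure IAtom where
  u : List ℕ
  w : List ℕ
  v : List ℕ

namespace IAtom

/-- All variables of the three tuples are in the list `y`. -/
def Within (a : IAtom) (y : List ℕ) : Prop := a.u ⊆ y ∧ a.w ⊆ y ∧ a.v ⊆ y

/-- `u ⊥_w v`. -/
def toFormula {L : FirstOrder.Language.{u, v}} (a : IAtom) : Formula L := Formula.indepVar a.u a.w a.v

/-- `u ⊥_{w r} v`. -/
def withCond {L : FirstOrder.Language.{u, v}} (a : IAtom) (r : ℕ) : Formula L :=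
  Formula.indepVar a.u (a.w ++ [r]) a.v

end IAtom

/-! ### Independence distribution -/

/-- `∃ x (⋀ᵢ uᵢ ⊥_{wᵢ} vᵢ ∧ C)`. -/
def exIndep {L : FirstOrder.Language.{u, v}} (x : List ℕ) (atoms : List IAtom) (C : Formula L) : Formula L :=
  Formula.exL x (Formula.conj (atoms.map IAtom.toFormula) C)

/-- The conclusion of the rule of independence distribution. -/
def distribConclusion {L : FirstOrder.Language.{u, v}} (x₀ x₁ : List ℕ) (atoms₀ atoms₁ : List IAtom)
    (C D : Formula L) (α β z₀ z₁ r : ℕ) : Formula L :=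
  let eqv (a b : ℕ) : Formula L := Formula.eq (FirstOrder.Language.Term.var a) (FirstOrder.Language.Term.var b)
  Formula.all α (Formula.all β (Formula.exL x₀ (Formula.exL x₁ (Formula.exL [z₀, z₁, r]
    (Formula.conj
      ((atoms₀ ++ atoms₁).map (fun a => a.withCond r) ++
        [Formula.constAtom z₀, Formula.constAtom z₁, Formula.or (Formula.neg (eqv z₀ z₁)) (eqv α β)])
      (Formula.or (Formula.and C (eqv r z₀)) (Formula.and D (eqv r z₁))))))))

/-! ### Independence transmission -/

/-- The integers `a, a + 1, …, b` in increasing order. -/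
def intervalList (a b : ℤ) : List ℤ := (List.range (b + 1 - a).toNat).map fun n => a + (n : ℤ)

/-- The renaming of variables that sends the `i`-th member of `xs` to the `i`-th member of `ys`. -/
def renVar (xs ys : List ℕ) (x : ℕ) : ℕ := ((xs.zip ys).lookup x).getD x

/-- The data of an instance of the rule of independence transmission: `x j k` and `y j k` are the
tuples `x_{j,k}` and `y_{j,k}`, `atoms` are the triples `(uⁱ, wⁱ, vⁱ)`, and `I₀ i`, `I₁ i` are the
translations of the inclusion atoms `x_{0,i} y_{0,i} ⊆ x_{0,0} y_{0,0}` and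
`x_{1,i} y_{1,i} ⊆ x_{1,-1} y_{1,-1}`. -/
structure Transmission (L : FirstOrder.Language.{u, v}) where
  p : ℕ
  atoms : List IAtom
  x : ℕ → ℤ → List ℕ
  y : ℕ → ℤ → List ℕ
  C : Formula L
  D : Formula L
  I₀ : ℤ → Formula L
  I₁ : ℤ → Formula L

namespace Transmission

variable {L : FirstOrder.Language.{u, v}} (T : Transmission L)

/-- `p' = p + m (p + 2)²`. -/
def p' : ℕ := T.p + T.atoms.length * (T.p + 2) ^ 2

/-- The tuple `x_{j,k} y_{j,k}`. -/
def xy (j : ℕ) (k : ℤ) : List ℕ := T.x j k ++ T.y j k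

/-- `x_{j,a} y_{j,a} … x_{j,b} y_{j,b}`. -/
def xys (j : ℕ) (a b : ℤ) : List ℕ := ((intervalList a b).map (T.xy j)).flatten

/-- The variables of all the tuples. -/
def tuples : List ℕ := T.xys 0 0 T.p ++ T.xys 1 (-1) T.p'

/-- `e(x_{j,k} y_{j,k} / x_{0,0} y_{0,0})` for a tuple `e` of variables. -/
def inst (j : ℕ) (k : ℤ) (e : List ℕ) : List ℕ := e.map (renVar (T.xy 0 0) (T.xy j k))

/-- `C_{j,k} = C(x_{j,k} y_{j,k} / x_{0,0} y_{0,0})`. -/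
def Cat (j : ℕ) (k : ℤ) : Formula L :=
  T.C.subst fun a => FirstOrder.Language.Term.var (renVar (T.xy 0 0) (T.xy j k) a)

/-- `⋀ᵢ uⁱ_{j,k} ⊥_{wⁱ_{j,k}} vⁱ_{j,k}`, as a list. -/
def atomsAt (j : ℕ) (k : ℤ) : List (Formula L) :=
  T.atoms.map fun a => Formula.indepVar (T.inst j k a.u) (T.inst j k a.w) (T.inst j k a.v)

/-- `Eⁱ_{1,j,k}`. -/
def E (a : IAtom) (j k : ℤ) : Formula L :=
  if a.w = [] then Formula.bot
  else Formula.neg (Formula.tupleEq (T.inst 1 j a.w) (T.inst 1 k a.w))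

/-- `Eⁱ_{1,j,k} ∨ ⋁_{p < l ≤ p'} uⁱ_{1,j} vⁱ_{1,k} wⁱ_{1,j} = uⁱ_{1,l} vⁱ_{1,l} wⁱ_{1,l}`. -/
def witness (a : IAtom) (j k : ℤ) : Formula L :=
  Formula.disj (T.E a j k) ((intervalList (T.p + 1) T.p').map fun l =>
    Formula.tupleEq (T.inst 1 j a.u ++ T.inst 1 k a.v ++ T.inst 1 j a.w)
      (T.inst 1 l a.u ++ T.inst 1 l a.v ++ T.inst 1 l a.w))

/-- The side conditions of the rule. -/
structure Valid : Prop where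
  length_x₀ : ∀ k ∈ intervalList 0 T.p, (T.x 0 k).length = (T.x 0 0).length
  length_y₀ : ∀ k ∈ intervalList 0 T.p, (T.y 0 k).length = (T.y 0 0).length
  length_x₁ : ∀ k ∈ intervalList (-1) T.p', (T.x 1 k).length = (T.x 0 0).length
  length_y₁ : ∀ k ∈ intervalList (-1) T.p', (T.y 1 k).length = (T.y 0 0).length
  nodup : T.tuples.Nodup
  not_mem_D : ∀ a ∈ T.tuples, a ∉ T.D.vars
  atoms_within : ∀ a ∈ T.atoms, a.Within (T.y 0 0)
  C_fo : T.C.IsFO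
  C_qf : T.C.IsQF
  C_vars : ∀ a ∈ T.C.vars, a ∈ T.xy 0 0
  incl₀ : ∀ i ∈ intervalList 1 T.p, Formula.IsIncl T.tuples (T.xy 0 i) (T.xy 0 0) (T.I₀ i)
  incl₁ : ∀ i ∈ intervalList 0 T.p', Formula.IsIncl T.tuples (T.xy 1 i) (T.xy 1 (-1)) (T.I₁ i)

/-- The premise of the rule. -/
def premise : Formula L :=
  Formula.allL (T.x 0 0) (Formula.exL (T.y 0 0) (Formula.exL (T.xys 0 1 T.p)
    (Formula.conj
      (T.atomsAt 0 0 ++ (intervalList 1 T.p).map T.I₀ ++ (intervalList 0 T.p).map (T.Cat 0))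
      T.D)))

/-- The conclusion of the rule. -/
def conclusion : Formula L :=
  Formula.allL (T.x 0 0) (Formula.exL (T.y 0 0) (Formula.exL (T.xys 0 1 T.p)
    (Formula.conj ((intervalList 0 T.p).map (T.Cat 0) ++ [T.D])
      (Formula.allL (T.x 1 (-1)) (Formula.exL (T.y 1 (-1)) (Formula.exL (T.xys 1 0 T.p')
        (Formula.bigAnd
          (T.atomsAt 1 (-1) ++ (intervalList 0 T.p').map T.I₁ ++
            (intervalList (-1) T.p').map (T.Cat 1) ++
            (intervalList 0 T.p).map (fun i => Formula.tupleEq (T.xy 1 i) (T.xy 0 i)) ++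
            T.atoms.flatMap fun a => (intervalList (-1) T.p).flatMap fun j =>
              (intervalList (-1) T.p).map fun k => T.witness a j k))))))))

end Transmission

/-! ### The deduction system -/

open Formula in
/-- `Deriv Γ A`: there is a natural deduction of the formula `A` all of whose non-discharged
assumptions are in `Γ`.  Where a rule restricts the variables that are free in the
non-discharged assumptions used in a subderivation, `Δ ⊆ Γ` is a set that contains these
assumptions. -/
inductive Deriv {L : FirstOrder.Language.{u, v}} : Set (Formula L) → Formula L → Prop
  | assumption {Γ : Set (Formula L)} {A : Formula L} : A ∈ Γ → Deriv Γ A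
  | andI {Γ : Set (Formula L)} {A B : Formula L} : Deriv Γ A → Deriv Γ B → Deriv Γ (and A B)
  | andE₁ {Γ : Set (Formula L)} {A B : Formula L} : Deriv Γ (and A B) → Deriv Γ A
  | andE₂ {Γ : Set (Formula L)} {A B : Formula L} : Deriv Γ (and A B) → Deriv Γ B
  | orI₁ {Γ : Set (Formula L)} {A B : Formula L} : B.WF → Deriv Γ A → Deriv Γ (or A B)
  | orI₂ {Γ : Set (Formula L)} {A B : Formula L} : A.WF → Deriv Γ B → Deriv Γ (or A B)
  | orE {Γ : Set (Formula L)} {A B C : Formula L} : C.IsFO → Deriv Γ (or A B) →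
      Deriv (insert A Γ) C → Deriv (insert B Γ) C → Deriv Γ C
  | negI {Γ : Set (Formula L)} {A B : Formula L} : A.IsFO → B.IsFO →
      Deriv (insert A Γ) (and B (neg B)) → Deriv Γ (neg A)
  | negE {Γ : Set (Formula L)} {A : Formula L} : A.IsFO → Deriv Γ (neg (neg A)) → Deriv Γ A
  | allI {Γ Δ : Set (Formula L)} {x : ℕ} {A : Formula L} : Δ ⊆ Γ → (∀ G ∈ Δ, x ∉ G.fv) →
      Deriv Δ A → Deriv Γ (all x A)
  | allE {Γ : Set (Formula L)} {x : ℕ} {A : Formula L} {t : L.Term ℕ} : A.IsFO →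
      A.FreeFor t x → Deriv Γ (all x A) → Deriv Γ (A.subst1 t x)
  | exI {Γ : Set (Formula L)} {x : ℕ} {A : Formula L} {t : L.Term ℕ} :
      A.FreeFor t x → Deriv Γ (A.subst1 t x) → Deriv Γ (ex x A)
  | exE {Γ Δ : Set (Formula L)} {x : ℕ} {A B : Formula L} : Δ ⊆ Γ → (∀ G ∈ Δ, x ∉ G.fv) →
      x ∉ B.fv → Deriv Γ (ex x A) → Deriv (insert A Δ) B → Deriv Γ B
  /-- Disjunction substitution. -/
  | orSubst {Γ : Set (Formula L)} {A B C : Formula L} : Deriv Γ (or A B) →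
      Deriv (insert B Γ) C → Deriv Γ (or A C)
  /-- Commutation of disjunction. -/
  | orComm {Γ : Set (Formula L)} {A B : Formula L} : Deriv Γ (or B A) → Deriv Γ (or A B)
  /-- Associativity of disjunction. -/
  | orAssoc {Γ : Set (Formula L)} {A B C : Formula L} : Deriv Γ (or (or A B) C) →
      Deriv Γ (or A (or B C))
  /-- Extending the scope of a universal quantifier. -/
  | allScope {Γ : Set (Formula L)} {x : ℕ} {y : List ℕ} {A B : Formula L} : x ∉ B.fv → y.Nodup →
      (∀ a, a ∈ y ↔ a ∈ (or A B).fv ∧ a ≠ x) → Deriv Γ (or (all x A) B) →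
      Deriv Γ (all x (or (and A (indepVar [x] [] y)) B))
  /-- Extending the scope of an existential quantifier. -/
  | exScope {Γ : Set (Formula L)} {x : ℕ} {A B : Formula L} : x ∉ B.fv →
      Deriv Γ (or (ex x A) B) → Deriv Γ (ex x (or A B))
  /-- Universal substitution. -/
  | allSubst {Γ Δ : Set (Formula L)} {x y : ℕ} {A B : Formula L} : Δ ⊆ Γ → (∀ G ∈ Δ, y ∉ G.fv) →
      y ∉ (all x A).fv → A.FreeFor (FirstOrder.Language.Term.var y) x → Deriv Γ (all x A) →
      Deriv (insert (A.subst1 (FirstOrder.Language.Term.var y) x) Δ) B → Deriv Γ (all y B)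
  /-- Independence distribution. -/
  | indepDistrib {Γ : Set (Formula L)} {x₀ x₁ : List ℕ} {atoms₀ atoms₁ : List IAtom}
      {C D : Formula L} {α β z₀ z₁ r : ℕ} : C.IsFO → D.IsFO →
      (∀ a ∈ x₀, a ∉ (exIndep x₁ atoms₁ D).vars) → (∀ a ∈ x₁, a ∉ (exIndep x₀ atoms₀ C).vars) →
      (∀ a ∈ atoms₀, a.Within x₀) → (∀ a ∈ atoms₁, a.Within x₁) → [α, β, z₀, z₁, r].Nodup →
      (∀ a ∈ [α, β, z₀, z₁, r], a ∉ (or (exIndep x₀ atoms₀ C) (exIndep x₁ atoms₁ D)).vars) →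
      Deriv Γ (or (exIndep x₀ atoms₀ C) (exIndep x₁ atoms₁ D)) →
      Deriv Γ (distribConclusion x₀ x₁ atoms₀ atoms₁ C D α β z₀ z₁ r)
  /-- Independence introduction. -/
  | indepIntro {Γ : Set (Formula L)} {x y : ℕ} {z : List ℕ} {A : Formula L} : x ≠ y → z.Nodup →
      (∀ a, a ∈ z ↔ a ∈ A.fv ∧ a ≠ x ∧ a ≠ y) → Deriv Γ (ex x (all y A)) →
      Deriv Γ (all y (ex x (and A (indepVar [x] z [y]))))
  /-- Independence transmission. -/
  | indepTrans {Γ : Set (Formula L)} (T : Transmission L) : T.Valid → Deriv Γ T.premise →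
      Deriv Γ T.conclusion
  /-- Identity axiom. -/
  | eqRefl {Γ : Set (Formula L)} (x : ℕ) : Deriv Γ (eq (FirstOrder.Language.Term.var x) (FirstOrder.Language.Term.var x))
  | eqSymm {Γ : Set (Formula L)} {x y : ℕ} :
      Deriv Γ (eq (FirstOrder.Language.Term.var x) (FirstOrder.Language.Term.var y)) →
      Deriv Γ (eq (FirstOrder.Language.Term.var y) (FirstOrder.Language.Term.var x))
  /-- From `x = y` infer `t(x/y) = t`. -/
  | eqTerm {Γ : Set (Formula L)} {x y : ℕ} (t : L.Term ℕ) :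
      Deriv Γ (eq (FirstOrder.Language.Term.var x) (FirstOrder.Language.Term.var y)) →
      Deriv Γ (eq (t.subst (Function.update FirstOrder.Language.Term.var y (FirstOrder.Language.Term.var x))) t)
  /-- From `A ∧ x = y` infer `A(x/y)`. -/
  | eqSubst {Γ : Set (Formula L)} {x y : ℕ} {A : Formula L} :
      A.FreeFor (FirstOrder.Language.Term.var x) y →
      Deriv Γ (and A (eq (FirstOrder.Language.Term.var x) (FirstOrder.Language.Term.var y))) →
      Deriv Γ (A.subst1 (FirstOrder.Language.Term.var x) y)

/-- Formulas of the form `∀ x ∃ y (⋀ᵢ uᵢ ⊥_{wᵢ} vᵢ ∧ θ)` where `x` and `y` are tuples of variables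
in which each variable is quantified only once, the `uᵢ`, `wᵢ`, `vᵢ` are tuples of variables from
`y`, and `θ` is a quantifier-free first-order formula. -/
def IsNormalForm {L : FirstOrder.Language.{u, v}} (A : Formula L) : Prop :=
  ∃ (x y : List ℕ) (atoms : List IAtom) (θ : Formula L),
    (x ++ y).Nodup ∧ (∀ a ∈ atoms, a.Within y) ∧ θ.IsFO ∧ θ.IsQF ∧
      A = Formula.allL x (Formula.exL y (Formula.conj (atoms.map IAtom.toFormula) θ))

end IndepLogic

/-! A formula of independence logic is brought into normal form by derivable equivalences.  The
relation `Reduces A B` says that `B` is derivable from the single assumption `A`, that `A` and `B`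
are logically equivalent, and that no free variable is added.  It is transitive (`Deriv.cut`) and a
congruence for the connectives and quantifiers, so the steps can be carried out anywhere inside a
formula, and no step depends on side assumptions.

The induction (`hasNormalForm`) is on a measure that decreases when a negation is moved inwards. For
each finite set it yields a normal form whose quantified variables avoid that set, which is how
clashes of variables are prevented; at a quantifier the bound variable is first renamed.

* At a conjunction both quantifier prefixes can be pulled out.
* At an existential quantifier, `∃ x ∀ y A` becomes `∀ y ∃ x (A ∧ x ⊥_z y)` (`Reduces.ex_all`): the
  atom states that the choice of `x` does not depend on `y`.
* At a disjunction the universal quantifiers are pulled out by `Reduces.all_or`, again at the cost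
  of an atom, which makes the part of the team that satisfies the first disjunct a product.  The two
  remaining existential blocks are merged by independence distribution (`Reduces.distrib`).  There a
  new variable `r` tells from which disjunct an assignment comes.  An atom conditioned on `r` only
  concerns its own disjunct, provided that `r` really takes two values; this can fail in one-element
  structures only, where all atoms hold.

The atoms that arise in this way, and those of the given formula, speak about universally quantified
or free variables and about terms.  By `Reduces.name_conj` new existentially quantified variables
take their places, with equations in the quantifier-free part. -/

namespace IndepLogic

open FirstOrder.Language (Term)

variable {L : FirstOrder.Language.{u, v}}

/-! ### Substitution -/

theorem term_subst_var {t : L.Term ℕ} {σ : ℕ → L.Term ℕ} (h : ∀ a ∈ t.varFinset, σ a = Term.var a) :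
    t.subst σ = t := by
  induction t with
  | var a => exact h a (by simp [Term.varFinset])
  | func f ts ih =>
    simp only [Term.subst]
    congr 1
    funext i
    refine ih i fun a ha => h a ?_
    simp only [Term.varFinset, Finset.mem_biUnion, Finset.mem_univ, true_and]
    exact ⟨i, ha⟩

theorem mem_varFinset_subst {t : L.Term ℕ} {σ : ℕ → L.Term ℕ} {b : ℕ}
    (h : b ∈ (t.subst σ).varFinset) : ∃ a ∈ t.varFinset, b ∈ (σ a).varFinset := by
  induction t with
  | var a => exact ⟨a, by simp [Term.varFinset], h⟩
  | func f ts ih =>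
    simp only [Term.subst, Term.varFinset, Finset.mem_biUnion, Finset.mem_univ, true_and] at h ⊢
    obtain ⟨i, hi⟩ := h
    obtain ⟨a, ha, hb⟩ := ih i hi
    exact ⟨a, ⟨i, ha⟩, hb⟩

theorem mem_tupleVars {ts : List (L.Term ℕ)} {a : ℕ} :
    a ∈ tupleVars ts ↔ ∃ t ∈ ts, a ∈ t.varFinset := by
  induction ts with
  | nil => simp [tupleVars]
  | cons t ts ih =>
    have : tupleVars (t :: ts) = t.varFinset ∪ tupleVars ts := rfl
    simp [this, ih]

theorem map_subst_var {ts : List (L.Term ℕ)} {σ : ℕ → L.Term ℕ}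
    (h : ∀ a ∈ tupleVars ts, σ a = Term.var a) : ts.map (fun t => t.subst σ) = ts := by
  conv_rhs => rw [← List.map_id ts]
  refine List.map_congr_left fun t ht => term_subst_var fun a ha => h a ?_
  exact mem_tupleVars.2 ⟨t, ht, ha⟩

theorem mem_tupleVars_subst {ts : List (L.Term ℕ)} {σ : ℕ → L.Term ℕ} {b : ℕ}
    (h : b ∈ tupleVars (ts.map fun t => t.subst σ)) :
    ∃ a ∈ tupleVars ts, b ∈ (σ a).varFinset := by
  obtain ⟨t', ht', hb⟩ := mem_tupleVars.1 h
  obtain ⟨t, ht, rfl⟩ := List.mem_map.1 ht'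
  obtain ⟨a, ha, hb⟩ := mem_varFinset_subst hb
  exact ⟨a, mem_tupleVars.2 ⟨t, ht, ha⟩, hb⟩

theorem tupleVars_varTuple (xs : List ℕ) {a : ℕ} :
    a ∈ tupleVars (Formula.varTuple (L := L) xs) ↔ a ∈ xs := by
  simp [mem_tupleVars, Formula.varTuple, Term.varFinset, eq_comm]

theorem tupleVal_varTuple {M : Type w} [L.Structure M] (xs : List ℕ) (s : ℕ → M) :
    tupleVal (Formula.varTuple (L := L) xs) s = xs.map s := by
  simp [tupleVal, Formula.varTuple, Function.comp_def]

namespace Formula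

theorem subst_var_of_fv {A : Formula L} {σ : ℕ → L.Term ℕ} (h : ∀ a ∈ A.fv, σ a = Term.var a) :
    A.subst σ = A := by
  have bound : ∀ (B : Formula L) (x : ℕ) (σ : ℕ → L.Term ℕ),
      (∀ a ∈ B.fv.erase x, σ a = Term.var a) →
      ∀ a ∈ B.fv, Function.update σ x (Term.var x) a = Term.var a := by
    intro B x σ h a ha
    by_cases e : a = x
    · subst e; simp
    · simp [e, h a (Finset.mem_erase.2 ⟨e, ha⟩)]
  induction A generalizing σ with
  | eq t₁ t₂ =>
    simp only [fv, Finset.mem_union] at h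
    simp only [subst, term_subst_var fun a ha => h a (Or.inl ha),
      term_subst_var fun a ha => h a (Or.inr ha)]
  | rel R ts =>
    simp only [fv, Finset.mem_biUnion, Finset.mem_univ, true_and] at h
    simp only [subst, fun i => term_subst_var fun a ha => h a ⟨i, ha⟩]
  | indep t₁ t₃ t₂ =>
    simp only [fv, Finset.mem_union] at h
    simp only [subst, map_subst_var fun a ha => h a (Or.inl (Or.inl ha)),
      map_subst_var fun a ha => h a (Or.inl (Or.inr ha)), map_subst_var fun a ha => h a (Or.inr ha)]
  | neg A ih => simp only [subst, ih h]
  | and A B ihA ihB =>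
    simp only [fv, Finset.mem_union] at h
    simp only [subst, ihA fun a ha => h a (Or.inl ha), ihB fun a ha => h a (Or.inr ha)]
  | or A B ihA ihB =>
    simp only [fv, Finset.mem_union] at h
    simp only [subst, ihA fun a ha => h a (Or.inl ha), ihB fun a ha => h a (Or.inr ha)]
  | ex x A ih => simp only [subst, ih (bound A x σ h)]
  | all x A ih => simp only [subst, ih (bound A x σ h)]

theorem subst1_self (A : Formula L) (x : ℕ) : A.subst1 (Term.var x) x = A :=
  subst_var_of_fv fun _ _ => by rw [Function.update_eq_self]

theorem subst1_of_notMem {A : Formula L} {t : L.Term ℕ} {x : ℕ} (h : x ∉ A.fv) :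
    A.subst1 t x = A :=
  subst_var_of_fv fun _ ha => Function.update_of_ne (ne_of_mem_of_not_mem ha h) _ _

theorem update_var_comm {t : L.Term ℕ} {x y : ℕ} (h : y ≠ x) :
    Function.update (Function.update Term.var x t) y (Term.var y) =
      Function.update (Term.var : ℕ → L.Term ℕ) x t := by
  rw [Function.update_comm h.symm, Function.update_eq_self]

theorem subst1_ex {A : Formula L} {t : L.Term ℕ} {x y : ℕ} (h : y ≠ x) :
    (ex y A).subst1 t x = ex y (A.subst1 t x) := by
  simp only [subst1, subst, update_var_comm h]

theorem subst1_all {A : Formula L} {t : L.Term ℕ} {x y : ℕ} (h : y ≠ x) :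
    (all y A).subst1 t x = all y (A.subst1 t x) := by
  simp only [subst1, subst, update_var_comm h]

theorem freeFor_self (A : Formula L) (x : ℕ) : A.FreeFor (Term.var x) x := by
  have bound : ∀ (B : Formula L) (y : ℕ), B.FreeFor (Term.var x) x →
      x ∉ B.fv.erase y ∨ (y ∉ (Term.var x : L.Term ℕ).varFinset ∧ B.FreeFor (Term.var x) x) := by
    intro B y h
    by_cases e : y = x
    · subst e; left; simp
    · right; exact ⟨by simpa [Term.varFinset] using e, h⟩
  induction A with
  | eq | rel | indep => trivial
  | neg A ih => exact ih
  | and A B ihA ihB => exact ⟨ihA, ihB⟩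
  | or A B ihA ihB => exact ⟨ihA, ihB⟩
  | ex y A ih => exact bound A y ih
  | all y A ih => exact bound A y ih

theorem freeFor_of_disjoint {A : Formula L} {t : L.Term ℕ} {x : ℕ}
    (h : ∀ a ∈ t.varFinset, a ∉ A.vars) : A.FreeFor t x := by
  induction A with
  | eq | rel | indep => trivial
  | neg A ih => exact ih h
  | and A B ihA ihB =>
    exact ⟨ihA fun a ha hA => h a ha (Finset.mem_union_left _ hA),
      ihB fun a ha hB => h a ha (Finset.mem_union_right _ hB)⟩
  | or A B ihA ihB =>
    exact ⟨ihA fun a ha hA => h a ha (Finset.mem_union_left _ hA),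
      ihB fun a ha hB => h a ha (Finset.mem_union_right _ hB)⟩
  | ex y A ih =>
    exact Or.inr ⟨fun hy => h y hy (Finset.mem_insert_self _ _),
      ih fun a ha hA => h a ha (Finset.mem_insert_of_mem hA)⟩
  | all y A ih =>
    exact Or.inr ⟨fun hy => h y hy (Finset.mem_insert_self _ _),
      ih fun a ha hA => h a ha (Finset.mem_insert_of_mem hA)⟩

theorem mem_fv_subst {A : Formula L} {σ : ℕ → L.Term ℕ} {b : ℕ} (h : b ∈ (A.subst σ).fv) :
    ∃ a ∈ A.fv, b ∈ (σ a).varFinset := by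
  have bound : ∀ (B : Formula L) (x : ℕ) (σ : ℕ → L.Term ℕ), b ≠ x →
      (∃ a ∈ B.fv, b ∈ (Function.update σ x (Term.var x) a).varFinset) →
      ∃ a ∈ B.fv.erase x, b ∈ (σ a).varFinset := by
    rintro B x σ hb ⟨a, ha, h⟩
    by_cases e : a = x
    · subst e
      rw [Function.update_self] at h
      exact absurd (by simpa [Term.varFinset] using h) hb
    · rw [Function.update_of_ne e] at h
      exact ⟨a, Finset.mem_erase.2 ⟨e, ha⟩, h⟩
  induction A generalizing σ with
  | eq t₁ t₂ =>
    simp only [subst, fv, Finset.mem_union] at h ⊢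
    rcases h with h | h <;> obtain ⟨a, ha, hb⟩ := mem_varFinset_subst h
    · exact ⟨a, Or.inl ha, hb⟩
    · exact ⟨a, Or.inr ha, hb⟩
  | rel R ts =>
    simp only [subst, fv, Finset.mem_biUnion, Finset.mem_univ, true_and] at h ⊢
    obtain ⟨i, h⟩ := h
    obtain ⟨a, ha, hb⟩ := mem_varFinset_subst h
    exact ⟨a, ⟨i, ha⟩, hb⟩
  | indep t₁ t₃ t₂ =>
    simp only [subst, fv, Finset.mem_union] at h ⊢
    rcases h with (h | h) | h <;> obtain ⟨a, ha, hb⟩ := mem_tupleVars_subst h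
    · exact ⟨a, Or.inl (Or.inl ha), hb⟩
    · exact ⟨a, Or.inl (Or.inr ha), hb⟩
    · exact ⟨a, Or.inr ha, hb⟩
  | neg A ih => exact ih h
  | and A B ihA ihB =>
    simp only [subst, fv, Finset.mem_union] at h ⊢
    rcases h with h | h
    · obtain ⟨a, ha, hb⟩ := ihA h
      exact ⟨a, Or.inl ha, hb⟩
    · obtain ⟨a, ha, hb⟩ := ihB h
      exact ⟨a, Or.inr ha, hb⟩
  | or A B ihA ihB =>
    simp only [subst, fv, Finset.mem_union] at h ⊢
    rcases h with h | h
    · obtain ⟨a, ha, hb⟩ := ihA h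
      exact ⟨a, Or.inl ha, hb⟩
    · obtain ⟨a, ha, hb⟩ := ihB h
      exact ⟨a, Or.inr ha, hb⟩
  | ex x A ih =>
    obtain ⟨hb, h⟩ := Finset.mem_erase.1 h
    exact bound A x σ hb (ih h)
  | all x A ih =>
    obtain ⟨hb, h⟩ := Finset.mem_erase.1 h
    exact bound A x σ hb (ih h)

theorem mem_fv_subst1 {A : Formula L} {t : L.Term ℕ} {x b : ℕ} (h : b ∈ (A.subst1 t x).fv) :
    (b ∈ A.fv ∧ b ≠ x) ∨ b ∈ t.varFinset := by
  obtain ⟨a, ha, hb⟩ := mem_fv_subst h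
  by_cases e : a = x
  · subst e
    rw [Function.update_self] at hb
    exact Or.inr hb
  · rw [Function.update_of_ne e] at hb
    obtain rfl : b = a := by simpa [Term.varFinset] using hb
    exact Or.inl ⟨ha, e⟩

theorem isFO_subst {A : Formula L} (σ : ℕ → L.Term ℕ) (h : A.IsFO) : (A.subst σ).IsFO := by
  induction A generalizing σ with
  | eq | rel => trivial
  | indep => exact h.elim
  | neg A ih => exact ih σ h
  | and A B ihA ihB => exact ⟨ihA σ h.1, ihB σ h.2⟩
  | or A B ihA ihB => exact ⟨ihA σ h.1, ihB σ h.2⟩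
  | ex x A ih => exact ih _ h
  | all x A ih => exact ih _ h

theorem wf_subst {A : Formula L} (σ : ℕ → L.Term ℕ) (h : A.WF) : (A.subst σ).WF := by
  induction A generalizing σ with
  | eq | rel | indep => trivial
  | neg A ih => exact isFO_subst σ h
  | and A B ihA ihB => exact ⟨ihA σ h.1, ihB σ h.2⟩
  | or A B ihA ihB => exact ⟨ihA σ h.1, ihB σ h.2⟩
  | ex x A ih => exact ih _ h
  | all x A ih => exact ih _ h

theorem IsFO.wf {A : Formula L} (h : A.IsFO) : A.WF := by
  induction A with
  | eq | rel | indep => trivial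
  | neg A ih => exact h
  | and A B ihA ihB => exact ⟨ihA h.1, ihB h.2⟩
  | or A B ihA ihB => exact ⟨ihA h.1, ihB h.2⟩
  | ex x A ih => exact ih h
  | all x A ih => exact ih h

theorem fv_subset_vars (A : Formula L) : A.fv ⊆ A.vars := by
  induction A with
  | eq | rel | indep => exact subset_rfl
  | neg A ih => exact ih
  | and A B ihA ihB => exact Finset.union_subset_union ihA ihB
  | or A B ihA ihB => exact Finset.union_subset_union ihA ihB
  | ex x A ih => exact ((Finset.erase_subset _ _).trans ih).trans (Finset.subset_insert _ _)
  | all x A ih => exact ((Finset.erase_subset _ _).trans ih).trans (Finset.subset_insert _ _)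

theorem IsQF.vars_eq {A : Formula L} (h : A.IsQF) : A.vars = A.fv := by
  induction A with
  | eq | rel | indep => rfl
  | neg A ih => exact ih h
  | and A B ihA ihB => exact congrArg₂ _ (ihA h.1) (ihB h.2)
  | or A B ihA ihB => exact congrArg₂ _ (ihA h.1) (ihB h.2)
  | ex | all => exact h.elim

/-- Renaming `x` to a new variable `y` can be undone without capturing a variable. -/
theorem subst1_var_var {A : Formula L} {x y : ℕ} (hy : y ∉ A.vars) :
    (A.subst1 (Term.var y) x).FreeFor (Term.var x) y ∧
      (A.subst1 (Term.var y) x).subst1 (Term.var x) y = A := by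
  have hvar : ∀ a, a ≠ y → ((Function.update Term.var x (Term.var y) a : L.Term ℕ).subst
      (Function.update Term.var y (Term.var x))) = Term.var a := by
    intro a ha
    by_cases e : a = x
    · subst e; simp [Term.subst]
    · simp [Term.subst, e, ha]
  have hterm : ∀ t : L.Term ℕ, y ∉ t.varFinset → (t.subst (Function.update Term.var x
      (Term.var y))).subst (Function.update Term.var y (Term.var x)) = t := by
    intro t ht
    induction t with
    | var a => exact hvar a fun e => ht (by simp [Term.varFinset, e])
    | func f ts ih =>
      simp only [Term.varFinset, Finset.mem_biUnion, Finset.mem_univ, true_and, not_exists] at ht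
      simp only [Term.subst, ih _ (ht _)]
  have htuple : ∀ ts : List (L.Term ℕ), y ∉ tupleVars ts → (ts.map fun t => t.subst
      (Function.update Term.var x (Term.var y))).map
        (fun t => t.subst (Function.update Term.var y (Term.var x))) = ts := by
    intro ts hts
    rw [List.map_map]
    conv_rhs => rw [← List.map_id ts]
    exact List.map_congr_left fun t ht => hterm t fun h => hts (mem_tupleVars.2 ⟨t, ht, h⟩)
  induction A with
  | eq t₁ t₂ =>
    simp only [vars, Finset.mem_union, not_or] at hy
    exact ⟨trivial, congrArg₂ _ (hterm _ hy.1) (hterm _ hy.2)⟩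
  | rel R ts =>
    simp only [vars, Finset.mem_biUnion, Finset.mem_univ, true_and, not_exists] at hy
    exact ⟨trivial, congrArg _ (funext fun i => hterm _ (hy i))⟩
  | indep t₁ t₃ t₂ =>
    simp only [vars, Finset.mem_union, not_or] at hy
    refine ⟨trivial, ?_⟩
    simp only [subst1, subst, htuple _ hy.1.1, htuple _ hy.1.2, htuple _ hy.2]
  | neg A ih => exact ⟨(ih hy).1, congrArg _ (ih hy).2⟩
  | and A B ihA ihB =>
    simp only [vars, Finset.mem_union, not_or] at hy
    exact ⟨⟨(ihA hy.1).1, (ihB hy.2).1⟩, congrArg₂ _ (ihA hy.1).2 (ihB hy.2).2⟩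
  | or A B ihA ihB =>
    simp only [vars, Finset.mem_union, not_or] at hy
    exact ⟨⟨(ihA hy.1).1, (ihB hy.2).1⟩, congrArg₂ _ (ihA hy.1).2 (ihB hy.2).2⟩
  | ex z A ih =>
    have hz : y ∉ (ex z A).fv := fun h => hy (fv_subset_vars _ h)
    simp only [vars, Finset.mem_insert, not_or] at hy
    by_cases e : z = x
    · rw [subst1_of_notMem (A := ex z A) (x := x) (by simp [fv, e]), subst1_of_notMem hz]
      exact ⟨Or.inl hz, rfl⟩
    · rw [subst1_ex e, subst1_ex (Ne.symm hy.1), (ih hy.2).2]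
      exact ⟨Or.inr ⟨by simpa [Term.varFinset] using e, (ih hy.2).1⟩, rfl⟩
  | all z A ih =>
    have hz : y ∉ (all z A).fv := fun h => hy (fv_subset_vars _ h)
    simp only [vars, Finset.mem_insert, not_or] at hy
    by_cases e : z = x
    · rw [subst1_of_notMem (A := all z A) (x := x) (by simp [fv, e]), subst1_of_notMem hz]
      exact ⟨Or.inl hz, rfl⟩
    · rw [subst1_all e, subst1_all (Ne.symm hy.1), (ih hy.2).2]
      exact ⟨Or.inr ⟨by simpa [Term.varFinset] using e, (ih hy.2).1⟩, rfl⟩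

/-! ### Blocks of quantifiers and conjunctions -/

theorem allL_append (xs ys : List ℕ) (A : Formula L) :
    allL (xs ++ ys) A = allL xs (allL ys A) := List.foldr_append ..

theorem exL_append (xs ys : List ℕ) (A : Formula L) :
    exL (xs ++ ys) A = exL xs (exL ys A) := List.foldr_append ..

theorem mem_fv_allL {xs : List ℕ} {A : Formula L} {a : ℕ} :
    a ∈ (allL xs A).fv ↔ a ∈ A.fv ∧ a ∉ xs := by
  induction xs with
  | nil => simp [allL]
  | cons x xs ih =>
    change a ∈ (allL xs A).fv.erase x ↔ _
    simp only [Finset.mem_erase, ih, List.mem_cons, not_or]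
    tauto

theorem mem_fv_exL {xs : List ℕ} {A : Formula L} {a : ℕ} :
    a ∈ (exL xs A).fv ↔ a ∈ A.fv ∧ a ∉ xs := by
  induction xs with
  | nil => simp [exL]
  | cons x xs ih =>
    change a ∈ (exL xs A).fv.erase x ↔ _
    simp only [Finset.mem_erase, ih, List.mem_cons, not_or]
    tauto

theorem mem_fv_conj {Bs : List (Formula L)} {A : Formula L} {a : ℕ} :
    a ∈ (conj Bs A).fv ↔ (∃ B ∈ Bs, a ∈ B.fv) ∨ a ∈ A.fv := by
  induction Bs with
  | nil => simp [conj]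
  | cons B Bs ih =>
    change a ∈ B.fv ∪ (conj Bs A).fv ↔ _
    simp only [Finset.mem_union, ih, List.mem_cons, exists_eq_or_imp, or_assoc]

theorem mem_vars_exL {xs : List ℕ} {A : Formula L} {a : ℕ} :
    a ∈ (exL xs A).vars ↔ a ∈ A.vars ∨ a ∈ xs := by
  induction xs with
  | nil => simp [exL]
  | cons x xs ih =>
    change a ∈ insert x (exL xs A).vars ↔ _
    simp only [Finset.mem_insert, ih, List.mem_cons]
    tauto

theorem mem_fv_indepVar {u w v : List ℕ} {a : ℕ} :
    a ∈ (indepVar (L := L) u w v).fv ↔ a ∈ u ∨ a ∈ w ∨ a ∈ v := by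
  simp only [indepVar, fv, Finset.mem_union, tupleVars_varTuple]
  tauto

theorem wf_allL {xs : List ℕ} {A : Formula L} (h : A.WF) : (allL xs A).WF := by
  induction xs with
  | nil => exact h
  | cons x xs ih => exact ih

theorem wf_exL {xs : List ℕ} {A : Formula L} (h : A.WF) : (exL xs A).WF := by
  induction xs with
  | nil => exact h
  | cons x xs ih => exact ih

theorem wf_conj {Bs : List (Formula L)} {A : Formula L} (hB : ∀ B ∈ Bs, B.WF) (h : A.WF) :
    (conj Bs A).WF := by
  induction Bs with
  | nil => exact h
  | cons B Bs ih =>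
    exact ⟨hB B (by simp), ih fun C hC => hB C (by simp [hC])⟩

theorem isQF_conj {Bs : List (Formula L)} {A : Formula L} (hB : ∀ B ∈ Bs, B.IsQF) (h : A.IsQF) :
    (conj Bs A).IsQF := by
  induction Bs with
  | nil => exact h
  | cons B Bs ih =>
    exact ⟨hB B (by simp), ih fun C hC => hB C (by simp [hC])⟩

/-! ### Team semantics of substitutions and quantifier blocks -/

section Semantics

variable {M : Type w} [L.Structure M]

theorem realize_subst1 (t' t : L.Term ℕ) (x : ℕ) (s : ℕ → M) :
    (t'.subst (Function.update Term.var x t)).realize s =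
      t'.realize (Function.update s x (t.realize s)) := by
  rw [Term.realize_subst]
  congr 1
  funext a
  by_cases e : a = x
  · subst e; simp
  · simp [e]

theorem tupleVal_subst1 (ts : List (L.Term ℕ)) (t : L.Term ℕ) (x : ℕ) (s : ℕ → M) :
    tupleVal (ts.map fun t' => t'.subst (Function.update Term.var x t)) s =
      tupleVal ts (Function.update s x (t.realize s)) := by
  simp only [tupleVal, List.map_map, Function.comp_def, realize_subst1]

theorem realize_update_of_notMem {t : L.Term ℕ} {y : ℕ} (h : y ∉ t.varFinset) (s : ℕ → M) (a : M) :
    t.realize (Function.update s y a) = t.realize s :=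
  realize_congr t fun _ hx => Function.update_of_ne (ne_of_mem_of_not_mem hx h) _ _

/-- The side condition of `FreeFor` at a quantifier, with the trivial case of a bound `x` moved to
the first alternative. -/
theorem freeFor_quantifier {A : Formula L} {t : L.Term ℕ} {x y : ℕ}
    (h : x ∉ A.fv.erase y ∨ (y ∉ t.varFinset ∧ A.FreeFor t x)) :
    x ∉ A.fv.erase y ∨ (y ≠ x ∧ y ∉ t.varFinset ∧ A.FreeFor t x) := by
  by_cases e : y = x
  · subst e; left; simp
  · exact h.imp_right fun h => ⟨e, h⟩

theorem tarski_subst1 {A : Formula L} {t : L.Term ℕ} {x : ℕ} (h : A.FreeFor t x) (s : ℕ → M) :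
    (A.subst1 t x).Tarski s ↔ A.Tarski (Function.update s x (t.realize s)) := by
  have vac : ∀ (B : Formula L) (s : ℕ → M), x ∉ B.fv →
      ((B.subst1 t x).Tarski s ↔ B.Tarski (Function.update s x (t.realize s))) := by
    intro B s hx
    rw [subst1_of_notMem hx]
    exact tarski_congr B fun a ha => (Function.update_of_ne (ne_of_mem_of_not_mem ha hx) _ _).symm
  induction A generalizing s with
  | eq t₁ t₂ => simp only [subst1, subst, Tarski, realize_subst1]
  | rel R ts => simp only [subst1, subst, Tarski, realize_subst1]
  | indep => exact Iff.rfl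
  | neg A ih => exact not_congr (ih h s)
  | and A B ihA ihB => exact and_congr (ihA h.1 s) (ihB h.2 s)
  | or A B ihA ihB => exact or_congr (ihA h.1 s) (ihB h.2 s)
  | ex y A ih =>
    rcases freeFor_quantifier h with hx | ⟨hne, hy, h⟩
    · exact vac _ s hx
    · rw [subst1_ex hne]
      refine exists_congr fun a => (ih h _).trans ?_
      rw [realize_update_of_notMem hy, Function.update_comm hne]
  | all y A ih =>
    rcases freeFor_quantifier h with hx | ⟨hne, hy, h⟩
    · exact vac _ s hx
    · rw [subst1_all hne]
      refine forall_congr' fun a => (ih h _).trans ?_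
      rw [realize_update_of_notMem hy, Function.update_comm hne]

/-- The substitution lemma of team semantics: a team satisfies `A(t/x)` when the team that results
from giving `x` the value of `t` in each of its assignments satisfies `A`. -/
theorem sat_subst1 {A : Formula L} {t : L.Term ℕ} {x : ℕ} (h : A.FreeFor t x)
    (X : Set (ℕ → M)) :
    (A.subst1 t x).Sat X ↔ A.Sat ((fun s => Function.update s x (t.realize s)) '' X) := by
  have vac : ∀ (B : Formula L) (X : Set (ℕ → M)), x ∉ B.fv →
      ((B.subst1 t x).Sat X ↔ B.Sat ((fun s => Function.update s x (t.realize s)) '' X)) := by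
    intro B X hx
    have e : ∀ s : ℕ → M, ∀ a ∈ B.fv, s a = Function.update s x (t.realize s) a := fun s a ha =>
      (Function.update_of_ne (ne_of_mem_of_not_mem ha hx) _ _).symm
    rw [subst1_of_notMem hx]
    constructor
    · refine sat_congr B _ _ (fun s hs => ⟨_, ⟨s, hs, rfl⟩, e s⟩) ?_
      rintro _ ⟨s, hs, rfl⟩
      exact ⟨s, hs, e s⟩
    · refine sat_congr B _ _ ?_ (fun s hs => ⟨_, ⟨s, hs, rfl⟩, fun a ha => (e s a ha).symm⟩)
      rintro _ ⟨s, hs, rfl⟩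
      exact ⟨s, hs, fun a ha => (e s a ha).symm⟩
  induction A generalizing X with
  | eq t₁ t₂ => simp only [subst1, subst, Sat, realize_subst1, Set.forall_mem_image]
  | rel R ts => simp only [subst1, subst, Sat, realize_subst1, Set.forall_mem_image]
  | indep t₁ t₃ t₂ =>
    simp only [subst1, subst, Sat, tupleVal_subst1, Set.forall_mem_image, Set.exists_mem_image]
  | neg A ih =>
    simp only [Sat, Set.forall_mem_image]
    exact forall₂_congr fun s _ => not_congr (tarski_subst1 (A := A) h s)
  | and A B ihA ihB => exact and_congr (ihA h.1 X) (ihB h.2 X)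
  | or A B ihA ihB =>
    constructor
    · rintro ⟨Y, Z, rfl, hY, hZ⟩
      exact ⟨_, _, (Set.image_union _ Y Z).symm, (ihA h.1 Y).1 hY, (ihB h.2 Z).1 hZ⟩
    · rintro ⟨Y, Z, e, hY, hZ⟩
      obtain ⟨Y', -, rfl⟩ := Set.subset_image_iff.1 (e ▸ Set.subset_union_left : Y ⊆ _)
      obtain ⟨Z', -, rfl⟩ := Set.subset_image_iff.1 (e ▸ Set.subset_union_right : Z ⊆ _)
      set f : (ℕ → M) → ℕ → M := fun s => Function.update s x (t.realize s) with hf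
      -- a splitting of the image pulls back to the splitting of `X` into preimages
      have pre : ∀ Y' : Set (ℕ → M), f '' Y' ⊆ f '' X → f '' {s ∈ X | f s ∈ f '' Y'} = f '' Y' := by
        intro Y' hY'
        ext r
        constructor
        · rintro ⟨s, ⟨-, hs⟩, rfl⟩
          exact hs
        · intro hr
          obtain ⟨s, hs, rfl⟩ := hY' hr
          exact ⟨s, ⟨hs, hr⟩, rfl⟩
      refine ⟨{s ∈ X | f s ∈ f '' Y'}, {s ∈ X | f s ∈ f '' Z'}, ?_, (ihA h.1 _).2 ?_,
        (ihB h.2 _).2 ?_⟩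
      · ext s
        constructor
        · rintro (hs | hs) <;> exact hs.1
        · intro hs
          have : f s ∈ f '' Y' ∪ f '' Z' := e ▸ ⟨s, hs, rfl⟩
          exact this.imp (fun h => ⟨hs, h⟩) fun h => ⟨hs, h⟩
      · rw [pre Y' (e ▸ Set.subset_union_left)]
        exact hY
      · rw [pre Z' (e ▸ Set.subset_union_right)]
        exact hZ
  | ex y A ih =>
    rcases freeFor_quantifier h with hx | ⟨hne, hy, h⟩
    · exact vac _ X hx
    · rw [subst1_ex hne]
      have comm : ∀ (s : ℕ → M) (a : M), Function.update (Function.update s y a) x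
          (t.realize (Function.update s y a)) =
            Function.update (Function.update s x (t.realize s)) y a := fun s a => by
        rw [realize_update_of_notMem hy, Function.update_comm hne]
      constructor
      · rintro ⟨F, hF, hA⟩
        refine ⟨fun r => {a | ∃ s ∈ X, Function.update s x (t.realize s) = r ∧ a ∈ F s}, ?_, ?_⟩
        · rintro _ ⟨s, hs, rfl⟩
          obtain ⟨a, ha⟩ := hF s hs
          exact ⟨a, s, hs, rfl, ha⟩
        · convert (ih h _).1 hA using 1
          ext r
          constructor
          · rintro ⟨_, -, a, ⟨s, hs, rfl, ha⟩, rfl⟩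
            exact ⟨_, ⟨s, hs, a, ha, rfl⟩, comm s a⟩
          · rintro ⟨_, ⟨s, hs, a, ha, rfl⟩, rfl⟩
            exact ⟨_, ⟨s, hs, rfl⟩, a, ⟨s, hs, rfl, ha⟩, comm s a⟩
      · rintro ⟨F, hF, hA⟩
        refine ⟨fun s => F (Function.update s x (t.realize s)), fun s hs => hF _ ⟨s, hs, rfl⟩,
          (ih h _).2 ?_⟩
        convert hA using 1
        ext r
        constructor
        · rintro ⟨_, ⟨s, hs, a, ha, rfl⟩, rfl⟩
          exact ⟨_, ⟨s, hs, rfl⟩, a, ha, comm s a⟩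
        · rintro ⟨_, ⟨s, hs, rfl⟩, a, ha, rfl⟩
          exact ⟨_, ⟨s, hs, a, ha, rfl⟩, comm s a⟩
  | all y A ih =>
    rcases freeFor_quantifier h with hx | ⟨hne, hy, h⟩
    · exact vac _ X hx
    · rw [subst1_all hne]
      have comm : ∀ (s : ℕ → M) (a : M), Function.update (Function.update s y a) x
          (t.realize (Function.update s y a)) =
            Function.update (Function.update s x (t.realize s)) y a := fun s a => by
        rw [realize_update_of_notMem hy, Function.update_comm hne]
      refine (ih h _).trans (Eq.to_iff (congrArg A.Sat ?_))
      ext r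
      constructor
      · rintro ⟨_, ⟨s, hs, a, rfl⟩, rfl⟩
        exact ⟨_, ⟨s, hs, rfl⟩, a, comm s a⟩
      · rintro ⟨_, ⟨s, hs, rfl⟩, a, rfl⟩
        exact ⟨_, ⟨s, hs, a, rfl⟩, comm s a⟩

theorem sat_empty (A : Formula L) : A.Sat (∅ : Set (ℕ → M)) := by
  induction A with
  | eq | rel | neg | indep => intro s hs; exact hs.elim
  | and A B ihA ihB => exact ⟨ihA, ihB⟩
  | or A B ihA ihB => exact ⟨∅, ∅, Set.union_self _, ihA, ihB⟩
  | ex x A ih =>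
    refine ⟨fun _ => ∅, fun s hs => hs.elim, ?_⟩
    convert ih
    ext s
    simp [supplement]
  | all x A ih =>
    change A.Sat (duplicate ∅ x)
    convert ih
    ext s
    simp [duplicate]

/-- The team `T` extends the team `X` on the variables `xs`: the two have the same restrictions to
the remaining variables. -/
def Ext (xs : List ℕ) (X T : Set (ℕ → M)) : Prop :=
  (∀ t ∈ T, ∃ s ∈ X, ∀ a, a ∉ xs → s a = t a) ∧ ∀ s ∈ X, ∃ t ∈ T, ∀ a, a ∉ xs → s a = t a

theorem sat_ex_iff {A : Formula L} {x : ℕ} {X : Set (ℕ → M)} :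
    (ex x A).Sat X ↔ ∃ T, Ext [x] X T ∧ A.Sat T := by
  have upd : ∀ (s : ℕ → M) (a : M) (b : ℕ), b ∉ [x] → s b = Function.update s x a b :=
    fun s a b hb => (Function.update_of_ne (by simpa using hb) _ _).symm
  constructor
  · rintro ⟨F, hF, hA⟩
    refine ⟨_, ⟨?_, fun s hs => ?_⟩, hA⟩
    · rintro _ ⟨s, hs, a, -, rfl⟩
      exact ⟨s, hs, upd s a⟩
    · obtain ⟨a, ha⟩ := hF s hs
      exact ⟨_, ⟨s, hs, a, ha, rfl⟩, upd s a⟩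
  · rintro ⟨T, ⟨h₁, h₂⟩, hA⟩
    have eq : ∀ s t : ℕ → M, (∀ a, a ∉ [x] → s a = t a) → t = Function.update s x (t x) := by
      intro s t e
      funext a
      by_cases h : a = x
      · subst h; simp
      · simp [h, e a (by simpa using h)]
    refine ⟨fun s => {a | Function.update s x a ∈ T}, fun s hs => ?_, ?_⟩
    · obtain ⟨t, ht, e⟩ := h₂ s hs
      exact ⟨t x, show _ ∈ T from eq s t e ▸ ht⟩
    · convert hA
      ext t
      constructor
      · rintro ⟨s, -, a, ha, rfl⟩
        exact ha
      · intro ht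
        obtain ⟨s, hs, e⟩ := h₁ t ht
        exact ⟨s, hs, t x, show _ ∈ T from eq s t e ▸ ht, eq s t e⟩

theorem sat_exL_iff {xs : List ℕ} {A : Formula L} {X : Set (ℕ → M)} :
    (exL xs A).Sat X ↔ ∃ T, Ext xs X T ∧ A.Sat T := by
  induction xs generalizing X with
  | nil =>
    constructor
    · intro h
      exact ⟨X, ⟨fun s hs => ⟨s, hs, fun _ _ => rfl⟩, fun s hs => ⟨s, hs, fun _ _ => rfl⟩⟩, h⟩
    · rintro ⟨T, ⟨h₁, h₂⟩, hA⟩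
      have eq : ∀ s t : ℕ → M, (∀ a, a ∉ ([] : List ℕ) → s a = t a) → s = t :=
        fun s t h => funext fun a => h a (by simp)
      have : X = T := by
        ext s
        constructor
        · intro hs
          obtain ⟨t, ht, e⟩ := h₂ s hs
          exact eq s t e ▸ ht
        · intro hs
          obtain ⟨t, ht, e⟩ := h₁ s hs
          exact eq t s e ▸ ht
      exact this ▸ hA
  | cons x xs ih =>
    change (ex x (exL xs A)).Sat X ↔ _
    rw [sat_ex_iff]
    simp only [ih]
    constructor
    · rintro ⟨Y, ⟨h₁, h₂⟩, T, ⟨h₃, h₄⟩, hA⟩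
      refine ⟨T, ⟨fun t ht => ?_, fun s hs => ?_⟩, hA⟩
      · obtain ⟨r, hr, e⟩ := h₃ t ht
        obtain ⟨s, hs, e'⟩ := h₁ r hr
        refine ⟨s, hs, fun a ha => ?_⟩
        simp only [List.mem_cons, not_or] at ha
        rw [e' a (by simpa using ha.1), e a ha.2]
      · obtain ⟨r, hr, e⟩ := h₂ s hs
        obtain ⟨t, ht, e'⟩ := h₄ r hr
        refine ⟨t, ht, fun a ha => ?_⟩
        simp only [List.mem_cons, not_or] at ha
        rw [e a (by simpa using ha.1), e' a ha.2]
    · rintro ⟨T, ⟨h₁, h₂⟩, hA⟩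
      have key : ∀ s t : ℕ → M, (∀ a, a ∉ x :: xs → s a = t a) →
          (∀ a, a ∉ [x] → s a = Function.update s x (t x) a) ∧
            ∀ a, a ∉ xs → Function.update s x (t x) a = t a := by
        intro s t e
        refine ⟨fun a ha => (Function.update_of_ne (by simpa using ha) _ _).symm, fun a ha => ?_⟩
        by_cases h : a = x
        · subst h; simp
        · simp [h, e a (by simp [h, ha])]
      -- the team between `X` and `T`, in which only the variable `x` has been given its value
      refine ⟨{r | ∃ s ∈ X, ∃ t ∈ T, (∀ a, a ∉ x :: xs → s a = t a) ∧
        r = Function.update s x (t x)}, ⟨?_, fun s hs => ?_⟩, T, ⟨fun t ht => ?_, ?_⟩, hA⟩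
      · rintro _ ⟨s, hs, t, ht, e, rfl⟩
        exact ⟨s, hs, (key s t e).1⟩
      · obtain ⟨t, ht, e⟩ := h₂ s hs
        exact ⟨_, ⟨s, hs, t, ht, e, rfl⟩, (key s t e).1⟩
      · obtain ⟨s, hs, e⟩ := h₁ t ht
        exact ⟨_, ⟨s, hs, t, ht, e, rfl⟩, (key s t e).2⟩
      · rintro _ ⟨s, hs, t, ht, e, rfl⟩
        exact ⟨t, ht, (key s t e).2⟩

theorem sat_all_all_iff {α β : ℕ} {A : Formula L} {X : Set (ℕ → M)} :
    (all α (all β A)).Sat X ↔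
      A.Sat {t | ∃ s ∈ X, ∃ p q, t = Function.update (Function.update s α p) β q} := by
  change A.Sat (duplicate (duplicate X α) β) ↔ _
  refine Eq.to_iff (congrArg A.Sat ?_)
  ext t
  constructor
  · rintro ⟨_, ⟨s, hs, p, rfl⟩, q, rfl⟩
    exact ⟨s, hs, p, q, rfl⟩
  · rintro ⟨s, hs, p, q, rfl⟩
    exact ⟨_, ⟨s, hs, p, rfl⟩, q, rfl⟩

theorem sat_conj_iff {Bs : List (Formula L)} {A : Formula L} {X : Set (ℕ → M)} :
    (conj Bs A).Sat X ↔ (∀ B ∈ Bs, B.Sat X) ∧ A.Sat X := by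
  induction Bs with
  | nil => simp [conj]
  | cons B Bs ih =>
    change B.Sat X ∧ (conj Bs A).Sat X ↔ _
    rw [ih, List.forall_mem_cons, and_assoc]

theorem sat_indepVar_iff {u w v : List ℕ} {X : Set (ℕ → M)} :
    (indepVar (L := L) u w v).Sat X ↔ ∀ s ∈ X, ∀ s' ∈ X, (∀ a ∈ w, s a = s' a) →
      ∃ s'' ∈ X, (∀ a ∈ u, s'' a = s a) ∧ (∀ a ∈ w, s'' a = s a) ∧ ∀ a ∈ v, s'' a = s' a := by
  simp only [indepVar, Sat, tupleVal_varTuple, List.map_inj_left]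

/-- A formula without free occurrences of `x` does not see a universal quantification of `x`. -/
theorem sat_duplicate_iff [Nonempty M] {B : Formula L} {x : ℕ} (hx : x ∉ B.fv)
    {X : Set (ℕ → M)} : B.Sat (duplicate X x) ↔ B.Sat X := by
  have e : ∀ (s : ℕ → M) (b : M), ∀ a ∈ B.fv, Function.update s x b a = s a := fun s b a ha =>
    Function.update_of_ne (ne_of_mem_of_not_mem ha hx) _ _
  inhabit M
  constructor
  · refine sat_congr B _ _ ?_ fun s hs => ⟨_, ⟨s, hs, default, rfl⟩, e s _⟩
    rintro _ ⟨s, hs, b, rfl⟩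
    exact ⟨s, hs, e s b⟩
  · refine sat_congr B _ _
      (fun s hs => ⟨_, ⟨s, hs, default, rfl⟩, fun a ha => (e s _ a ha).symm⟩) ?_
    rintro _ ⟨s, hs, b, rfl⟩
    exact ⟨s, hs, fun a ha => (e s b a ha).symm⟩

/-- A formula without free occurrences of `x` does not see a supplementation of `x`. -/
theorem sat_supplement_iff {B : Formula L} {x : ℕ} (hx : x ∉ B.fv) {X : Set (ℕ → M)}
    {F : (ℕ → M) → Set M} (hF : ∀ s ∈ X, (F s).Nonempty) :
    B.Sat (supplement X F x) ↔ B.Sat X := by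
  have e : ∀ (s : ℕ → M) (b : M), ∀ a ∈ B.fv, Function.update s x b a = s a := fun s b a ha =>
    Function.update_of_ne (ne_of_mem_of_not_mem ha hx) _ _
  constructor
  · refine sat_congr B _ _ ?_ fun s hs => ?_
    · rintro _ ⟨s, hs, b, -, rfl⟩
      exact ⟨s, hs, e s b⟩
    · obtain ⟨b, hb⟩ := hF s hs
      exact ⟨_, ⟨s, hs, b, hb, rfl⟩, e s b⟩
  · refine sat_congr B _ _ (fun s hs => ?_) ?_
    · obtain ⟨b, hb⟩ := hF s hs
      exact ⟨_, ⟨s, hs, b, hb, rfl⟩, fun a ha => (e s b a ha).symm⟩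
    · rintro _ ⟨s, hs, b, -, rfl⟩
      exact ⟨s, hs, fun a ha => (e s b a ha).symm⟩

end Semantics

end Formula

open Formula

/-! ### Structural rules of the deduction system -/

theorem Deriv.mono {Γ Γ' : Set (Formula L)} {A : Formula L} (h : Deriv Γ A) (hΓ : Γ ⊆ Γ') :
    Deriv Γ' A := by
  induction h generalizing Γ' with
  | assumption hA => exact assumption (hΓ hA)
  | andI _ _ ih₁ ih₂ => exact andI (ih₁ hΓ) (ih₂ hΓ)
  | andE₁ _ ih => exact andE₁ (ih hΓ)
  | andE₂ _ ih => exact andE₂ (ih hΓ)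
  | orI₁ hB _ ih => exact orI₁ hB (ih hΓ)
  | orI₂ hA _ ih => exact orI₂ hA (ih hΓ)
  | orE hC _ _ _ ih ih₁ ih₂ =>
    exact orE hC (ih hΓ) (ih₁ (Set.insert_subset_insert hΓ)) (ih₂ (Set.insert_subset_insert hΓ))
  | negI hA hB _ ih => exact negI hA hB (ih (Set.insert_subset_insert hΓ))
  | negE hA _ ih => exact negE hA (ih hΓ)
  | allI hΔ hx h _ => exact allI (hΔ.trans hΓ) hx h
  | allE hA ht _ ih => exact allE hA ht (ih hΓ)
  | exI ht _ ih => exact exI ht (ih hΓ)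
  | exE hΔ hx hB _ h₂ ih => exact exE (hΔ.trans hΓ) hx hB (ih hΓ) h₂
  | orSubst _ _ ih₁ ih₂ => exact orSubst (ih₁ hΓ) (ih₂ (Set.insert_subset_insert hΓ))
  | orComm _ ih => exact orComm (ih hΓ)
  | orAssoc _ ih => exact orAssoc (ih hΓ)
  | allScope hx hy h _ ih => exact allScope hx hy h (ih hΓ)
  | exScope hx _ ih => exact exScope hx (ih hΓ)
  | allSubst hΔ hy hy' hf _ h ih => exact allSubst (hΔ.trans hΓ) hy hy' hf (ih hΓ) h
  | indepDistrib h₁ h₂ h₃ h₄ h₅ h₆ h₇ h₈ _ ih =>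
    exact indepDistrib h₁ h₂ h₃ h₄ h₅ h₆ h₇ h₈ (ih hΓ)
  | indepIntro hxy hz h _ ih => exact indepIntro hxy hz h (ih hΓ)
  | indepTrans T hT _ ih => exact indepTrans T hT (ih hΓ)
  | eqRefl x => exact eqRefl x
  | eqSymm _ ih => exact eqSymm (ih hΓ)
  | eqTerm t _ ih => exact eqTerm t (ih hΓ)
  | eqSubst hf _ ih => exact eqSubst hf (ih hΓ)

theorem Deriv.head {Γ : Set (Formula L)} {A : Formula L} : Deriv (insert A Γ) A :=
  assumption (Set.mem_insert _ _)

theorem Deriv.hyp {A : Formula L} : Deriv {A} A := assumption rfl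

/-- The cut rule for a derivation from a single assumption.  The assumption is bound by a vacuous
existential quantifier, which is introduced and then eliminated. -/
theorem Deriv.cut {Γ : Set (Formula L)} {A B : Formula L} (hA : Deriv Γ A) (h : Deriv {A} B) :
    Deriv Γ B := by
  obtain ⟨x, hx⟩ := Infinite.exists_notMem_finset B.fv
  refine exE (Δ := ∅) (Set.empty_subset _) (by simp) hx
    (exI (t := Term.var x) (freeFor_self A x) ?_) (h.mono (by simp))
  rwa [subst1_self]

theorem Deriv.ex_intro {Γ : Set (Formula L)} {x : ℕ} {A : Formula L} (h : Deriv Γ A) :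
    Deriv Γ (ex x A) :=
  exI (t := Term.var x) (freeFor_self A x) (by rwa [subst1_self])

theorem Deriv.eq_refl {Γ : Set (Formula L)} (t : L.Term ℕ) : Deriv Γ (Formula.eq t t) := by
  have := eqTerm t (eqRefl (L := L) (Γ := Γ) 0)
  rwa [term_subst_var fun a _ => by rw [Function.update_eq_self]] at this

/-- Classical reasoning by contradiction between first-order formulas. -/
theorem Deriv.by_contra {Γ : Set (Formula L)} {A B : Formula L} (hA : A.IsFO) (hB : B.IsFO)
    (h₁ : Deriv (insert (neg A) Γ) B) (h₂ : Deriv (insert (neg A) Γ) (neg B)) : Deriv Γ A :=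
  negE hA (negI (A := neg A) hA hB (andI h₁ h₂))

/-! ### Derivable equivalence -/

/-- `Reduces A B`: `B` is derivable from `A`, the two are logically equivalent, and the free
variables of `B` are free in `A`.  This is the relation in which a formula stands to the formulas on
the way to its normal form. -/
structure Reduces (A B : Formula L) : Prop where
  deriv : Deriv {A} B
  equiv : LogEquiv.{u, v, w} A B
  fv_subset : B.fv ⊆ A.fv

namespace Reduces

variable {A A' B B' C : Formula L}

theorem of_iff (hd : Deriv {A} B)
    (he : ∀ (M : Type w) [L.Structure M] [Nonempty M] (X : Set (ℕ → M)), A.Sat X ↔ B.Sat X)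
    (hf : B.fv ⊆ A.fv) : Reduces.{u, v, w} A B :=
  ⟨hd, ⟨fun M _ _ X => (he M X).1, fun M _ _ X => (he M X).2⟩, hf⟩

theorem sat_iff (h : Reduces.{u, v, w} A B) (M : Type w) [L.Structure M] [Nonempty M]
    (X : Set (ℕ → M)) :
    A.Sat X ↔ B.Sat X := ⟨h.equiv.1 M X, h.equiv.2 M X⟩

theorem refl (A : Formula L) :
    Reduces.{u, v, w} A A := of_iff .hyp (fun _ _ _ _ => Iff.rfl) subset_rfl

theorem trans (h₁ : Reduces.{u, v, w} A B) (h₂ : Reduces.{u, v, w} B C) : Reduces.{u, v, w} A C :=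
  of_iff (h₁.deriv.cut h₂.deriv) (fun M _ _ X => (h₁.sat_iff M X).trans (h₂.sat_iff M X))
    (h₂.fv_subset.trans h₁.fv_subset)

theorem and_congr (h₁ : Reduces.{u, v, w} A A') (h₂ : Reduces.{u, v, w} B B') :
    Reduces.{u, v, w} (and A B) (and A' B') :=
  of_iff (.andI (Deriv.hyp.andE₁.cut h₁.deriv) (Deriv.hyp.andE₂.cut h₂.deriv))
    (fun M _ _ X => _root_.and_congr (h₁.sat_iff M X) (h₂.sat_iff M X))
    (Finset.union_subset_union h₁.fv_subset h₂.fv_subset)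

theorem or_comm (A B : Formula L) : Reduces.{u, v, w} (or A B) (or B A) :=
  of_iff (.orComm .hyp)
    (fun _ _ _ _ => ⟨fun ⟨Y, Z, e, hY, hZ⟩ => ⟨Z, Y, Set.union_comm Z Y ▸ e, hZ, hY⟩,
      fun ⟨Y, Z, e, hY, hZ⟩ => ⟨Z, Y, Set.union_comm Z Y ▸ e, hZ, hY⟩⟩)
    (Finset.union_comm _ _).subset

theorem or_congr_right (h : Reduces.{u, v, w} B B') : Reduces.{u, v, w} (or A B) (or A B') :=
  of_iff (.orSubst .hyp (Deriv.head.cut h.deriv))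
    (fun M _ _ _ => exists₂_congr fun _ Z => and_congr_right' (and_congr_right' (h.sat_iff M Z)))
    (Finset.union_subset_union_right h.fv_subset)

theorem or_congr (h₁ : Reduces.{u, v, w} A A') (h₂ : Reduces.{u, v, w} B B') :
    Reduces.{u, v, w} (or A B) (or A' B') :=
  (or_congr_right h₂).trans <| (or_comm _ _).trans <| (or_congr_right h₁).trans (or_comm _ _)

theorem ex_congr (x : ℕ) (h : Reduces.{u, v, w} A B) : Reduces.{u, v, w} (ex x A) (ex x B) :=
  of_iff (.exE (Set.empty_subset _) (by simp) (by simp [fv]) .hyp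
      (Deriv.head.cut h.deriv).ex_intro)
    (fun M _ _ _ => exists_congr fun F => and_congr_right' (h.sat_iff M _))
    (Finset.erase_subset_erase _ h.fv_subset)

theorem all_congr (x : ℕ) (h : Reduces.{u, v, w} A B) : Reduces.{u, v, w} (all x A) (all x B) :=
  of_iff (.allSubst (x := x) (A := A) (Set.empty_subset _) (by simp) (by simp [fv])
      (freeFor_self A x) .hyp (by rw [subst1_self]; exact Deriv.head.cut h.deriv))
    (fun M _ _ _ => h.sat_iff M _)
    (Finset.erase_subset_erase _ h.fv_subset)

theorem exL_congr (xs : List ℕ) (h : Reduces.{u, v, w} A B) :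
    Reduces.{u, v, w} (exL xs A) (exL xs B) := by
  induction xs with
  | nil => exact h
  | cons x xs ih => exact ex_congr x ih

theorem allL_congr (xs : List ℕ) (h : Reduces.{u, v, w} A B) :
    Reduces.{u, v, w} (allL xs A) (allL xs B) := by
  induction xs with
  | nil => exact h
  | cons x xs ih => exact all_congr x ih

/-! ### Conjunctions -/

theorem and_comm (A B : Formula L) : Reduces.{u, v, w} (and A B) (and B A) :=
  of_iff (.andI (.andE₂ .hyp) (.andE₁ .hyp)) (fun _ _ _ _ => _root_.and_comm)
    (Finset.union_comm _ _).subset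

theorem and_assoc (A B C : Formula L) : Reduces.{u, v, w} (and (and A B) C) (and A (and B C)) :=
  of_iff (.andI (.andE₁ (.andE₁ .hyp)) (.andI (.andE₂ (.andE₁ .hyp)) (.andE₂ .hyp)))
    (fun _ _ _ _ => _root_.and_assoc) (Finset.union_assoc _ _ _).symm.subset

theorem and_left_comm (A B C : Formula L) : Reduces.{u, v, w} (and A (and B C)) (and B (and A C)) :=
  of_iff (.andI (.andE₁ (.andE₂ .hyp)) (.andI (.andE₁ .hyp) (.andE₂ (.andE₂ .hyp))))
    (fun _ _ _ _ => _root_.and_left_comm) (Finset.union_left_comm _ _ _).subset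

theorem and_conj (Bs : List (Formula L)) (A B : Formula L) :
    Reduces.{u, v, w} (and A (conj Bs B)) (conj Bs (and A B)) := by
  induction Bs with
  | nil => exact refl _
  | cons C Bs ih => exact (and_left_comm _ _ _).trans (and_congr (refl C) ih)

theorem conj_and_conj (Bs Cs : List (Formula L)) (A B : Formula L) :
    Reduces.{u, v, w} (and (conj Bs A) (conj Cs B)) (conj (Bs ++ Cs) (and A B)) := by
  induction Bs with
  | nil => exact and_conj Cs A B
  | cons C Bs ih => exact (and_assoc _ _ _).trans (and_congr (refl C) ih)

theorem all_and {x : ℕ} (hx : x ∉ B.fv) :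
    Reduces.{u, v, w} (and (all x A) B) (all x (and A B)) := by
  refine of_iff (.allSubst (x := x) (A := A) (Δ := {and (all x A) B}) subset_rfl ?_ (by simp [fv])
    (freeFor_self A x) (.andE₁ .hyp) ?_) (fun M _ _ X => ?_) ?_
  · rintro _ rfl
    simp [fv, hx]
  · rw [subst1_self]
    exact .andI .head (.andE₂ (A := all x A) (.assumption (by simp)))
  · exact and_congr_right' (sat_duplicate_iff hx).symm
  · intro a
    simp only [fv, Finset.mem_erase, Finset.mem_union]
    tauto

theorem ex_and {x : ℕ} (hx : x ∉ B.fv) : Reduces.{u, v, w} (and (ex x A) B) (ex x (and A B)) := by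
  refine of_iff (.exE (A := A) (Δ := {and (ex x A) B}) subset_rfl ?_ (by simp [fv])
    (.andE₁ .hyp) (.ex_intro ?_)) (fun M _ _ X => ?_) ?_
  · rintro _ rfl
    simp [fv, hx]
  · exact .andI .head (.andE₂ (A := ex x A) (.assumption (by simp)))
  · constructor
    · rintro ⟨⟨F, hF, hA⟩, hB⟩
      exact ⟨F, hF, hA, (sat_supplement_iff hx hF).2 hB⟩
    · rintro ⟨F, hF, hA, hB⟩
      exact ⟨⟨F, hF, hA⟩, (sat_supplement_iff hx hF).1 hB⟩
  · intro a
    simp only [fv, Finset.mem_erase, Finset.mem_union]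
    tauto

theorem allL_and {xs : List ℕ} (hx : ∀ a ∈ xs, a ∉ B.fv) :
    Reduces.{u, v, w} (and (allL xs A) B) (allL xs (and A B)) := by
  induction xs with
  | nil => exact refl _
  | cons x xs ih =>
    exact (all_and (hx x (by simp))).trans (all_congr x (ih fun a ha => hx a (by simp [ha])))

theorem exL_and {xs : List ℕ} (hx : ∀ a ∈ xs, a ∉ B.fv) :
    Reduces.{u, v, w} (and (exL xs A) B) (exL xs (and A B)) := by
  induction xs with
  | nil => exact refl _
  | cons x xs ih =>
    exact (ex_and (hx x (by simp))).trans (ex_congr x (ih fun a ha => hx a (by simp [ha])))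

theorem and_allL {xs : List ℕ} (hx : ∀ a ∈ xs, a ∉ B.fv) :
    Reduces.{u, v, w} (and B (allL xs A)) (allL xs (and B A)) :=
  (and_comm _ _).trans ((allL_and hx).trans (allL_congr xs (and_comm _ _)))

theorem and_exL {xs : List ℕ} (hx : ∀ a ∈ xs, a ∉ B.fv) :
    Reduces.{u, v, w} (and B (exL xs A)) (exL xs (and B A)) :=
  (and_comm _ _).trans ((exL_and hx).trans (exL_congr xs (and_comm _ _)))

/-! ### Negations of first-order formulas -/

/-- Between first-order formulas, logical equivalence is equivalence in every assignment. -/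
theorem of_tarski_iff (hA : A.IsFO) (hB : B.IsFO) (hd : Deriv {A} B)
    (he : ∀ (M : Type w) [L.Structure M] (s : ℕ → M), A.Tarski s ↔ B.Tarski s)
    (hf : B.fv ⊆ A.fv) : Reduces.{u, v, w} A B :=
  of_iff hd (fun M _ _ X => by
    rw [sat_iff_tarski A hA, sat_iff_tarski B hB]
    exact forall₂_congr fun s _ => he M s) hf

theorem neg_neg (hA : A.IsFO) : Reduces.{u, v, w} (neg (neg A)) A :=
  of_tarski_iff hA hA (.negE hA .hyp) (fun _ _ _ => not_not) subset_rfl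

theorem neg_and (hA : A.IsFO) (hB : B.IsFO) :
    Reduces.{u, v, w} (neg (and A B)) (or (neg A) (neg B)) := by
  have hor : (or (neg A) (neg B)).IsFO := ⟨hA, hB⟩
  refine of_tarski_iff ⟨hA, hB⟩ hor ?_ (fun _ _ _ => not_and_or) subset_rfl
  refine .by_contra hor (B := and A B) ⟨hA, hB⟩ (.andI ?_ ?_) (.assumption (by simp))
  · exact .by_contra hA hor (.orI₁ (IsFO.wf (A := neg B) hB) .head) (.assumption (by simp))
  · exact .by_contra hB hor (.orI₂ (IsFO.wf (A := neg A) hA) .head) (.assumption (by simp))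

theorem neg_or (hA : A.IsFO) (hB : B.IsFO) :
    Reduces.{u, v, w} (neg (or A B)) (and (neg A) (neg B)) := by
  refine of_tarski_iff ⟨hA, hB⟩ ⟨hA, hB⟩ (.andI ?_ ?_) (fun _ _ _ => not_or) subset_rfl
  · exact .negI hA (B := or A B) ⟨hA, hB⟩ (.andI (.orI₁ hB.wf .head) (.assumption (by simp)))
  · exact .negI hB (B := or A B) ⟨hA, hB⟩ (.andI (.orI₂ hA.wf .head) (.assumption (by simp)))

theorem neg_ex {x : ℕ} (hA : A.IsFO) : Reduces.{u, v, w} (neg (ex x A)) (all x (neg A)) := by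
  refine of_tarski_iff (A := neg (ex x A)) hA hA (.allI (Δ := {neg (ex x A)}) subset_rfl ?_
    (.negI hA (B := ex x A) hA (.andI (.ex_intro .head) (.assumption (by simp)))))
    (fun _ _ _ => not_exists) subset_rfl
  rintro _ rfl
  simp [fv]

theorem neg_all {x : ℕ} (hA : A.IsFO) : Reduces.{u, v, w} (neg (all x A)) (ex x (neg A)) := by
  refine of_tarski_iff (A := neg (all x A)) hA hA (.by_contra (A := ex x (neg A)) hA
    (B := all x A) hA (.allI (Δ := {neg (ex x (neg A))}) (by simp) ?_ ?_) (.assumption (by simp)))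
    (fun _ _ _ => not_forall) subset_rfl
  · rintro _ rfl
    simp [fv]
  · exact .by_contra hA (B := ex x (neg A)) hA (.ex_intro .head) (.assumption (by simp))

/-! ### Change of bound variables and naming of terms -/

theorem rename_ex {x y : ℕ} (hy : y ∉ A.vars) :
    Reduces.{u, v, w} (ex x A) (ex y (A.subst1 (Term.var y) x)) := by
  have hy' : y ∉ A.fv := fun h => hy (fv_subset_vars A h)
  have hf : A.FreeFor (Term.var y) x := freeFor_of_disjoint (by simpa [Term.varFinset] using hy)
  by_cases hxy : y = x
  · subst hxy
    rw [subst1_self]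
    exact refl _
  have hB : (ex y (A.subst1 (Term.var y) x)).fv ⊆ (ex x A).fv := by
    intro a ha
    obtain ⟨hay, ha⟩ := Finset.mem_erase.1 ha
    rcases mem_fv_subst1 ha with h | h
    · exact Finset.mem_erase.2 ⟨h.2, h.1⟩
    · exact absurd (by simpa [Term.varFinset] using h) hay
  refine of_iff (.exE (Δ := ∅) (Set.empty_subset _) (by simp)
    (fun h => Finset.notMem_erase x A.fv (hB h)) .hyp ?_) (fun M _ _ X => ?_) hB
  · refine .exI (t := Term.var x) (subst1_var_var hy).1 ?_
    rw [(subst1_var_var hy).2]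
    exact .head
  · refine exists_congr fun F => and_congr_right fun hF => ?_
    rw [sat_subst1 hf]
    have e : ∀ (s : ℕ → M) (b : M), ∀ a ∈ A.fv, Function.update s x b a =
        Function.update (Function.update s y b) x
          ((Term.var y : L.Term ℕ).realize (Function.update s y b)) a := by
      intro s b a ha
      have : a ≠ y := ne_of_mem_of_not_mem ha hy'
      by_cases h : a = x
      · subst h; simp
      · simp [h, this]
    constructor
    · refine sat_congr A _ _ ?_ ?_
      · rintro _ ⟨s, hs, b, hb, rfl⟩
        exact ⟨_, ⟨_, ⟨s, hs, b, hb, rfl⟩, rfl⟩, e s b⟩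
      · rintro _ ⟨_, ⟨s, hs, b, hb, rfl⟩, rfl⟩
        exact ⟨_, ⟨s, hs, b, hb, rfl⟩, e s b⟩
    · refine sat_congr A _ _ ?_ ?_
      · rintro _ ⟨_, ⟨s, hs, b, hb, rfl⟩, rfl⟩
        exact ⟨_, ⟨s, hs, b, hb, rfl⟩, fun a ha => (e s b a ha).symm⟩
      · rintro _ ⟨s, hs, b, hb, rfl⟩
        exact ⟨_, ⟨_, ⟨s, hs, b, hb, rfl⟩, rfl⟩, fun a ha => (e s b a ha).symm⟩

theorem rename_all {x y : ℕ} (hy : y ∉ A.vars) :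
    Reduces.{u, v, w} (all x A) (all y (A.subst1 (Term.var y) x)) := by
  have hy' : y ∉ A.fv := fun h => hy (fv_subset_vars A h)
  have hf : A.FreeFor (Term.var y) x := freeFor_of_disjoint (by simpa [Term.varFinset] using hy)
  refine of_iff (.allSubst (Δ := ∅) (Set.empty_subset _) (by simp)
    (fun h => hy' (Finset.mem_of_mem_erase h)) hf .hyp .head) (fun M _ _ X => ?_) ?_
  · change A.Sat (duplicate X x) ↔ (A.subst1 (Term.var y) x).Sat (duplicate X y)
    rw [sat_subst1 hf]
    have e : ∀ (s : ℕ → M) (b : M), ∀ a ∈ A.fv, Function.update s x b a =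
        Function.update (Function.update s y b) x
          ((Term.var y : L.Term ℕ).realize (Function.update s y b)) a := by
      intro s b a ha
      have : a ≠ y := ne_of_mem_of_not_mem ha hy'
      by_cases h : a = x
      · subst h; simp
      · simp [h, this]
    constructor
    · refine sat_congr A _ _ ?_ ?_
      · rintro _ ⟨s, hs, b, rfl⟩
        exact ⟨_, ⟨_, ⟨s, hs, b, rfl⟩, rfl⟩, e s b⟩
      · rintro _ ⟨_, ⟨s, hs, b, rfl⟩, rfl⟩
        exact ⟨_, ⟨s, hs, b, rfl⟩, e s b⟩
    · refine sat_congr A _ _ ?_ ?_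
      · rintro _ ⟨_, ⟨s, hs, b, rfl⟩, rfl⟩
        exact ⟨_, ⟨s, hs, b, rfl⟩, fun a ha => (e s b a ha).symm⟩
      · rintro _ ⟨s, hs, b, rfl⟩
        exact ⟨_, ⟨_, ⟨s, hs, b, rfl⟩, rfl⟩, fun a ha => (e s b a ha).symm⟩
  · intro a ha
    obtain ⟨hay, ha⟩ := Finset.mem_erase.1 ha
    rcases mem_fv_subst1 ha with h | h
    · exact Finset.mem_erase.2 ⟨h.2, h.1⟩
    · exact absurd (by simpa [Term.varFinset] using h) hay

/-- A term in a formula can be named by a new existentially quantified variable. -/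
theorem name_term {t : L.Term ℕ} {z : ℕ} (hz : z ∉ t.varFinset) (hf : A.FreeFor t z)
    (hA : (ex z (and (eq (Term.var z) t) A)).fv ⊆ (A.subst1 t z).fv) :
    Reduces.{u, v, w} (A.subst1 t z) (ex z (and (eq (Term.var z) t) A)) := by
  have ht : t.subst (Function.update Term.var z t) = t :=
    term_subst_var fun a ha => Function.update_of_ne (ne_of_mem_of_not_mem ha hz) _ _
  refine of_iff (.exI (t := t) ⟨trivial, hf⟩ (.andI ?_ .hyp)) (fun M _ _ X => ?_) hA
  · simp only [subst, Term.subst, Function.update_self, ht]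
    exact .eq_refl t
  · rw [sat_subst1 hf]
    constructor
    · intro h
      refine ⟨fun s => {t.realize s}, fun s _ => Set.singleton_nonempty _, ?_⟩
      have : supplement X (fun s => {t.realize s}) z =
          (fun s => Function.update s z (t.realize s)) '' X := by
        ext r
        simp [supplement, eq_comm]
      rw [this]
      refine ⟨?_, h⟩
      rintro _ ⟨s, -, rfl⟩
      simp [realize_update_of_notMem hz]
    · rintro ⟨F, hF, he, h⟩
      convert h using 1
      have key : ∀ s ∈ X, ∀ b ∈ F s, b = t.realize s := by
        intro s hs b hb
        simpa [realize_update_of_notMem hz] using he _ ⟨s, hs, b, hb, rfl⟩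
      ext r
      constructor
      · rintro ⟨s, hs, rfl⟩
        obtain ⟨b, hb⟩ := hF s hs
        exact ⟨s, hs, b, hb, by rw [key s hs b hb]⟩
      · rintro ⟨s, hs, b, hb, rfl⟩
        exact ⟨s, hs, by simp only [key s hs b hb]⟩

end Reduces

namespace Reduces

variable {A A' B B' C : Formula L}

/-! ### Universal quantifiers out of disjunctions -/

/-- Extending the scope of a universal quantifier over a disjunction.  For the way back, a team
that splits as required has a product structure on the part that satisfies `A`, by the
independence atom; either `x` takes all values there, or that part can be dropped. -/
theorem all_or {x : ℕ} (hx : x ∉ B.fv) : ∃ y : List ℕ,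
    (∀ a ∈ y, a ∈ (or A B).fv ∧ a ≠ x) ∧
    Reduces.{u, v, w} (or (all x A) B) (all x (or (and A (indepVar [x] [] y)) B)) := by
  obtain ⟨y, hyn, hy⟩ : ∃ y : List ℕ, y.Nodup ∧ ∀ a, a ∈ y ↔ a ∈ (or A B).fv ∧ a ≠ x :=
    ⟨((or A B).fv.erase x).toList, Finset.nodup_toList _, fun a => by
      rw [Finset.mem_toList, Finset.mem_erase, _root_.and_comm]⟩
  refine ⟨y, fun a => (hy a).1, of_iff (.allScope hx hyn hy .hyp) (fun M _ _ X => ?_) ?_⟩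
  · have hxB : ∀ (s : ℕ → M) (b : M), ∀ a ∈ B.fv, Function.update s x b a = s a := fun s b a ha =>
      Function.update_of_ne (ne_of_mem_of_not_mem ha hx) _ _
    constructor
    · rintro ⟨Y, Z, rfl, hA, hB⟩
      refine ⟨duplicate Y x, duplicate Z x, ?_, ⟨hA, ?_⟩, (sat_duplicate_iff hx).2 hB⟩
      · ext t
        constructor
        · rintro (⟨s, hs, b, rfl⟩ | ⟨s, hs, b, rfl⟩)
          · exact ⟨s, Or.inl hs, b, rfl⟩
          · exact ⟨s, Or.inr hs, b, rfl⟩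
        · rintro ⟨s, hs | hs, b, rfl⟩
          · exact Or.inl ⟨s, hs, b, rfl⟩
          · exact Or.inr ⟨s, hs, b, rfl⟩
      · rw [sat_indepVar_iff]
        rintro _ ⟨s, hs, b, rfl⟩ _ ⟨s', hs', b', rfl⟩ -
        refine ⟨_, ⟨s', hs', b, rfl⟩, by simp, by simp, fun a ha => ?_⟩
        have := ((hy a).1 ha).2
        simp [this]
    · rintro ⟨Y, Z, e, ⟨hA, hI⟩, hB⟩
      have hYX : ∀ t ∈ Y, ∃ s ∈ X, ∃ b, t = Function.update s x b := fun t ht =>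
        (e ▸ Or.inl ht : t ∈ duplicate X x)
      have hZX : ∀ t ∈ Z, ∃ s ∈ X, ∃ b, t = Function.update s x b := fun t ht =>
        (e ▸ Or.inr ht : t ∈ duplicate X x)
      have hX : ∀ s ∈ X, ∀ b, Function.update s x b ∈ Y ∪ Z := fun s hs b => by
        rw [e]
        exact ⟨s, hs, b, rfl⟩
      by_cases hc : ∃ c, ∀ t ∈ Y, t x ≠ c
      · -- the value `c` of `x` occurs in `Z` only, so `Z` already covers `X`
        obtain ⟨c, hc⟩ := hc
        refine ⟨∅, X, Set.empty_union X, sat_empty _, sat_congr B Z X ?_ ?_ hB⟩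
        · intro t ht
          obtain ⟨s, hs, b, rfl⟩ := hZX t ht
          exact ⟨s, hs, hxB s b⟩
        · intro s hs
          refine ⟨_, (hX s hs c).resolve_left fun h => hc _ h (by simp), hxB s c⟩
      · -- every value of `x` occurs in `Y`, so by the atom `Y` is closed under changes of `x`
        push Not at hc
        refine ⟨{s ∈ X | ∃ b, Function.update s x b ∈ Y}, {s ∈ X | ∃ b, Function.update s x b ∈ Z},
          ?_, sat_congr A Y _ ?_ ?_ hA, sat_congr B Z _ ?_ ?_ hB⟩
        · ext s
          constructor
          · rintro (h | h) <;> exact h.1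
          · intro hs
            inhabit M
            exact (hX s hs default).imp (fun h => ⟨hs, _, h⟩) fun h => ⟨hs, _, h⟩
        · intro t ht
          obtain ⟨s, hs, b, rfl⟩ := hYX t ht
          exact ⟨_, ⟨s, ⟨hs, b, ht⟩, b, rfl⟩, fun _ _ => rfl⟩
        · rintro _ ⟨s, ⟨hs, b, hb⟩, c, rfl⟩
          obtain ⟨t, ht, rfl⟩ := hc c
          obtain ⟨r, hr, h₁, -, h₂⟩ := sat_indepVar_iff.1 hI t ht _ hb (by simp)
          refine ⟨r, hr, fun a ha => ?_⟩
          by_cases hax : a = x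
          · subst hax
            simpa using h₁
          · rw [h₂ a ((hy a).2 ⟨Finset.mem_union_left _ ha, hax⟩)]
            simp [hax]
        · intro t ht
          obtain ⟨s, hs, b, rfl⟩ := hZX t ht
          exact ⟨s, ⟨hs, b, ht⟩, hxB s b⟩
        · rintro s ⟨hs, b, hb⟩
          exact ⟨_, hb, hxB s b⟩
  · intro a ha
    obtain ⟨hax, ha⟩ := Finset.mem_erase.1 ha
    simp only [fv, Finset.mem_union, mem_fv_indepVar, Finset.mem_erase] at ha ⊢
    rcases ha with (ha | ha | ha | ha) | ha
    · exact Or.inl ⟨hax, ha⟩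
    · exact absurd (by simpa using ha) hax
    · simp at ha
    · exact (Finset.mem_union.1 ((hy a).1 ha).1).imp (fun h => ⟨hax, h⟩) id
    · exact Or.inr ha

/-! ### Universal quantifiers out of existential ones -/

/-- Exchange of an existential quantifier with a universal one.  The atom makes the choice of `x`
independent of `y`. -/
theorem ex_all {x y : ℕ} (hxy : x ≠ y) : ∃ z : List ℕ,
    (∀ a ∈ z, a ∈ A.fv) ∧
    Reduces.{u, v, w} (ex x (all y A)) (all y (ex x (and A (indepVar [x] z [y])))) := by
  obtain ⟨z, hzn, hz⟩ : ∃ z : List ℕ, z.Nodup ∧ ∀ a, a ∈ z ↔ a ∈ A.fv ∧ a ≠ x ∧ a ≠ y :=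
    ⟨((A.fv.erase x).erase y).toList, Finset.nodup_toList _, fun a => by
      simp only [Finset.mem_toList, Finset.mem_erase]
      tauto⟩
  refine ⟨z, fun a ha => ((hz a).1 ha).1,
    of_iff (.indepIntro hxy hzn hz .hyp) (fun M _ _ X => ?_) ?_⟩
  · constructor
    · rintro ⟨F, hF, hA⟩
      have hout : ∀ (s : ℕ → M) (b c : M), Function.update (Function.update s x b) y c =
          Function.update (Function.update s y c) x b := fun s b c => Function.update_comm hxy _ _ _
      refine sat_ex_iff.2 ⟨duplicate (supplement X F x) y, ⟨?_, ?_⟩, hA, ?_⟩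
      · rintro _ ⟨_, ⟨s, hs, b, hb, rfl⟩, c, rfl⟩
        refine ⟨_, ⟨s, hs, c, rfl⟩, fun a ha => ?_⟩
        rw [hout]
        exact (Function.update_of_ne (by simpa using ha) _ _).symm
      · rintro _ ⟨s, hs, c, rfl⟩
        obtain ⟨b, hb⟩ := hF s hs
        refine ⟨_, ⟨_, ⟨s, hs, b, hb, rfl⟩, c, rfl⟩, fun a ha => ?_⟩
        rw [hout]
        exact (Function.update_of_ne (by simpa using ha) _ _).symm
      · rw [sat_indepVar_iff]
        rintro _ ⟨s, hs, b, rfl⟩ _ ⟨s', hs', b', rfl⟩ h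
        refine ⟨_, ⟨s, hs, b', rfl⟩, by simp [hxy], fun a ha => ?_, by simp⟩
        have := ((hz a).1 ha).2.2
        simp [this]
    · intro h
      obtain ⟨T, ⟨h₁, h₂⟩, hA, hI⟩ := sat_ex_iff.1 h
      rw [sat_indepVar_iff] at hI
      inhabit M
      have hzs : ∀ (s : ℕ → M) (c : M), ∀ a ∈ z, Function.update s y c a = s a := fun s c a ha =>
        Function.update_of_ne ((hz a).1 ha).2.2 _ _
      have hzx : ∀ a ∈ z, a ∉ [x] := fun a ha => by simpa using ((hz a).1 ha).2.1
      -- `x` may take all the values that it has in `T` together with the given values of `z`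
      refine ⟨fun s => {b | ∃ t ∈ T, (∀ a ∈ z, t a = s a) ∧ t x = b}, fun s hs => ?_,
        sat_congr A T _ ?_ ?_ hA⟩
      · obtain ⟨t, ht, e⟩ := h₂ _ ⟨s, hs, default, rfl⟩
        exact ⟨t x, t, ht, fun a ha => by rw [← e a (hzx a ha), hzs s _ a ha], rfl⟩
      · intro t ht
        obtain ⟨_, ⟨s, hs, c, rfl⟩, e⟩ := h₁ t ht
        refine ⟨_, ⟨_, ⟨s, hs, t x, ⟨t, ht, fun a ha => ?_, rfl⟩, rfl⟩, c, rfl⟩, fun a _ => ?_⟩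
        · rw [← e a (hzx a ha), hzs s _ a ha]
        · by_cases hax : a = x
          · subst hax
            simp [hxy]
          · rw [← e a (by simpa using hax)]
            by_cases hay : a = y
            · subst hay; simp
            · simp [hax, hay]
      · rintro _ ⟨_, ⟨s, hs, b, ⟨t, ht, hts, rfl⟩, rfl⟩, c, rfl⟩
        obtain ⟨t', ht', e⟩ := h₂ _ ⟨s, hs, c, rfl⟩
        obtain ⟨r, hr, r₁, r₂, r₃⟩ := hI t ht t' ht' fun a ha => by
          rw [hts a ha, ← e a (hzx a ha), hzs s _ a ha]
        refine ⟨r, hr, fun a ha => ?_⟩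
        by_cases hay : a = y
        · subst hay
          rw [r₃ a (by simp), ← e a (by simpa using hxy.symm)]
          simp
        · by_cases hax : a = x
          · subst hax
            rw [r₁ a (by simp)]
            simp [hay]
          · have haz := (hz a).2 ⟨ha, hax, hay⟩
            rw [r₂ a haz, hts a haz]
            simp [hax, hay]
  · intro a ha
    simp only [fv, Finset.mem_erase, Finset.mem_union, mem_fv_indepVar] at ha ⊢
    refine ⟨ha.2.1, ha.1, ?_⟩
    rcases ha.2.2 with h | h | h | h
    · exact h
    · exact absurd (by simpa using h) ha.2.1
    · exact ((hz a).1 h).1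
    · exact absurd (by simpa using h) ha.1

end Reduces

/-! ### Disjunctions of existential formulas -/

section Distribution

variable {M : Type w} [L.Structure M]

theorem sat_exIndep_iff {x : List ℕ} {atoms : List IAtom} {C : Formula L} {X : Set (ℕ → M)} :
    (exIndep x atoms C).Sat X ↔
      ∃ T, Ext x X T ∧ (∀ a ∈ atoms, (a.toFormula : Formula L).Sat T) ∧ C.Sat T := by
  simp only [exIndep, sat_exL_iff, sat_conj_iff, List.forall_mem_map]

theorem fv_toFormula_subset {a : IAtom} {x : List ℕ} (h : a.Within x) {b : ℕ}
    (hb : b ∈ (a.toFormula : Formula L).fv) : b ∈ x := by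
  rcases mem_fv_indepVar.1 hb with hb | hb | hb
  · exact h.1 hb
  · exact h.2.1 hb
  · exact h.2.2 hb

theorem sat_constAtom_iff {z : ℕ} {X : Set (ℕ → M)} :
    (constAtom (L := L) z).Sat X ↔ ∀ s ∈ X, ∀ s' ∈ X, s z = s' z := by
  simp only [constAtom, sat_indepVar_iff, List.mem_singleton, forall_eq, List.not_mem_nil,
    false_imp_iff, implies_true, true_imp_iff, true_and]
  constructor
  · intro h s hs s' hs'
    obtain ⟨r, -, h₁, h₂⟩ := h s hs s' hs'
    rw [← h₁, h₂]
  · intro h s hs s' hs'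
    exact ⟨s, hs, rfl, h s hs s' hs'⟩

/-- An atom conditioned additionally on `r` holds in a union of two teams if it holds in the first,
its variables are constant in the second, and `r` tells the two apart. -/
theorem sat_withCond_union {a : IAtom} {x : List ℕ} (ha : a.Within x) {r : ℕ}
    {W W' : Set (ℕ → M)} (h : (a.toFormula : Formula L).Sat W) (hr : ∀ s ∈ W, ∀ s' ∈ W, s r = s' r)
    (hconst : ∀ s ∈ W', ∀ s' ∈ W', ∀ b ∈ x, s b = s' b)
    (hsep : ∀ s ∈ W, ∀ s' ∈ W', s r = s' r → ∀ b c : M, b = c) :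
    (a.withCond r : Formula L).Sat (W ∪ W') := by
  rw [IAtom.toFormula, sat_indepVar_iff] at h
  rw [IAtom.withCond, sat_indepVar_iff]
  have triv : (∀ b c : M, b = c) → ∀ s ∈ W ∪ W', ∀ s' : ℕ → M, ∃ s'' ∈ W ∪ W',
      (∀ b ∈ a.u, s'' b = s b) ∧ (∀ b ∈ a.w ++ [r], s'' b = s b) ∧ ∀ b ∈ a.v, s'' b = s' b :=
    fun h s hs s' => ⟨s, hs, fun _ _ => rfl, fun _ _ => rfl, fun _ _ => h _ _⟩
  intro s hs s' hs' e
  simp only [List.forall_mem_append, List.forall_mem_singleton] at e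
  rcases hs with hs | hs <;> rcases hs' with hs' | hs'
  · obtain ⟨t, ht, h₁, h₂, h₃⟩ := h s hs s' hs' e.1
    refine ⟨t, Or.inl ht, h₁, ?_, h₃⟩
    simp only [List.forall_mem_append, List.forall_mem_singleton]
    exact ⟨h₂, hr t ht s hs⟩
  · exact triv (hsep s hs s' hs' e.2) s (Or.inl hs) s'
  · exact triv (hsep s' hs' s hs e.2.symm) s (Or.inr hs) s'
  · exact ⟨s, Or.inr hs, fun _ _ => rfl, fun _ _ => rfl,
      fun b hb => hconst s hs s' hs' b (ha.2.2 hb)⟩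

/-- Restricting an atom conditioned on `r` to the part of the team in which `r` has the value of the
constant `z`.  The other part of the team, where `r` has the value of the constant `z'`, can only
interfere if `z` and `z'` are equal, which they are in one-element structures only. -/
theorem sat_toFormula_of_withCond {a : IAtom} {r z z' : ℕ} {T T' : Set (ℕ → M)}
    (h : (a.withCond r : Formula L).Sat (T ∪ T'))
    (hz : ∀ s ∈ T ∪ T', ∀ s' ∈ T ∪ T', s z = s' z) (hr : ∀ t ∈ T, t r = t z)
    (hr' : ∀ t ∈ T', t r = t z') (hsep : ∀ t ∈ T ∪ T', t z = t z' → ∀ b c : M, b = c) :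
    (a.toFormula : Formula L).Sat T := by
  rw [IAtom.withCond, sat_indepVar_iff] at h
  rw [IAtom.toFormula, sat_indepVar_iff]
  intro s hs s' hs' e
  have hrr : ∀ t ∈ T ∪ T', s r = t z := fun t ht => by rw [hr s hs, hz s (Or.inl hs) t ht]
  obtain ⟨t, ht, h₁, h₂, h₃⟩ := h s (Or.inl hs) s' (Or.inl hs') (by
    simp only [List.forall_mem_append, List.forall_mem_singleton]
    exact ⟨e, by rw [hrr s' (Or.inl hs'), hr s' hs']⟩)
  simp only [List.forall_mem_append, List.forall_mem_singleton] at h₂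
  rcases ht with hT | hT
  · exact ⟨t, hT, h₁, h₂.1, h₃⟩
  · have htriv := hsep t (Or.inr hT) (by rw [← hrr t (Or.inr hT), ← h₂.2, hr' t hT])
    exact ⟨s, hs, fun _ _ => rfl, fun _ _ => rfl, fun _ _ => htriv _ _⟩

variable {x₀ x₁ : List ℕ} {atoms₀ atoms₁ : List IAtom}
  {C D : Formula L} {α β z₀ z₁ r : ℕ} {X : Set (ℕ → M)}

theorem sat_distribConclusion_iff :
    (distribConclusion x₀ x₁ atoms₀ atoms₁ C D α β z₀ z₁ r).Sat X ↔
      ∃ T, Ext (x₀ ++ (x₁ ++ [z₀, z₁, r]))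
          {t | ∃ s ∈ X, ∃ p q, t = Function.update (Function.update s α p) β q} T ∧
        (∀ a ∈ atoms₀, (a.withCond r : Formula L).Sat T) ∧
        (∀ a ∈ atoms₁, (a.withCond r : Formula L).Sat T) ∧
        (∀ s ∈ T, ∀ s' ∈ T, s z₀ = s' z₀) ∧ (∀ s ∈ T, ∀ s' ∈ T, s z₁ = s' z₁) ∧
        (∀ t ∈ T, t z₀ = t z₁ → t α = t β) ∧
        ∃ T₀ T₁, T₀ ∪ T₁ = T ∧ (C.Sat T₀ ∧ ∀ t ∈ T₀, t r = t z₀) ∧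
          (D.Sat T₁ ∧ ∀ t ∈ T₁, t r = t z₁) := by
  have hor : ∀ T : Set (ℕ → M), (or (neg (eq (Term.var z₀) (Term.var z₁)) : Formula L)
      (eq (Term.var α) (Term.var β))).Sat T ↔ ∀ t ∈ T, t z₀ = t z₁ → t α = t β := by
    intro T
    refine (sat_iff_tarski _ ?_ T).trans ?_
    · exact ⟨trivial, trivial⟩
    simp only [Tarski, Term.realize_var, imp_iff_not_or]
  have hsplit : ∀ T : Set (ℕ → M), (or (and C (eq (Term.var r) (Term.var z₀)))
      (and D (eq (Term.var r) (Term.var z₁)))).Sat T ↔ ∃ T₀ T₁, T₀ ∪ T₁ = T ∧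
        (C.Sat T₀ ∧ ∀ t ∈ T₀, t r = t z₀) ∧ (D.Sat T₁ ∧ ∀ t ∈ T₁, t r = t z₁) :=
    fun _ => Iff.rfl
  simp only [distribConclusion, ← exL_append, sat_all_all_iff, sat_exL_iff, sat_conj_iff,
    List.forall_mem_append, List.forall_mem_map, List.forall_mem_cons, List.not_mem_nil,
    false_imp_iff, implies_true, and_true, hor, hsplit, sat_constAtom_iff, and_assoc]

/-- One half of the way back from `distribConclusion`: the part of the team in which `r` has the
value of `z₀` witnesses the formula `∃ x₀ (… ∧ C)` on the part of the original team below it. -/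
theorem sat_exIndep_of_part {V : List ℕ} {T T' : Set (ℕ → M)}
    (hV : ∀ a ∈ V, a ∉ (exIndep x₀ atoms₀ C).fv)
    (hat : ∀ a ∈ atoms₀, (a.withCond r : Formula L).Sat (T ∪ T'))
    (hz : ∀ s ∈ T ∪ T', ∀ s' ∈ T ∪ T', s z₀ = s' z₀) (hr : ∀ t ∈ T, t r = t z₀)
    (hr' : ∀ t ∈ T', t r = t z₁) (hsep : ∀ t ∈ T ∪ T', t z₀ = t z₁ → ∀ b c : M, b = c)
    (hC : C.Sat T) (hT : ∀ t ∈ T, ∃ s ∈ X, ∀ a, a ∉ V → s a = t a) :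
    (exIndep x₀ atoms₀ C).Sat {s ∈ X | ∃ t ∈ T, ∀ a, a ∉ V → s a = t a} := by
  have h : (exIndep x₀ atoms₀ C).Sat T := sat_exIndep_iff.2
    ⟨T, ⟨fun t ht => ⟨t, ht, fun _ _ => rfl⟩, fun t ht => ⟨t, ht, fun _ _ => rfl⟩⟩,
      fun a ha => sat_toFormula_of_withCond (hat a ha) hz hr hr' hsep, hC⟩
  refine sat_congr _ T _ (fun t ht => ?_) ?_ h
  · obtain ⟨s, hs, e⟩ := hT t ht
    exact ⟨s, ⟨hs, t, ht, e⟩, fun a ha => (e a fun h => hV a h ha).symm⟩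
  · rintro s ⟨-, t, ht, e⟩
    exact ⟨t, ht, fun a ha => (e a fun h => hV a h ha).symm⟩

end Distribution

/-- Independence distribution.  The two disjuncts are merged into one existential block, in which
`r` says which disjunct an assignment comes from; `r` takes the values of the constants `z₀` and
`z₁`, which are different unless the structure has only one element. -/
theorem Reduces.distrib {x₀ x₁ : List ℕ} {atoms₀ atoms₁ : List IAtom}
    {C D : Formula L} {α β z₀ z₁ r : ℕ} (hC : C.IsFO) (hD : D.IsFO)
    (h₀ : ∀ a ∈ x₀, a ∉ (exIndep x₁ atoms₁ D).vars)
    (h₁ : ∀ a ∈ x₁, a ∉ (exIndep x₀ atoms₀ C).vars)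
    (hat₀ : ∀ a ∈ atoms₀, a.Within x₀) (hat₁ : ∀ a ∈ atoms₁, a.Within x₁)
    (hnd : [α, β, z₀, z₁, r].Nodup)
    (hnew : ∀ a ∈ [α, β, z₀, z₁, r],
      a ∉ (or (exIndep x₀ atoms₀ C) (exIndep x₁ atoms₁ D)).vars) :
    Reduces.{u, v, w} (or (exIndep x₀ atoms₀ C) (exIndep x₁ atoms₁ D))
      (distribConclusion x₀ x₁ atoms₀ atoms₁ C D α β z₀ z₁ r) := by
  have hx : ∀ (x : List ℕ) (atoms : List IAtom) (E : Formula L), ∀ a ∈ x,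
      a ∈ (exIndep x atoms E).vars := fun x atoms E a ha => mem_vars_exL.2 (Or.inr ha)
  have hE : ∀ (x : List ℕ) (atoms : List IAtom) (E : Formula L), ∀ a ∈ E.fv, a ∉ x →
      a ∈ (exIndep x atoms E).fv := fun x atoms E a ha hax =>
    mem_fv_exL.2 ⟨mem_fv_conj.2 (Or.inr ha), hax⟩
  have hE' : ∀ (x : List ℕ) (atoms : List IAtom) (E : Formula L), ∀ a ∈ E.fv,
      a ∈ (exIndep x atoms E).vars := fun x atoms E a ha => by
    by_cases hax : a ∈ x
    · exact hx x atoms E a hax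
    · exact fv_subset_vars _ (hE x atoms E a ha hax)
  have hK₀ : ∀ a ∈ [α, β, z₀, z₁, r], a ∉ (exIndep x₀ atoms₀ C).vars := fun a ha h =>
    hnew a ha (Finset.mem_union_left _ h)
  have hK₁ : ∀ a ∈ [α, β, z₀, z₁, r], a ∉ (exIndep x₁ atoms₁ D).vars := fun a ha h =>
    hnew a ha (Finset.mem_union_right _ h)
  have hdisj : ∀ a ∈ x₀, a ∉ x₁ := fun a ha h => h₀ a ha (hx _ _ _ a h)
  have hKx₀ : ∀ a ∈ x₀, a ∉ [α, β, z₀, z₁, r] := fun a ha h => hK₀ a h (hx _ _ _ a ha)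
  have hKx₁ : ∀ a ∈ x₁, a ∉ [α, β, z₀, z₁, r] := fun a ha h => hK₁ a h (hx _ _ _ a ha)
  have hnd' := hnd
  simp only [List.nodup_cons, List.mem_cons, List.not_mem_nil, or_false, not_or, not_false_eq_true,
    List.nodup_nil, and_true] at hnd'
  obtain ⟨⟨n₁, n₂, n₃, n₄⟩, ⟨n₅, n₆, n₇⟩, ⟨n₈, n₉⟩, n₁₀⟩ := hnd'
  refine of_iff (.indepDistrib hC hD h₀ h₁ hat₀ hat₁ hnd hnew .hyp) (fun M _ _ X => ?_) ?_
  · rw [sat_distribConclusion_iff]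
    constructor
    · rintro ⟨Y, Z, rfl, hY, hZ⟩
      obtain ⟨T₀, ⟨hYT, hYT'⟩, hT₀, hTC⟩ := sat_exIndep_iff.1 hY
      obtain ⟨T₁, ⟨hZT, hZT'⟩, hT₁, hTD⟩ := sat_exIndep_iff.1 hZ
      obtain ⟨c₀, c₁, hc⟩ : ∃ c₀ c₁ : M, c₀ = c₁ → ∀ b c : M, b = c := by
        by_cases h : ∃ b c : M, b ≠ c
        · obtain ⟨b, c, h⟩ := h
          exact ⟨b, c, fun e => absurd e h⟩
        · push Not at h
          inhabit M
          exact ⟨default, default, fun _ => h⟩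
      obtain ⟨d⟩ := ‹Nonempty M›
      -- `g y c t p q` is `t` with the values `p`, `q`, `c₀`, `c₁`, `c` at the new variables and
      -- with the tuple `y` of the other disjunct made constant
      obtain ⟨g, hg⟩ : ∃ g : List ℕ → M → (ℕ → M) → M → M → ℕ → M, ∀ y c t p q, g y c t p q =
          fun a => if a = α then p else if a = β then q else if a = z₀ then c₀ else
            if a = z₁ then c₁ else if a = r then c else if a ∈ y then d else t a :=
        ⟨_, fun _ _ _ _ _ => rfl⟩
      have gα : ∀ y c t p q, g y c t p q α = p := fun y c t p q => by simp [hg]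
      have gβ : ∀ y c t p q, g y c t p q β = q := fun y c t p q => by simp [hg, Ne.symm n₁]
      have gz₀ : ∀ y c t p q, g y c t p q z₀ = c₀ := fun y c t p q => by
        simp [hg, Ne.symm n₂, Ne.symm n₅]
      have gz₁ : ∀ y c t p q, g y c t p q z₁ = c₁ := fun y c t p q => by
        simp [hg, Ne.symm n₃, Ne.symm n₆, Ne.symm n₈]
      have gr : ∀ y c t p q, g y c t p q r = c := fun y c t p q => by
        simp [hg, Ne.symm n₄, Ne.symm n₇, Ne.symm n₉, Ne.symm n₁₀]
      have gy : ∀ y c t p q, ∀ a ∈ y, a ∉ [α, β, z₀, z₁, r] → g y c t p q a = d := by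
        intro y c t p q a ha hK
        simp only [List.mem_cons, List.not_mem_nil, or_false, not_or] at hK
        simp [hg, hK, ha]
      have gt : ∀ y c t p q, ∀ a, a ∉ y → a ∉ [α, β, z₀, z₁, r] → g y c t p q a = t a := by
        intro y c t p q a ha hK
        simp only [List.mem_cons, List.not_mem_nil, or_false, not_or] at hK
        simp [hg, hK, ha]
      set W : List ℕ → M → Set (ℕ → M) → Set (ℕ → M) :=
        fun y c T => {t' | ∃ t ∈ T, ∃ p q, t' = g y c t p q} with hW
      have hsat : ∀ (F : Formula L) (y : List ℕ) (c : M) (T : Set (ℕ → M)),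
          (∀ a ∈ F.fv, a ∉ y ∧ a ∉ [α, β, z₀, z₁, r]) → F.Sat T → F.Sat (W y c T) := by
        intro F y c T hF
        refine sat_congr F _ _ (fun t ht => ⟨_, ⟨t, ht, d, d, rfl⟩, fun a ha => ?_⟩) ?_
        · exact (gt y c t d d a (hF a ha).1 (hF a ha).2).symm
        · rintro _ ⟨t, ht, p, q, rfl⟩
          exact ⟨t, ht, fun a ha => (gt y c t p q a (hF a ha).1 (hF a ha).2).symm⟩
      have hagree : ∀ (x y : List ℕ) (c : M) (s t : ℕ → M) (p q : M),
          (∀ a, a ∉ x → s a = t a) → ∀ a, a ∉ x → a ∉ y → a ∉ [z₀, z₁, r] →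
            Function.update (Function.update s α p) β q a = g y c t p q a := by
        intro x y c s t p q e a hax hay haz
        by_cases haβ : a = β
        · subst haβ
          rw [gβ]
          simp
        by_cases haα : a = α
        · subst haα
          rw [gα]
          simp [haβ]
        rw [Function.update_of_ne haβ, Function.update_of_ne haα, e a hax, gt y c t p q a hay]
        simp only [List.mem_cons, haα, haβ, false_or] at haz ⊢
        exact haz
      have hmem : ∀ a, a ∉ x₀ ++ (x₁ ++ [z₀, z₁, r]) → a ∉ x₀ ∧ a ∉ x₁ ∧ a ∉ [z₀, z₁, r] :=
        fun a ha => by simpa only [List.mem_append, not_or] using ha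
      refine ⟨W x₁ c₀ T₀ ∪ W x₀ c₁ T₁, ⟨?_, ?_⟩, fun a ha => ?_, fun a ha => ?_, ?_, ?_, ?_,
        W x₁ c₀ T₀, W x₀ c₁ T₁, rfl, ⟨?_, ?_⟩, ?_, ?_⟩
      · rintro _ (⟨t, ht, p, q, rfl⟩ | ⟨t, ht, p, q, rfl⟩)
        · obtain ⟨s, hs, e⟩ := hYT t ht
          refine ⟨_, ⟨s, Or.inl hs, p, q, rfl⟩, fun a ha => ?_⟩
          obtain ⟨i, j, k⟩ := hmem a ha
          exact hagree x₀ x₁ c₀ s t p q e a i j k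
        · obtain ⟨s, hs, e⟩ := hZT t ht
          refine ⟨_, ⟨s, Or.inr hs, p, q, rfl⟩, fun a ha => ?_⟩
          obtain ⟨i, j, k⟩ := hmem a ha
          exact hagree x₁ x₀ c₁ s t p q e a j i k
      · rintro _ ⟨s, hs | hs, p, q, rfl⟩
        · obtain ⟨t, ht, e⟩ := hYT' s hs
          refine ⟨_, Or.inl ⟨t, ht, p, q, rfl⟩, fun a ha => ?_⟩
          obtain ⟨i, j, k⟩ := hmem a ha
          exact hagree x₀ x₁ c₀ s t p q e a i j k
        · obtain ⟨t, ht, e⟩ := hZT' s hs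
          refine ⟨_, Or.inr ⟨t, ht, p, q, rfl⟩, fun a ha => ?_⟩
          obtain ⟨i, j, k⟩ := hmem a ha
          exact hagree x₁ x₀ c₁ s t p q e a j i k
      · refine sat_withCond_union (hat₀ a ha) (hsat _ _ _ _ (fun b hb => ?_) (hT₀ a ha)) ?_ ?_ ?_
        · have hb := fv_toFormula_subset (hat₀ a ha) hb
          exact ⟨hdisj b hb, hKx₀ b hb⟩
        · rintro _ ⟨t, -, p, q, rfl⟩ _ ⟨t', -, p', q', rfl⟩
          rw [gr, gr]
        · rintro _ ⟨t, -, p, q, rfl⟩ _ ⟨t', -, p', q', rfl⟩ b hb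
          rw [gy _ _ _ _ _ b hb (hKx₀ b hb), gy _ _ _ _ _ b hb (hKx₀ b hb)]
        · rintro _ ⟨t, -, p, q, rfl⟩ _ ⟨t', -, p', q', rfl⟩ e
          rw [gr, gr] at e
          exact hc e
      · rw [Set.union_comm]
        refine sat_withCond_union (hat₁ a ha) (hsat _ _ _ _ (fun b hb => ?_) (hT₁ a ha)) ?_ ?_ ?_
        · have hb := fv_toFormula_subset (hat₁ a ha) hb
          exact ⟨fun h => hdisj b h hb, hKx₁ b hb⟩
        · rintro _ ⟨t, -, p, q, rfl⟩ _ ⟨t', -, p', q', rfl⟩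
          rw [gr, gr]
        · rintro _ ⟨t, -, p, q, rfl⟩ _ ⟨t', -, p', q', rfl⟩ b hb
          rw [gy _ _ _ _ _ b hb (hKx₁ b hb), gy _ _ _ _ _ b hb (hKx₁ b hb)]
        · rintro _ ⟨t, -, p, q, rfl⟩ _ ⟨t', -, p', q', rfl⟩ e
          rw [gr, gr] at e
          exact hc e.symm
      · rintro _ (⟨t, -, p, q, rfl⟩ | ⟨t, -, p, q, rfl⟩) _
          (⟨t', -, p', q', rfl⟩ | ⟨t', -, p', q', rfl⟩) <;> rw [gz₀, gz₀]
      · rintro _ (⟨t, -, p, q, rfl⟩ | ⟨t, -, p, q, rfl⟩) _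
          (⟨t', -, p', q', rfl⟩ | ⟨t', -, p', q', rfl⟩) <;> rw [gz₁, gz₁]
      · rintro _ (⟨t, -, p, q, rfl⟩ | ⟨t, -, p, q, rfl⟩) e <;> rw [gz₀, gz₁] at e <;> exact hc e _ _
      · exact hsat C _ _ _ (fun a ha => ⟨fun h => h₁ a h (hE' _ _ _ a ha),
          fun h => hK₀ a h (hE' _ _ _ a ha)⟩) hTC
      · rintro _ ⟨t, -, p, q, rfl⟩
        rw [gr, gz₀]
      · exact hsat D _ _ _ (fun a ha => ⟨fun h => h₀ a h (hE' _ _ _ a ha),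
          fun h => hK₁ a h (hE' _ _ _ a ha)⟩) hTD
      · rintro _ ⟨t, -, p, q, rfl⟩
        rw [gr, gz₁]
    · rintro ⟨_, ⟨hX, hX'⟩, ha₀, ha₁, hz₀, hz₁, hαβ, T₀, T₁, rfl, ⟨hTC, hr₀⟩, hTD, hr₁⟩
      set V := α :: β :: (x₀ ++ (x₁ ++ [z₀, z₁, r])) with hV
      have hVmem : ∀ a, a ∉ V → a ≠ α ∧ a ≠ β ∧ a ∉ x₀ ++ (x₁ ++ [z₀, z₁, r]) := fun a ha => by
        simpa only [hV, List.mem_cons, not_or] using ha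
      have hVK : ∀ a ∈ V, a ∈ [α, β, z₀, z₁, r] ∨ a ∈ x₀ ∨ a ∈ x₁ := by
        intro a ha
        simp only [hV, List.mem_cons, List.mem_append] at ha ⊢
        tauto
      -- if the constants `z₀` and `z₁` are equal, then `α = β` for all values of `α` and `β`
      have hsep : ∀ t ∈ T₀ ∪ T₁, t z₀ = t z₁ → ∀ b c : M, b = c := by
        intro t ht e b c
        obtain ⟨_, ⟨s, hs, -⟩, -⟩ := hX t ht
        obtain ⟨t', ht', e'⟩ := hX' _ ⟨s, hs, b, c, rfl⟩
        have hnot : ∀ a ∈ [α, β], a ∉ x₀ ++ (x₁ ++ [z₀, z₁, r]) := by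
          intro a ha h
          have haK : a ∈ [α, β, z₀, z₁, r] := List.mem_append_left [z₀, z₁, r] ha
          simp only [List.mem_append] at h
          rcases h with h | h | h
          · exact hKx₀ a h haK
          · exact hKx₁ a h haK
          · exact List.disjoint_of_nodup_append (l₁ := [α, β]) (l₂ := [z₀, z₁, r]) hnd ha h
        have hα := e' α (hnot α (by simp))
        have hβ := e' β (hnot β (by simp))
        have := hαβ t' ht' (by rw [hz₀ t' ht' t ht, hz₁ t' ht' t ht, e])
        rw [← hα, ← hβ] at this
        simpa [n₁] using this
      have hdown : ∀ t ∈ T₀ ∪ T₁, ∃ s ∈ X, ∀ a, a ∉ V → s a = t a := by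
        intro t ht
        obtain ⟨_, ⟨s, hs, p, q, rfl⟩, e⟩ := hX t ht
        refine ⟨s, hs, fun a ha => ?_⟩
        obtain ⟨i, j, k⟩ := hVmem a ha
        rw [← e a k]
        simp [i, j]
      refine ⟨{s ∈ X | ∃ t ∈ T₀, ∀ a, a ∉ V → s a = t a},
        {s ∈ X | ∃ t ∈ T₁, ∀ a, a ∉ V → s a = t a}, ?_, ?_, ?_⟩
      · ext s
        constructor
        · rintro (h | h) <;> exact h.1
        · intro hs
          obtain ⟨t, ht, e⟩ := hX' _ ⟨s, hs, s α, s β, rfl⟩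
          have e' : ∀ a, a ∉ V → s a = t a := fun a ha => by
            rw [← e a (hVmem a ha).2.2]
            simp
          exact ht.imp (fun h => ⟨hs, t, h, e'⟩) fun h => ⟨hs, t, h, e'⟩
      · refine sat_exIndep_of_part (fun a ha h => ?_) ha₀ hz₀ hr₀ hr₁ hsep hTC
          fun t ht => hdown t (Or.inl ht)
        rcases hVK a ha with ha | ha | ha
        · exact hK₀ a ha (fv_subset_vars _ h)
        · exact (mem_fv_exL.1 h).2 ha
        · exact h₁ a ha (fv_subset_vars _ h)
      · rw [Set.union_comm] at ha₁ hz₁ hsep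
        refine sat_exIndep_of_part (fun a ha h => ?_) ha₁ hz₁ hr₁ hr₀
          (fun t ht e => hsep t ht e.symm) hTD fun t ht => hdown t (Or.inr ht)
        rcases hVK a ha with ha | ha | ha
        · exact hK₁ a ha (fv_subset_vars _ h)
        · exact h₀ a ha (fv_subset_vars _ h)
        · exact (mem_fv_exL.1 h).2 ha
  · intro a ha
    have hwc : ∀ (b : IAtom) (x : List ℕ), b.Within x → a ∈ (b.withCond r : Formula L).fv →
        a ∈ x ∨ a = r := by
      intro b x hb h
      simp only [IAtom.withCond, mem_fv_indepVar, List.mem_append, List.mem_singleton] at h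
      rcases h with h | (h | h) | h
      · exact Or.inl (hb.1 h)
      · exact Or.inl (hb.2.1 h)
      · exact Or.inr h
      · exact Or.inl (hb.2.2 h)
    simp only [distribConclusion, ← exL_append, fv, Finset.mem_erase, mem_fv_exL, mem_fv_conj,
      List.mem_append, List.mem_map, List.mem_cons, List.not_mem_nil, or_false, not_or,
      Finset.mem_union, Term.varFinset, Finset.mem_singleton] at ha
    obtain ⟨hβ, hα, h, hx₀, hx₁, hz₀, hz₁, hr⟩ := ha
    rcases h with ⟨B, ⟨b, hb, rfl⟩ | rfl | rfl | rfl, hB⟩ | (h | h | h) | h | h | h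
    · rcases hb with hb | hb
      · rcases hwc b x₀ (hat₀ b hb) hB with h | h <;> contradiction
      · rcases hwc b x₁ (hat₁ b hb) hB with h | h <;> contradiction
    · simp [constAtom, mem_fv_indepVar, hz₀] at hB
    · simp [constAtom, mem_fv_indepVar, hz₁] at hB
    · simp [fv, Term.varFinset, hz₀, hz₁, hα, hβ] at hB
    · exact Finset.mem_union_left _ (hE _ _ _ a h hx₀)
    · contradiction
    · contradiction
    · exact Finset.mem_union_right _ (hE _ _ _ a h hx₁)
    · contradiction
    · contradiction

/-! ### Naming the terms of independence atoms -/

namespace Formula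

/-- Independence atoms, of arbitrary terms. -/
def IsIndep (B : Formula L) : Prop := ∃ t₁ t₃ t₂, B = indep t₁ t₃ t₂

theorem isIndep_indepVar (u w v : List ℕ) : (indepVar (L := L) u w v).IsIndep := ⟨_, _, _, rfl⟩

theorem isIndep_map (ats : List IAtom) : ∀ F ∈ ats.map (IAtom.toFormula (L := L)), F.IsIndep := by
  intro F hF
  obtain ⟨a, -, rfl⟩ := List.mem_map.1 hF
  exact isIndep_indepVar _ _ _

/-- The independence atom whose three tuples are the consecutive parts of `ts`, of which the first
two have the lengths `k` and `l`. -/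
def splitIndep (k l : ℕ) (ts : List (L.Term ℕ)) : Formula L :=
  indep (ts.take k) ((ts.drop k).take l) ((ts.drop k).drop l)

theorem mem_fv_splitIndep {k l : ℕ} {ts : List (L.Term ℕ)} {a : ℕ} :
    a ∈ (splitIndep k l ts).fv ↔ a ∈ tupleVars ts := by
  have happ : ∀ l₁ l₂ : List (L.Term ℕ),
      a ∈ tupleVars (l₁ ++ l₂) ↔ a ∈ tupleVars l₁ ∨ a ∈ tupleVars l₂ := by
    intro l₁ l₂
    simp only [mem_tupleVars, List.mem_append, or_and_right, exists_or]
  conv_rhs => rw [← List.take_append_drop k ts, ← List.take_append_drop l (ts.drop k)]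
  simp only [splitIndep, fv, Finset.mem_union, happ]
  tauto

theorem subst_splitIndep (k l : ℕ) (ts : List (L.Term ℕ)) (σ : ℕ → L.Term ℕ) :
    (splitIndep k l ts).subst σ = splitIndep k l (ts.map fun t => t.subst σ) := by
  simp only [splitIndep, subst, List.map_take, List.map_drop]

end Formula

theorem exists_forall_add_notMem (S : Finset ℕ) : ∃ N, ∀ k, N + k ∉ S :=
  ⟨S.sup id + 1, fun k h => by
    have : S.sup id + 1 + k ≤ S.sup id := Finset.le_sup (f := id) h
    omega⟩

namespace Reduces

variable {A A' B B' C : Formula L}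

/-- The terms of an independence atom after the first few are named by new variables. -/
theorem name_splitIndep (k l : ℕ) (ts ds : List (L.Term ℕ)) (S : Finset ℕ) :
    ∃ (zs : List ℕ) (es : List (Formula L)), zs.Nodup ∧ (∀ a ∈ zs, a ∉ S) ∧
      (∀ e ∈ es, e.IsFO ∧ e.IsQF) ∧
      Reduces.{u, v, w} (splitIndep k l (ds ++ ts))
        (exL zs (conj es (splitIndep k l (ds ++ varTuple zs)))) := by
  induction ts generalizing ds S with
  | nil => exact ⟨[], [], by simp, by simp, by simp, refl _⟩
  | cons t ts ih =>
    obtain ⟨z, hz⟩ := Infinite.exists_notMem_finset (S ∪ tupleVars (ds ++ t :: ts))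
    simp only [Finset.mem_union, not_or, mem_tupleVars, not_exists, not_and, List.mem_append,
      List.mem_cons] at hz
    obtain ⟨hzS, hz⟩ := hz
    have hzt : z ∉ t.varFinset := hz t (by simp)
    obtain ⟨zs, es, hnd, hzs, hes, h⟩ := ih (ds ++ [Term.var z]) (insert z (S ∪ t.varFinset))
    simp only [Finset.mem_insert, Finset.mem_union, not_or] at hzs
    have hsub : (splitIndep k l (ds ++ [Term.var z] ++ ts)).subst1 t z =
        splitIndep k l (ds ++ t :: ts) := by
      have hfix : ∀ us : List (L.Term ℕ), (∀ t' ∈ us, z ∉ t'.varFinset) →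
          us.map (fun t' => t'.subst (Function.update Term.var z t)) = us := fun us hus =>
        map_subst_var fun a ha => Function.update_of_ne (fun e => by
          obtain ⟨t', ht', h⟩ := mem_tupleVars.1 ha
          exact hus t' ht' (e ▸ h)) _ _
      rw [subst1, subst_splitIndep]
      simp only [List.map_append, List.map_cons, Term.subst, Function.update_self,
        hfix ds fun t' h => hz t' (Or.inl h), hfix ts fun t' h => hz t' (Or.inr (Or.inr h)),
        List.append_assoc, List.singleton_append]
    have hname : Reduces.{u, v, w} ((splitIndep k l (ds ++ [Term.var z] ++ ts)).subst1 t z)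
        (ex z (and (eq (Term.var z) t) (splitIndep k l (ds ++ [Term.var z] ++ ts)))) := by
      refine name_term hzt trivial ?_
      rw [hsub]
      intro a ha
      simp only [fv, Finset.mem_erase, Finset.mem_union, mem_fv_splitIndep, mem_tupleVars,
        List.mem_append, List.mem_cons, List.not_mem_nil, or_false, Term.varFinset] at ha ⊢
      obtain ⟨haz, (ha | ha) | ⟨t', (ht' | rfl) | ht', h'⟩⟩ := ha
      · exact absurd (Finset.mem_singleton.1 ha) haz
      · exact ⟨t, Or.inr (Or.inl rfl), ha⟩
      · exact ⟨t', Or.inl ht', h'⟩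
      · exact absurd (by simpa [Term.varFinset] using h') haz
      · exact ⟨t', Or.inr (Or.inr ht'), h'⟩
    rw [hsub] at hname
    refine ⟨z :: zs, eq (Term.var z) t :: es, List.nodup_cons.2 ⟨fun h => (hzs z h).1 rfl, hnd⟩,
      ?_, ?_, hname.trans (ex_congr z (((refl _).and_congr h).trans ?_))⟩
    · rintro a (_ | ⟨_, ha⟩)
      · exact hzS
      · exact (hzs a ha).2.1
    · rintro e (_ | ⟨_, he⟩)
      · exact ⟨trivial, trivial⟩
      · exact hes e he
    · have e : ds ++ [Term.var z] ++ varTuple zs = ds ++ varTuple (z :: zs) := by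
        simp [varTuple]
      rw [e]
      refine and_exL fun a ha => ?_
      simp only [fv, Finset.mem_union, Term.varFinset, Finset.mem_singleton, not_or]
      exact ⟨(hzs a ha).1, (hzs a ha).2.2⟩

/-- An independence atom of terms is an existentially quantified atom of variables. -/
theorem name_indep (hB : B.IsIndep) (S : Finset ℕ) :
    ∃ (zs : List ℕ) (a : IAtom) (es : List (Formula L)), zs.Nodup ∧ (∀ b ∈ zs, b ∉ S) ∧
      a.Within zs ∧ (∀ e ∈ es, e.IsFO ∧ e.IsQF) ∧
      Reduces.{u, v, w} B (exL zs (conj es a.toFormula)) := by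
  obtain ⟨t₁, t₃, t₂, rfl⟩ := hB
  obtain ⟨zs, es, hnd, hzs, hes, h⟩ :=
    name_splitIndep.{u, v, w} t₁.length t₃.length (t₁ ++ (t₃ ++ t₂)) [] S
  refine ⟨zs, ⟨zs.take t₁.length, (zs.drop t₁.length).take t₃.length,
    (zs.drop t₁.length).drop t₃.length⟩, es, hnd, hzs, ⟨List.take_subset _ _,
      fun _ h => List.mem_of_mem_drop (List.mem_of_mem_take h),
      fun _ h => List.mem_of_mem_drop (List.mem_of_mem_drop h)⟩, hes, ?_⟩
  have e₁ : splitIndep t₁.length t₃.length ([] ++ (t₁ ++ (t₃ ++ t₂))) = indep t₁ t₃ t₂ := by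
    simp [splitIndep]
  rw [e₁] at h
  simpa [splitIndep, IAtom.toFormula, indepVar, varTuple, List.map_take, List.map_drop] using h

theorem conj_and_atom (es Bs : List (Formula L)) :
    Reduces.{u, v, w} (and (conj es A) (conj Bs B)) (conj (A :: Bs) (conj es B)) := by
  induction es with
  | nil => exact refl _
  | cons e es ih =>
    exact (and_assoc _ _ _).trans (((refl e).and_congr ih).trans (and_conj (A :: Bs) e (conj es B)))

/-- In a conjunction of independence atoms and a quantifier-free formula, the atoms can be replaced
by atoms of new existentially quantified variables. -/
theorem name_conj {Bs : List (Formula L)} (hBs : ∀ B ∈ Bs, B.IsIndep) {θ : Formula L}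
    (hfo : θ.IsFO) (hqf : θ.IsQF) (S : Finset ℕ) :
    ∃ (ys : List ℕ) (atoms : List IAtom) (θ' : Formula L), ys.Nodup ∧ (∀ b ∈ ys, b ∉ S) ∧
      (∀ a ∈ atoms, a.Within ys) ∧ θ'.IsFO ∧ θ'.IsQF ∧
      Reduces.{u, v, w} (conj Bs θ) (exIndep ys atoms θ') := by
  induction Bs generalizing S with
  | nil => exact ⟨[], [], θ, by simp, by simp, by simp, hfo, hqf, refl _⟩
  | cons B Bs ih =>
    obtain ⟨zs, a, es, hnd, hzs, ha, hes, h⟩ :=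
      name_indep.{u, v, w} (hBs B (by simp)) (S ∪ (conj Bs θ).fv)
    obtain ⟨ys, atoms, θ', hnd', hys, hat, hfo', hqf', h'⟩ :=
      ih (fun C hC => hBs C (by simp [hC])) (S ∪ zs.toFinset ∪ (conj es (a.toFormula (L := L))).fv)
    simp only [Finset.mem_union, not_or, List.mem_toFinset] at hzs hys
    have hfo'' : (conj es θ').IsFO ∧ (conj es θ').IsQF := by
      clear h
      induction es with
      | nil => exact ⟨hfo', hqf'⟩
      | cons e es ih' =>
        have := ih' (fun e he => hes e (by simp [he])) (fun b hb => ⟨(hys b hb).1, fun h =>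
          (hys b hb).2 (Finset.mem_union_right _ h)⟩)
        have he := hes e (by simp)
        exact ⟨⟨he.1, this.1⟩, he.2, this.2⟩
    refine ⟨zs ++ ys, a :: atoms, conj es θ', ?_, ?_, ?_, hfo''.1, hfo''.2,
      (h.and_congr h').trans ((exL_and ?_).trans ?_)⟩
    · exact List.Nodup.append hnd hnd' fun b hb hb' => (hys b hb').1.2 hb
    · intro b hb
      rcases List.mem_append.1 hb with hb | hb
      · exact (hzs b hb).1
      · exact (hys b hb).1.1
    · rintro b (_ | ⟨_, hb⟩)
      · exact ⟨fun c hc => List.mem_append_left _ (ha.1 hc),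
          fun c hc => List.mem_append_left _ (ha.2.1 hc),
          fun c hc => List.mem_append_left _ (ha.2.2 hc)⟩
      · have := hat b hb
        exact ⟨fun c hc => List.mem_append_right _ (this.1 hc),
          fun c hc => List.mem_append_right _ (this.2.1 hc),
          fun c hc => List.mem_append_right _ (this.2.2 hc)⟩
    · exact fun b hb hb' => (hzs b hb).2 (h'.fv_subset hb')
    · rw [exIndep, exIndep, exL_append]
      exact exL_congr zs ((and_exL fun b hb => (hys b hb).2).trans
        (exL_congr ys (conj_and_atom es _)))

/-! ### Quantifier prefixes under the connectives -/

theorem prenex_and {xs y : List ℕ} {Bs : List (Formula L)} {θ F : Formula L}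
    (hxs : ∀ a ∈ xs, a ∉ F.fv) (hy : ∀ a ∈ y, a ∉ F.fv) :
    Reduces.{u, v, w} (and (allL xs (exL y (conj Bs θ))) F) (allL xs (exL y (conj (F :: Bs) θ))) :=
  (allL_and hxs).trans (allL_congr xs ((exL_and hy).trans (exL_congr y (and_comm _ _))))

/-- A universal prefix is pulled out of the left disjunct; the independence atoms that this creates
are added to the atoms of that disjunct. -/
theorem prenex_or {xs y : List ℕ} {Bs : List (Formula L)} {θ : Formula L}
    (hBs : ∀ F ∈ Bs, F.IsIndep) (hnd : (xs ++ y).Nodup) (hB : ∀ a ∈ xs ++ y, a ∉ B.fv) :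
    ∃ Bs' : List (Formula L), (∀ F ∈ Bs', F.IsIndep) ∧
      Reduces.{u, v, w} (or (allL xs (exL y (conj Bs θ))) B)
        (allL xs (or (exL y (conj Bs' θ)) B)) := by
  induction xs generalizing Bs with
  | nil => exact ⟨Bs, hBs, refl _⟩
  | cons x xs ih =>
    rw [List.cons_append, List.nodup_cons] at hnd
    obtain ⟨l, hl, h⟩ := all_or.{u, v, w} (A := allL xs (exL y (conj Bs θ))) (hB x (by simp))
    have hat : ∀ a ∈ xs ++ y, a ∉ (indepVar (L := L) [x] [] l).fv := by
      intro a ha h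
      rcases mem_fv_indepVar.1 h with h | h | h
      · exact hnd.1 (by simpa [List.mem_singleton.1 h] using ha)
      · simp at h
      · rcases Finset.mem_union.1 (hl a h).1 with h | h
        · rw [mem_fv_allL, mem_fv_exL] at h
          rcases List.mem_append.1 ha with ha | ha
          · exact h.2 ha
          · exact h.1.2 ha
        · exact hB a (by simp [List.mem_append.1 ha]) h
    obtain ⟨Bs', hBs', h'⟩ := ih (Bs := indepVar [x] [] l :: Bs) (by
      rintro F (_ | ⟨_, hF⟩)
      · exact isIndep_indepVar _ _ _
      · exact hBs F hF) hnd.2 fun a ha => hB a (by simp [List.mem_append.1 ha])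
    exact ⟨Bs', hBs', h.trans (all_congr x ((or_congr (prenex_and
      (fun a ha => hat a (List.mem_append_left _ ha))
      fun a ha => hat a (List.mem_append_right _ ha)) (refl B)).trans h'))⟩

/-- An existential quantifier is moved behind a universal prefix; the independence atoms that this
creates are added to the atoms of the matrix. -/
theorem prenex_ex {x : ℕ} {xs y : List ℕ} {Bs : List (Formula L)} {θ : Formula L}
    (hBs : ∀ F ∈ Bs, F.IsIndep) (hnd : (xs ++ y).Nodup) (hx : x ∉ xs ++ y) :
    ∃ Bs' : List (Formula L), (∀ F ∈ Bs', F.IsIndep) ∧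
      Reduces.{u, v, w} (ex x (allL xs (exL y (conj Bs θ))))
        (allL xs (exL (x :: y) (conj Bs' θ))) := by
  induction xs generalizing Bs with
  | nil => exact ⟨Bs, hBs, refl _⟩
  | cons x' xs ih =>
    rw [List.cons_append, List.nodup_cons] at hnd
    rw [List.cons_append, List.mem_cons, not_or] at hx
    obtain ⟨l, hl, h⟩ := ex_all.{u, v, w} (A := allL xs (exL y (conj Bs θ))) hx.1
    have hat : ∀ a ∈ xs ++ y, a ∉ (indepVar (L := L) [x] l [x']).fv := by
      intro a ha h
      rcases mem_fv_indepVar.1 h with h | h | h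
      · exact hx.2 (by simpa [List.mem_singleton.1 h] using ha)
      · have h := hl a h
        rw [mem_fv_allL, mem_fv_exL] at h
        rcases List.mem_append.1 ha with ha | ha
        · exact h.2 ha
        · exact h.1.2 ha
      · exact hnd.1 (by simpa [List.mem_singleton.1 h] using ha)
    obtain ⟨Bs', hBs', h'⟩ := ih (Bs := indepVar [x] l [x'] :: Bs) (by
      rintro F (_ | ⟨_, hF⟩)
      · exact isIndep_indepVar _ _ _
      · exact hBs F hF) hnd.2 hx.2
    exact ⟨Bs', hBs', h.trans (all_congr x' ((ex_congr x (prenex_and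
      (fun a ha => hat a (List.mem_append_left _ ha))
      fun a ha => hat a (List.mem_append_right _ ha))).trans h'))⟩

end Reduces

/-! ### Normal forms -/

/-- `A` reduces to a formula in normal form none of whose quantified variables is in `S`. -/
def HasNormalForm (S : Finset ℕ) (A : Formula L) : Prop :=
  ∃ (x y : List ℕ) (atoms : List IAtom) (θ : Formula L),
    (x ++ y).Nodup ∧ (∀ a ∈ x ++ y, a ∉ S) ∧ (∀ a ∈ atoms, a.Within y) ∧ θ.IsFO ∧ θ.IsQF ∧
      Reduces.{u, v, w} A (allL x (exIndep y atoms θ))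

theorem mem_vars_exIndep {x : List ℕ} {atoms : List IAtom} {θ : Formula L} (hqf : θ.IsQF) {a : ℕ}
    (h : a ∈ (exIndep x atoms θ).vars) : a ∈ x ∨ a ∈ (exIndep x atoms θ).fv := by
  have hQ : (conj (atoms.map IAtom.toFormula) θ).IsQF := by
    refine isQF_conj (fun B hB => ?_) hqf
    obtain ⟨a, -, rfl⟩ := List.mem_map.1 hB
    trivial
  by_cases hx : a ∈ x
  · exact Or.inl hx
  · rw [exIndep, mem_vars_exL, hQ.vars_eq] at h
    exact Or.inr (mem_fv_exL.2 ⟨h.resolve_right hx, hx⟩)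

namespace HasNormalForm

variable {A B : Formula L} {S : Finset ℕ}

theorem of_reduces (h : Reduces.{u, v, w} A B) (hB : HasNormalForm.{u, v, w} S B) :
    HasNormalForm.{u, v, w} S A := by
  obtain ⟨x, y, atoms, θ, h₁, h₂, h₃, h₄, h₅, h₆⟩ := hB
  exact ⟨x, y, atoms, θ, h₁, h₂, h₃, h₄, h₅, h.trans h₆⟩

/-- It suffices to reach the quantifier prefix of a normal form, with arbitrary atoms. -/
theorem of_prenex {x y : List ℕ} {Bs : List (Formula L)} {θ : Formula L}
    (hnd : (x ++ y).Nodup) (hS : ∀ a ∈ x ++ y, a ∉ S) (hBs : ∀ B ∈ Bs, B.IsIndep) (hfo : θ.IsFO)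
    (hqf : θ.IsQF) (h : Reduces.{u, v, w} A (allL x (exL y (conj Bs θ)))) :
    HasNormalForm.{u, v, w} S A := by
  obtain ⟨ys, atoms, θ', hnd', hys, hat, hfo', hqf', h'⟩ :=
    Reduces.name_conj.{u, v, w} hBs hfo hqf (S ∪ (x ++ y).toFinset)
  simp only [Finset.mem_union, not_or, List.mem_toFinset] at hys
  refine ⟨x, y ++ ys, atoms, θ', ?_, ?_, ?_, hfo', hqf', h.trans (Reduces.allL_congr x ?_)⟩
  · rw [← List.append_assoc]
    exact List.Nodup.append hnd hnd' fun b hb hb' => (hys b hb').2 hb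
  · intro a ha
    rw [← List.append_assoc] at ha
    rcases List.mem_append.1 ha with ha | ha
    · exact hS a ha
    · exact (hys a ha).1
  · exact fun a ha => ⟨fun c hc => List.mem_append_right _ ((hat a ha).1 hc),
      fun c hc => List.mem_append_right _ ((hat a ha).2.1 hc),
      fun c hc => List.mem_append_right _ ((hat a ha).2.2 hc)⟩
  · rw [exIndep, exL_append]
    exact Reduces.exL_congr y h'

theorem of_isQF (hfo : A.IsFO) (hqf : A.IsQF) : HasNormalForm.{u, v, w} S A :=
  ⟨[], [], [], A, by simp, by simp, by simp, hfo, hqf, Reduces.refl A⟩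

/-- An independence atom is given the trivial quantifier-free part `z = z`, with a quantified `z`:
a vocabulary without constants has no quantifier-free first-order sentence. -/
theorem of_indep (t₁ t₃ t₂ : List (L.Term ℕ)) : HasNormalForm.{u, v, w} S (indep t₁ t₃ t₂) := by
  obtain ⟨z, hz⟩ := Infinite.exists_notMem_finset (S ∪ (indep t₁ t₃ t₂).fv)
  rw [Finset.mem_union, not_or] at hz
  refine of_prenex (x := []) (y := [z]) (Bs := [indep t₁ t₃ t₂])
    (θ := Formula.eq (Term.var z) (Term.var z)) (by simp) (by simpa using hz.1) ?_ trivial trivial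
    (Reduces.of_iff (Deriv.hyp.andI (.eqRefl z)).ex_intro (fun M _ _ X => ?_) ?_)
  · rintro B (_ | ⟨_, hB⟩)
    · exact ⟨_, _, _, rfl⟩
    · cases hB
  · constructor
    · intro h
      have hF : ∀ s ∈ X, ((fun _ => Set.univ : (ℕ → M) → Set M) s).Nonempty :=
        fun _ _ => Set.univ_nonempty
      exact ⟨_, hF, (sat_supplement_iff hz.2 hF).2 h, fun _ _ => rfl⟩
    · rintro ⟨F, hF, h, -⟩
      exact (sat_supplement_iff hz.2 hF).1 h
  · intro a ha
    simp only [allL, exL, conj, List.foldr_nil, List.foldr_cons, fv, Finset.mem_erase,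
      Finset.mem_union, Term.varFinset, Finset.mem_singleton] at ha ⊢
    tauto

theorem and (hA : ∀ S, HasNormalForm.{u, v, w} S A) (hB : ∀ S, HasNormalForm.{u, v, w} S B)
    (S : Finset ℕ) : HasNormalForm.{u, v, w} S (and A B) := by
  obtain ⟨x₀, y₀, at₀, θ₀, nd₀, av₀, -, fo₀, qf₀, h₀⟩ := hA (S ∪ B.fv)
  obtain ⟨x₁, y₁, at₁, θ₁, nd₁, av₁, -, fo₁, qf₁, h₁⟩ :=
    hB (S ∪ (x₀ ++ y₀).toFinset ∪ A.fv)
  simp only [Finset.mem_union, not_or, List.mem_toFinset, List.mem_append] at av₀ av₁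
  have hf₀ : ∀ a ∈ (exIndep y₀ at₀ θ₀).fv, a ∈ A.fv ∨ a ∈ x₀ := fun a ha => by
    by_cases hx : a ∈ x₀
    · exact Or.inr hx
    · exact Or.inl (h₀.fv_subset (mem_fv_allL.2 ⟨ha, hx⟩))
  have hf₁ : ∀ a ∈ (exIndep y₁ at₁ θ₁).fv, a ∈ B.fv ∨ a ∈ x₁ := fun a ha => by
    by_cases hx : a ∈ x₁
    · exact Or.inr hx
    · exact Or.inl (h₁.fv_subset (mem_fv_allL.2 ⟨ha, hx⟩))
  refine of_prenex (x := x₀ ++ x₁) (y := y₀ ++ y₁)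
    (Bs := at₀.map IAtom.toFormula ++ at₁.map IAtom.toFormula) (θ := Formula.and θ₀ θ₁)
    ?_ ?_ ?_ ⟨fo₀, fo₁⟩ ⟨qf₀, qf₁⟩ ((h₀.and_congr h₁).trans ?_)
  · simp only [List.nodup_append, List.mem_append] at nd₀ nd₁ ⊢
    grind
  · simp only [List.mem_append]
    grind
  · intro F hF
    rcases List.mem_append.1 hF with hF | hF
    · exact isIndep_map _ F hF
    · exact isIndep_map _ F hF
  · rw [allL_append, exL_append]
    refine (Reduces.allL_and fun a ha h => ?_).trans (Reduces.allL_congr x₀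
      ((Reduces.and_allL fun a ha h => ?_).trans (Reduces.allL_congr x₁
      ((Reduces.exL_and fun a ha h => ?_).trans (Reduces.exL_congr y₀
      ((Reduces.and_exL fun a ha h => ?_).trans (Reduces.exL_congr y₁
      (Reduces.conj_and_conj _ _ _ _))))))))
    · exact (av₀ a (Or.inl ha)).2 (h₁.fv_subset h)
    · rcases hf₀ a h with h | h
      · exact (av₁ a (Or.inl ha)).2 h
      · exact (av₁ a (Or.inl ha)).1.2.1 h
    · rcases hf₁ a h with h | h
      · exact (av₀ a (Or.inr ha)).2 h
      · exact (av₁ a (Or.inl h)).1.2.2 ha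
    · by_cases hy : a ∈ y₀
      · exact (av₁ a (Or.inr ha)).1.2.2 hy
      · rcases hf₀ a (mem_fv_exL.2 ⟨h, hy⟩) with h | h
        · exact (av₁ a (Or.inr ha)).2 h
        · exact (av₁ a (Or.inr ha)).1.2.1 h

theorem all {x : ℕ} (h : ∀ z S, HasNormalForm.{u, v, w} S (A.subst1 (Term.var z) x))
    (S : Finset ℕ) : HasNormalForm.{u, v, w} S (all x A) := by
  obtain ⟨z, hz⟩ := Infinite.exists_notMem_finset (S ∪ A.vars)
  rw [Finset.mem_union, not_or] at hz
  obtain ⟨xs, y, atoms, θ, hnd, hS, hat, hfo, hqf, h'⟩ := h z (insert z S)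
  simp only [Finset.mem_insert, not_or] at hS
  refine ⟨z :: xs, y, atoms, θ, ?_, ?_, hat, hfo, hqf,
    (Reduces.rename_all hz.2).trans (Reduces.all_congr z h')⟩
  · exact List.nodup_cons.2 ⟨fun h => (hS z h).1 rfl, hnd⟩
  · rintro a (_ | ⟨_, ha⟩)
    · exact hz.1
    · exact (hS a ha).2

theorem ex {x : ℕ} (h : ∀ z S, HasNormalForm.{u, v, w} S (A.subst1 (Term.var z) x))
    (S : Finset ℕ) : HasNormalForm.{u, v, w} S (ex x A) := by
  obtain ⟨z, hz⟩ := Infinite.exists_notMem_finset (S ∪ A.vars)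
  rw [Finset.mem_union, not_or] at hz
  obtain ⟨xs, y, atoms, θ, hnd, hS, -, hfo, hqf, h'⟩ := h z (insert z S)
  simp only [Finset.mem_insert, not_or] at hS
  obtain ⟨Bs, hBs, h''⟩ := Reduces.prenex_ex.{u, v, w} (θ := θ) (isIndep_map atoms) hnd
    fun h => (hS z h).1 rfl
  refine of_prenex ?_ ?_ hBs hfo hqf
    ((Reduces.rename_ex hz.2).trans ((Reduces.ex_congr z h').trans h''))
  · rw [List.nodup_middle]
    exact List.nodup_cons.2 ⟨fun h => (hS z h).1 rfl, hnd⟩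
  · intro a ha
    rw [List.mem_append, List.mem_cons] at ha
    rcases ha with ha | rfl | ha
    · exact (hS a (List.mem_append_left _ ha)).2
    · exact hz.1
    · exact (hS a (List.mem_append_right _ ha)).2

theorem or (hA : ∀ S, HasNormalForm.{u, v, w} S A) (hB : ∀ S, HasNormalForm.{u, v, w} S B)
    (S : Finset ℕ) : HasNormalForm.{u, v, w} S (or A B) := by
  obtain ⟨x₀, y₀, at₀, θ₀, nd₀, av₀, -, fo₀, qf₀, h₀⟩ := hA (S ∪ A.fv ∪ B.fv)
  obtain ⟨x₁, y₁, at₁, θ₁, nd₁, av₁, -, fo₁, qf₁, h₁⟩ :=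
    hB (S ∪ A.fv ∪ B.fv ∪ (x₀ ++ y₀).toFinset)
  simp only [Finset.mem_union, not_or, List.mem_toFinset] at av₀ av₁
  obtain ⟨Bs₀, hBs₀, k₀⟩ := Reduces.prenex_or.{u, v, w} (θ := θ₀) (isIndep_map at₀) nd₀
    (B := allL x₁ (exIndep y₁ at₁ θ₁)) fun a ha h => (av₀ a ha).2 (h₁.fv_subset h)
  have hE₀ : ∀ a ∈ (exL y₀ (conj Bs₀ θ₀)).fv, a ∈ x₀ ∨ a ∈ A.fv ∨ a ∈ B.fv := by
    intro a ha
    by_cases hx : a ∈ x₀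
    · exact Or.inl hx
    · exact Or.inr ((Finset.mem_union.1 (k₀.fv_subset
        (mem_fv_allL.2 ⟨Finset.mem_union_left _ ha, hx⟩))).imp (fun h => h₀.fv_subset h)
          fun h => h₁.fv_subset h)
  obtain ⟨Bs₁, hBs₁, k₁⟩ := Reduces.prenex_or.{u, v, w} (θ := θ₁) (isIndep_map at₁) nd₁
    (B := exL y₀ (conj Bs₀ θ₀)) fun a ha h => by
      rcases hE₀ a h with h | h | h
      · exact (av₁ a ha).2 (List.mem_append_left _ h)
      · exact (av₁ a ha).1.1.2 h
      · exact (av₁ a ha).1.2 h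
  have hE₁ : ∀ a ∈ (exL y₁ (conj Bs₁ θ₁)).fv, a ∈ x₁ ∨ a ∈ x₀ ∨ a ∈ A.fv ∨ a ∈ B.fv := by
    intro a ha
    by_cases hx : a ∈ x₁
    · exact Or.inl hx
    · rcases Finset.mem_union.1 (k₁.fv_subset (mem_fv_allL.2 ⟨Finset.mem_union_left _ ha, hx⟩))
        with h | h
      · exact Or.inr (Or.inr (Or.inr (h₁.fv_subset h)))
      · exact Or.inr (hE₀ a h)
  -- independence distribution needs atoms of variables from the existential blocks only
  obtain ⟨ys₀, as₀, C, nds₀, avs₀, win₀, foC, qfC, r₀⟩ := Reduces.name_conj.{u, v, w} hBs₀ fo₀ qf₀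
    (S ∪ A.fv ∪ B.fv ∪ (x₀ ++ y₀).toFinset ∪ (x₁ ++ y₁).toFinset)
  obtain ⟨ys₁, as₁, D, nds₁, avs₁, win₁, foD, qfD, r₁⟩ := Reduces.name_conj.{u, v, w} hBs₁ fo₁ qf₁
    (S ∪ A.fv ∪ B.fv ∪ (x₀ ++ y₀).toFinset ∪ (x₁ ++ y₁).toFinset ∪ ys₀.toFinset)
  simp only [Finset.mem_union, not_or, List.mem_toFinset] at avs₀ avs₁
  have g₀ : Reduces.{u, v, w} (exL y₀ (conj Bs₀ θ₀)) (exIndep (y₀ ++ ys₀) as₀ C) := by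
    rw [exIndep, exL_append]
    exact Reduces.exL_congr y₀ r₀
  have g₁ : Reduces.{u, v, w} (exL y₁ (conj Bs₁ θ₁)) (exIndep (y₁ ++ ys₁) as₁ D) := by
    rw [exIndep, exL_append]
    exact Reduces.exL_congr y₁ r₁
  have hG₀ : ∀ a ∈ (exIndep (y₀ ++ ys₀) as₀ C).vars,
      a ∈ y₀ ∨ a ∈ ys₀ ∨ a ∈ x₀ ∨ a ∈ A.fv ∨ a ∈ B.fv := by
    intro a ha
    rcases mem_vars_exIndep qfC ha with h | h
    · exact (List.mem_append.1 h).imp_right Or.inl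
    · exact Or.inr (Or.inr (hE₀ a (g₀.fv_subset h)))
  have hG₁ : ∀ a ∈ (exIndep (y₁ ++ ys₁) as₁ D).vars,
      a ∈ y₁ ∨ a ∈ ys₁ ∨ a ∈ x₁ ∨ a ∈ x₀ ∨ a ∈ A.fv ∨ a ∈ B.fv := by
    intro a ha
    rcases mem_vars_exIndep qfD ha with h | h
    · exact (List.mem_append.1 h).imp_right Or.inl
    · exact Or.inr (Or.inr (hE₁ a (g₁.fv_subset h)))
  have within : ∀ {y ys : List ℕ} {ats : List IAtom}, (∀ a ∈ ats, a.Within ys) →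
      ∀ a ∈ ats, a.Within (y ++ ys) := fun h a ha =>
    ⟨fun c hc => List.mem_append_right _ ((h a ha).1 hc),
      fun c hc => List.mem_append_right _ ((h a ha).2.1 hc),
      fun c hc => List.mem_append_right _ ((h a ha).2.2 hc)⟩
  obtain ⟨N, hN⟩ := exists_forall_add_notMem (S ∪ (x₀ ++ x₁).toFinset ∪
    ((exIndep (y₁ ++ ys₁) as₁ D).vars ∪ (exIndep (y₀ ++ ys₀) as₀ C).vars))
  simp only [Finset.mem_union, not_or, List.mem_toFinset] at hN
  have hK : ∀ a ∈ [N, N + 1, N + 2, N + 3, N + 4], ∃ k, a = N + k := by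
    intro a ha
    refine ⟨a - N, ?_⟩
    simp only [List.mem_cons, List.not_mem_nil, or_false] at ha
    omega
  have hfresh : ∀ a ∈ [N, N + 1, N + 2, N + 3, N + 4], a ∉ S ∧ a ∉ x₀ ∧ a ∉ x₁ ∧
      a ∉ y₀ ++ ys₀ ∧ a ∉ y₁ ++ ys₁ := by
    intro a ha
    obtain ⟨k, rfl⟩ := hK a ha
    have := (hN k).1
    rw [List.mem_append, not_or] at this
    exact ⟨this.1, this.2.1, this.2.2, fun h => (hN k).2.2 (mem_vars_exL.2 (Or.inr h)),
      fun h => (hN k).2.1 (mem_vars_exL.2 (Or.inr h))⟩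
  have hdist : Reduces.{u, v, w} (Formula.or (exIndep (y₁ ++ ys₁) as₁ D)
      (exIndep (y₀ ++ ys₀) as₀ C)) (distribConclusion (y₁ ++ ys₁) (y₀ ++ ys₀) as₁ as₀ D C
        N (N + 1) (N + 2) (N + 3) (N + 4)) := by
    refine Reduces.distrib foD foC ?_ ?_ (within win₁) (within win₀) (by simp) ?_
    · intro a ha h
      have := hG₀ a h
      simp only [List.mem_append] at *
      grind
    · intro a ha h
      have := hG₁ a h
      simp only [List.mem_append] at *
      grind
    · intro a ha h
      obtain ⟨k, rfl⟩ := hK a ha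
      exact (Finset.mem_union.1 h).elim (hN k).2.1 (hN k).2.2
  refine ⟨x₀ ++ (x₁ ++ [N, N + 1]), (y₁ ++ ys₁) ++ ((y₀ ++ ys₀) ++ [N + 2, N + 3, N + 4]),
    ((as₁ ++ as₀).map fun a => ⟨a.u, a.w ++ [N + 4], a.v⟩) ++
      [⟨[N + 2], [], [N + 2]⟩, ⟨[N + 3], [], [N + 3]⟩],
    Formula.and (Formula.or (neg (eq (Term.var (N + 2)) (Term.var (N + 3))))
        (eq (Term.var N) (Term.var (N + 1))))
      (Formula.or (Formula.and D (eq (Term.var (N + 4)) (Term.var (N + 2))))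
        (Formula.and C (eq (Term.var (N + 4)) (Term.var (N + 3))))),
    ?_, ?_, ?_, ⟨⟨trivial, trivial⟩, ⟨foD, trivial⟩, foC, trivial⟩,
    ⟨⟨trivial, trivial⟩, ⟨qfD, trivial⟩, qfC, trivial⟩, ?_⟩
  · obtain ⟨ndx₀, ndy₀, d₀⟩ := List.nodup_append.1 nd₀
    obtain ⟨ndx₁, ndy₁, d₁⟩ := List.nodup_append.1 nd₁
    refine .append (.append ndx₀ (.append ndx₁ (by simp) ?_) ?_)
      (.append (.append ndy₁ nds₁ ?_) (.append (.append ndy₀ nds₀ ?_) (by simp) ?_) ?_) ?_ <;>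
    · intro a ha hb
      simp only [List.mem_append] at av₁ avs₀ avs₁
      simp only [List.mem_append, List.mem_cons, List.not_mem_nil, or_false] at ha hb hfresh
      grind only
  · intro a ha
    simp only [List.mem_append, List.mem_cons, List.not_mem_nil, or_false] at ha hfresh av₀ av₁
    grind only
  · intro a ha
    rcases List.mem_append.1 ha with ha | ha
    · obtain ⟨b, hb, rfl⟩ := List.mem_map.1 ha
      have hw : b.Within (y₁ ++ ys₁) ∨ b.Within (y₀ ++ ys₀) :=
        (List.mem_append.1 hb).imp (within win₁ b) (within win₀ b)
      simp only [IAtom.Within, List.subset_def, List.mem_append,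
        List.mem_cons, List.not_mem_nil, or_false] at hw ⊢
      grind only
    · simp only [List.mem_cons, List.not_mem_nil, or_false] at ha
      rcases ha with rfl | rfl <;> simp [IAtom.Within]
  · refine (h₀.or_congr h₁).trans (k₀.trans ?_)
    rw [allL_append, allL_append]
    refine Reduces.allL_congr x₀ (((Reduces.or_comm _ _).trans k₁).trans
      (Reduces.allL_congr x₁ ((g₁.or_congr g₀).trans ?_)))
    convert hdist using 1
    simp [distribConclusion, exIndep, allL, conj, IAtom.withCond,
      IAtom.toFormula, constAtom, Function.comp_def, exL]

end HasNormalForm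

/-- The measure of the induction.  It decreases when a negation is moved inwards. -/
def Formula.size : Formula L → ℕ
  | Formula.eq _ _ => 1
  | Formula.rel _ _ => 1
  | Formula.indep _ _ _ => 1
  | Formula.neg A => 2 * A.size
  | Formula.and A B => A.size + B.size + 1
  | Formula.or A B => A.size + B.size + 1
  | Formula.ex _ A => A.size + 1
  | Formula.all _ A => A.size + 1

theorem Formula.size_pos (A : Formula L) : 0 < A.size := by
  induction A with
  | neg A ih => simpa only [size, Nat.ofNat_pos, mul_pos_iff_of_pos_left] using ih
  | _ => simp only [size]; omega

theorem Formula.size_subst (A : Formula L) (σ : ℕ → L.Term ℕ) : (A.subst σ).size = A.size := by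
  induction A generalizing σ with
  | eq | rel | indep => rfl
  | neg A ih => simp only [subst, size, ih]
  | and A B ihA ihB => simp only [subst, size, ihA, ihB]
  | or A B ihA ihB => simp only [subst, size, ihA, ihB]
  | ex x A ih => simp only [subst, size, ih]
  | all x A ih => simp only [subst, size, ih]

/-- Every formula of independence logic has a normal form, with quantified variables outside a given
finite set. -/
theorem hasNormalForm (A : Formula L) (hA : A.WF) (S : Finset ℕ) :
    HasNormalForm.{u, v, w} S A := by
  induction hn : A.size using Nat.strong_induction_on generalizing A S with
  | _ n ih =>
    subst hn
    have ih' : ∀ B : Formula L, B.size < A.size → B.WF → ∀ S, HasNormalForm.{u, v, w} S B :=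
      fun B hB hwf S => ih _ hB B hwf S rfl
    clear ih
    cases A with
    | eq t₁ t₂ => exact .of_isQF trivial trivial
    | rel R ts => exact .of_isQF trivial trivial
    | indep t₁ t₃ t₂ => exact .of_indep t₁ t₃ t₂
    | and A B =>
      exact .and (ih' A (by simp only [size]; omega) hA.1)
        (ih' B (by simp only [size]; omega) hA.2) S
    | or A B =>
      exact .or (ih' A (by simp only [size]; omega) hA.1)
        (ih' B (by simp only [size]; omega) hA.2) S
    | ex x A =>
      exact .ex (fun z => ih' (A.subst1 (Term.var z) x)
        (by simp only [size, subst1, size_subst]; omega) (wf_subst _ hA)) S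
    | all x A =>
      exact .all (fun z => ih' (A.subst1 (Term.var z) x)
        (by simp only [size, subst1, size_subst]; omega) (wf_subst _ hA)) S
    | neg A =>
      cases A with
      | eq t₁ t₂ => exact .of_isQF trivial trivial
      | rel R ts => exact .of_isQF trivial trivial
      | indep t₁ t₃ t₂ => exact hA.elim
      | neg A =>
        have := A.size_pos
        exact .of_reduces (Reduces.neg_neg hA) (ih' A (by simp only [size]; omega) (IsFO.wf hA) S)
      | and A B =>
        exact .of_reduces (Reduces.neg_and hA.1 hA.2)
          (ih' (Formula.or (neg A) (neg B)) (by simp only [size]; omega) hA S)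
      | or A B =>
        exact .of_reduces (Reduces.neg_or hA.1 hA.2)
          (ih' (Formula.and (neg A) (neg B)) (by simp only [size]; omega) hA S)
      | ex x A =>
        exact .of_reduces (Reduces.neg_ex hA)
          (ih' (Formula.all x (neg A)) (by simp only [size]; omega) hA S)
      | all x A =>
        exact .of_reduces (Reduces.neg_all hA)
          (ih' (Formula.ex x (neg A)) (by simp only [size]; omega) hA S)

end IndepLogic

theorem mainTheorem3 {L : FirstOrder.Language.{u, v}} (φ : IndepLogic.Formula L)
    (hφ : φ.WF) (hs : φ.IsSentence) :
    ∃ φ' : IndepLogic.Formula L, IndepLogic.IsNormalForm φ' ∧ φ'.WF ∧ φ'.IsSentence ∧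
      IndepLogic.Deriv {φ} φ' ∧ IndepLogic.Formula.LogEquiv.{u, v, w} φ φ' := by
  obtain ⟨x, y, atoms, θ, hnd, -, hat, hfo, hqf, h⟩ :=
    IndepLogic.hasNormalForm.{u, v, w} φ hφ ∅
  refine ⟨_, ⟨x, y, atoms, θ, hnd, hat, hfo, hqf, rfl⟩, ?_, ?_, h.deriv, h.equiv⟩
  · refine IndepLogic.Formula.wf_allL (IndepLogic.Formula.wf_exL
      (IndepLogic.Formula.wf_conj (fun B hB => ?_) hfo.wf))
    obtain ⟨a, -, rfl⟩ := List.mem_map.1 hB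
    trivial
  · exact Finset.subset_empty.1 (hs ▸ h.fv_subset)
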